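/- There is a single word-RAM program with the following property. Given a permutation $\pi=\pi_1\pi_2\cdots\pi_n$ of $\{1,\dots,n\}$ (the input is $n$ followed by the word $\pi_1\cdots\pi_n$; $n\ge 0$ is arbitrary), the program outputs a longest $(213,231)$-avoiding pattern contained in $\pi$, together with an occurrence of it: it outputs an integer $k$, a permutation $\sigma=\sigma_1\cdots\sigma_k$ of $\{1,\dots,k\}$ and a subsequence $\pi_{i_1}\pi_{i_2}\cdots\pi_{i_k}$ of $\pi$, $i_1<\dots<i_k$, which has the same relative order as $\sigma$, such that $\sigma$ contains neither $213$ nor $231$ and every permutation contained in $\pi$ that contains neither $213$ nor $231$ has length at most $k$. The program runs in $O(n\log\log n)$ time and uses $O(n)$ words of memory in the worst case over all permutations of length $n$. Here a permutation $\pi$ contains $\sigma$ if some subsequence of $\pi$ has the same relative order as $\sigma$. The word RAM has words of $O(\log n)$ bits and random access memory; its unit-cost instructions are constants, copying, loading and storing memory cells, and addition, truncated subtraction, multiplication, integer division with remainder, shifts, bitwise logical operations and comparisons of words. Programs use finitely many registers and combine instructions by sequencing, tests and loops; memory outside the input is initially $0$, and overflows and addresses outside the $O(n)$ available cells must never occur.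 Time is the number of instructions and tests executed, and the memory used includes the input and the output. -/

import Mathlib

/-! ## Permutation patterns -/

/-- An occurrence (a "matching") of the pattern `σ` in the permutation `π`: an increasing choice `f`
of positions of `π` such that the selected elements have the same relative order as `σ`. -/
def IsMatching {k n : ℕ} (σ : Equiv.Perm (Fin k)) (π : Equiv.Perm (Fin n))
    (f : Fin k ↪o Fin n) : Prop :=
  ∀ i j : Fin k, σ i < σ j ↔ π (f i) < π (f j)

/-- `σ ⪯ π`: the permutation `π` matches (contains) the permutation `σ`. -/
def Matches {k n : ℕ} (σ : Equiv.Perm (Fin k)) (π : Equiv.Perm (Fin n)) : Prop :=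
  ∃ f : Fin k ↪o Fin n, IsMatching σ π f

/-- The permutation `213`, with positions and values counted from `0`. -/
def perm213 : Equiv.Perm (Fin 3) := ⟨![1, 0, 2], ![1, 0, 2], by decide, by decide⟩

/-- The permutation `231`, with positions and values counted from `0`. -/
def perm231 : Equiv.Perm (Fin 3) := ⟨![1, 2, 0], ![2, 0, 1], by decide, by decide⟩

/-- `π` is `(213, 231)`-avoiding: it matches neither `213` nor `231`. -/
def Avoids213And231 {n : ℕ} (π : Equiv.Perm (Fin n)) : Prop :=
  ¬ Matches perm213 π ∧ ¬ Matches perm231 π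

/-- `σ` is a longest `(213, 231)`-avoiding pattern contained in `π`. -/
def IsLongestAvoidingPattern {k n : ℕ} (σ : Equiv.Perm (Fin k)) (π : Equiv.Perm (Fin n)) : Prop :=
  Avoids213And231 σ ∧ Matches σ π ∧
    ∀ (m : ℕ) (τ : Equiv.Perm (Fin m)), Avoids213And231 τ → Matches τ π → m ≤ k

/-- The one-line notation `π₁ π₂ … πₙ` of a permutation, with values in `{1, …, n}`. -/
def oneLine {n : ℕ} (π : Equiv.Perm (Fin n)) : List ℕ :=
  List.ofFn fun i => (π i : ℕ) + 1

/-- The subsequence of the word `π₁ π₂ … πₙ` at the positions chosen by `f`. -/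
def subsequenceAt {k n : ℕ} (π : Equiv.Perm (Fin n)) (f : Fin k ↪o Fin n) : List ℕ :=
  List.ofFn fun i => (π (f i) : ℕ) + 1

/-! ## The word RAM

A unit-cost random access machine whose words hold natural numbers of `w` bits and whose memory
consists of the cells `0, …, s - 1`.  Programs are finite pieces of code over registers (so each
program uses a fixed finite number of them), with tests and loops as control structures.  An
instruction whose result does not fit into a word, or which addresses a cell outside of the memory,
has no outcome: a computation that tries to execute it does not terminate successfully. -/

namespace WordRAM

/-- The binary word operations. -/
inductive Op where
  | add | sub | mul | div | mod | shiftLeft | shiftRight | and | or | xor | eq | lt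

/-- The value of a word operation: subtraction is truncated at `0`, `x / 0 = 0`, `x mod 0 = x`, and
comparisons return `1` for true and `0` for false. -/
def Op.eval : Op → ℕ → ℕ → ℕ
  | .add, x, y => x + y
  | .sub, x, y => x - y
  | .mul, x, y => x * y
  | .div, x, y => x / y
  | .mod, x, y => x % y
  | .shiftLeft, x, y => x * 2 ^ y
  | .shiftRight, x, y => x / 2 ^ y
  | .and, x, y => Nat.land x y
  | .or, x, y => Nat.lor x y
  | .xor, x, y => Nat.xor x y
  | .eq, x, y => if x = y then 1 else 0
  | .lt, x, y => if x < y then 1 else 0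

/-- Elementary instructions; arguments other than the operation and the constant `c` are names of
registers. -/
inductive Instr where
  /-- `r := c` -/
  | const (r c : ℕ)
  /-- `r := a` -/
  | copy (r a : ℕ)
  /-- `r := a o b` -/
  | op (o : Op) (r a b : ℕ)
  /-- `r := memory[a]` -/
  | load (r a : ℕ)
  /-- `memory[a] := b` -/
  | store (a b : ℕ)

/-- Programs. -/
inductive Program where
  | skip
  | instr (i : Instr)
  | seq (p q : Program)
  /-- `if r ≠ 0 then p else q` -/
  | branch (r : ℕ) (p q : Program)
  /-- `while r ≠ 0 do p` -/
  | loop (r : ℕ) (p : Program)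

/-- The contents of the registers and of the memory. -/
structure State where
  reg : ℕ → ℕ
  mem : ℕ → ℕ

/-- Write the word `v` into the register `r`, provided that it has at most `w` bits. -/
def State.setReg (w : ℕ) (σ : State) (r v : ℕ) : Option State :=
  if v < 2 ^ w then some { σ with reg := Function.update σ.reg r v } else none

/-- The effect of an elementary instruction, with `w`-bit words and `s` memory cells. -/
def Instr.exec (w s : ℕ) : Instr → State → Option State
  | .const r c, σ => σ.setReg w r c
  | .copy r a, σ => σ.setReg w r (σ.reg a)
  | .op o r a b, σ => σ.setReg w r (o.eval (σ.reg a) (σ.reg b))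
  | .load r a, σ => if σ.reg a < s then σ.setReg w r (σ.mem (σ.reg a)) else none
  | .store a b, σ =>
      if σ.reg a < s then some { σ with mem := Function.update σ.mem (σ.reg a) (σ.reg b) }
      else none

/-- `Runs w s p σ t σ'`: with `w`-bit words and `s` memory cells, the program `p`, started in the
state `σ`, terminates in the state `σ'` after exactly `t` steps.  Every elementary instruction and
every evaluation of a test is one step. -/
inductive Runs (w s : ℕ) : Program → State → ℕ → State → Prop where
  | skip (σ : State) : Runs w s .skip σ 1 σ
  | instr {i : Instr} {σ σ' : State} (h : i.exec w s σ = some σ') : Runs w s (.instr i) σ 1 σ'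
  | seq {p q : Program} {σ σ' σ'' : State} {t t' : ℕ}
      (hp : Runs w s p σ t σ') (hq : Runs w s q σ' t' σ'') :
      Runs w s (.seq p q) σ (t + t') σ''
  | branch_true {r : ℕ} {p q : Program} {σ σ' : State} {t : ℕ}
      (hr : σ.reg r ≠ 0) (hp : Runs w s p σ t σ') : Runs w s (.branch r p q) σ (t + 1) σ'
  | branch_false {r : ℕ} {p q : Program} {σ σ' : State} {t : ℕ}
      (hr : σ.reg r = 0) (hq : Runs w s q σ t σ') : Runs w s (.branch r p q) σ (t + 1) σ'
  | loop_done {r : ℕ} {p : Program} {σ : State}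
      (hr : σ.reg r = 0) : Runs w s (.loop r p) σ 1 σ
  | loop_step {r : ℕ} {p : Program} {σ σ' σ'' : State} {t t' : ℕ}
      (hr : σ.reg r ≠ 0) (hp : Runs w s p σ t σ') (hl : Runs w s (.loop r p) σ' t' σ'') :
      Runs w s (.loop r p) σ (t + t' + 1) σ''

/-- The initial state: the input occupies the first memory cells, everything else is `0`. -/
def initialState (input : List ℕ) : State where
  reg := fun _ => 0
  mem := fun a => input.getD a 0

/-- With `w`-bit words and at most `s` memory cells (those of the input and the output included),
the program `p` terminates on the given input within `T` steps and leaves the given output in the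
first memory cells. -/
def Computes (p : Program) (w s T : ℕ) (input output : List ℕ) : Prop :=
  input.length ≤ s ∧ output.length ≤ s ∧ (∀ x ∈ input, x < 2 ^ w) ∧
    ∃ t ≤ T, ∃ σ : State, Runs w s p (initialState input) t σ ∧
      (List.range output.length).map σ.mem = output

end WordRAM

/-!
# Longest (213, 231)-avoiding patterns in time `O(n log log n)`

A permutation avoids 213 and 231 if and only if each of its elements is either smaller than all
later elements or greater than all later elements. Hence, below and above its last element, it is
increasing and decreasing, respectively. Conversely, if an increasing and a decreasing subsequence
of `π` end at the same element, then together they form an occurrence of such a pattern. So the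
longest patterns have length `1 + max (L₁ i + L₂ i)`, where `L₁ i + 1` and `L₂ i + 1` are the
greatest lengths of increasing and of decreasing subsequences that end at the index `i`. The upper
bound is `length_le_of_avoids`; it uses only that `L₁` and `L₂` grow along increasing and decreasing
pairs. The pattern itself is recovered from chains of predecessors (`chainMarks_spec`,
`Marking.exists_pattern`).

Decreasing subsequences become increasing ones after a reversal of the values, so it remains to
compute lengths of increasing subsequences in time `O(n log log n)`. This is patience sorting: the
least last elements `T 0 < T 1 < ⋯` of increasing subsequences of each length are kept, and a new
key replaces the first `T j` that is greater (`LisInv.step`). The values lie below `N = 2 ^ h` with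
`h = O(log n)`, and the index `j` is found in time `O(log h)` as follows. The sequence `T` is cut
into groups of `O(h)` consecutive indices by a set of separating keys. The separators are the leaves
of a complete binary tree of height `h` in which every node stores the least and the greatest
separator below it. A binary search over the `h` levels finds the lowest nonempty ancestor of the
key, whose stored extrema contain a neighbouring separator (`TrieInv.neighbour`); a second binary
search in the group of this separator finds `j` (`locate_wp`).

The replacement of a tail can push the boundary of a group one index further, possibly into the next
separator, with which it is then merged. Every separator counts these moves; after `h` of them the
group is split. An update of the tree costs `O(h)`, but a split is preceded by `h` moves and a merge
removes a separator, so the `potential` pays for them and the amortized cost per key is `O(log h)`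
(`step_wp`, `pass_wp`).

The program is written in a small imperative language with variables and arrays, whose weakest
preconditions are transferred to runs of the word RAM by `Cmd.ends_comp`. The time that passes is a
component of the store, so running times are part of the postconditions.
-/

namespace AvoidingPattern

open WordRAM

/-! ### A small imperative language over the word RAM -/

/-- The variables of the program; each of them lives in a register of its own. -/
inductive Reg where
  | n | N | h | i | u | l | lo | hi | mid | v | c | s | q | z | k | best | low | high
  deriving DecidableEq

/-- The arrays of the program. `io` is the area that holds the input and then the output. The arrays
marked by a Boolean exist twice, once for each of the two subsequence computations. -/
inductive Arr where
  | io | mark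
  | X (b : Bool) | T (b : Bool) | I (b : Bool) | L (b : Bool) | P (b : Bool)
  | S (b : Bool) | pos (b : Bool) | cnt (b : Bool) | mx (b : Bool) | mn (b : Bool)
  deriving DecidableEq

/-- The register that holds a variable. Register `0` holds the start of the array area, and the
registers from `100` on hold intermediate values of expressions. -/
def Reg.idx : Reg → ℕ
  | .n => 1 | .N => 2 | .h => 3 | .i => 4 | .u => 5 | .l => 6 | .lo => 7 | .hi => 8 | .mid => 9
  | .v => 10 | .c => 11 | .s => 12 | .q => 13 | .z => 14 | .k => 15 | .best => 16 | .low => 17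
  | .high => 18

/-- The column of an array: the arrays other than `io` are interleaved, cell `i` of the array with
column `k` being the memory cell `D + 32 * i + k`. -/
def Arr.idx : Arr → ℕ
  | .io => 32 | .mark => 31
  | .X b => b.toNat * 16 | .T b => 1 + b.toNat * 16 | .I b => 2 + b.toNat * 16
  | .L b => 3 + b.toNat * 16 | .P b => 4 + b.toNat * 16 | .S b => 5 + b.toNat * 16
  | .pos b => 6 + b.toNat * 16 | .cnt b => 7 + b.toNat * 16 | .mx b => 8 + b.toNat * 16
  | .mn b => 9 + b.toNat * 16

lemma Reg.idx_injective : Function.Injective Reg.idx := by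
  intro a b hab
  cases a <;> cases b <;> first | rfl | (simp [Reg.idx] at hab)

lemma Reg.idx_pos (r : Reg) : 0 < r.idx := by cases r <;> simp [Reg.idx]

lemma Reg.idx_lt (r : Reg) : r.idx < 100 := by cases r <;> simp [Reg.idx]

lemma Arr.idx_injective : Function.Injective Arr.idx := by
  intro a b hab
  rcases a with _ | _ | x | x | x | x | x | x | x | x | x | x <;>
    rcases b with _ | _ | y | y | y | y | y | y | y | y | y | y <;>
    first
      | rfl
      | (cases x <;> cases y <;> first | rfl | (simp [Arr.idx] at hab))
      | (cases x <;> (simp [Arr.idx] at hab))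
      | (cases y <;> (simp [Arr.idx] at hab))
      | (simp [Arr.idx] at hab)

lemma Arr.idx_lt {A : Arr} (hA : A ≠ .io) : A.idx < 32 := by
  rcases A with _ | _ | x | x | x | x | x | x | x | x | x | x <;>
    first
      | exact absurd rfl hA
      | (cases x <;> simp [Arr.idx])
      | simp [Arr.idx]

/-- Expressions over the variables and the arrays. -/
inductive Ex where
  | var (r : Reg)
  | lit (k : ℕ)
  | op (o : Op) (x y : Ex)
  | get (A : Arr) (x : Ex)

/-- Commands: assignments to variables and to array cells, and the control structures. -/
inductive Cmd where
  | skip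
  | asg (r : Reg) (e : Ex)
  | put (A : Arr) (x e : Ex)
  | seq (p q : Cmd)
  | ite (e : Ex) (p q : Cmd)
  | loop (e : Ex) (p : Cmd)

/-- Sequential composition of a list of commands. -/
def Cmd.block : List Cmd → Cmd
  | [] => .skip
  | p :: ps => .seq p (.block ps)

/-- The contents of the variables and of the arrays, and the time that has passed. -/
structure Store where
  v : Reg → ℕ
  m : Arr → ℕ → ℕ
  t : ℕ

/-- The parameters of the machine: `w`-bit words, `s` memory cells, the input and output area
`0, …, D - 1`, and arrays of `cap` cells each. -/
structure Machine where
  w : ℕ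
  s : ℕ
  D : ℕ
  cap : ℕ
  fits : D + 32 * cap ≤ s
  small : s ≤ 2 ^ w
  large : 64 ≤ 2 ^ w

/-- The number of cells of an array. -/
def Machine.size (M : Machine) (A : Arr) : ℕ := if A = .io then M.D else M.cap

/-- The value of an expression. -/
def Ex.eval (a : Store) : Ex → ℕ
  | .var r => a.v r
  | .lit k => k
  | .op o x y => o.eval (x.eval a) (y.eval a)
  | .get A x => a.m A (x.eval a)

/-- The word operations whose value is at most the first argument, or at most `1`. -/
def shrinking : Op → Bool
  | .sub | .div | .shiftRight | .eq | .lt => true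
  | _ => false

/-- The evaluation of an expression causes no overflow and reads no cell outside of an array. -/
def Ex.ok (M : Machine) (a : Store) : Ex → Prop
  | .var _ => True
  | .lit k => k < 64
  | .op o x y => x.ok M a ∧ y.ok M a ∧ (shrinking o = true ∨ o.eval (x.eval a) (y.eval a) < 2 ^ M.w)
  | .get A x => x.ok M a ∧ x.eval a < M.size A

/-- The time to evaluate an expression. -/
def Ex.cost : Ex → ℕ
  | .var _ => 1
  | .lit _ => 1
  | .op _ x y => x.cost + y.cost + 1
  | .get _ x => x.cost + 6

/-- Replace the index of an array cell in register `t` by its address. -/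
def toAddr (A : Arr) (t : ℕ) : Program :=
  if A = .io then .skip
  else .seq (.instr (.const (t + 1) 32)) (.seq (.instr (.op .mul t t (t + 1)))
    (.seq (.instr (.const (t + 1) A.idx)) (.seq (.instr (.op .add t t (t + 1)))
      (.instr (.op .add t t 0)))))

/-- Evaluate an expression into register `t`, using only registers from `t` on. -/
def Ex.comp : Ex → ℕ → Program
  | .var r, t => .instr (.copy t r.idx)
  | .lit k, t => .instr (.const t k)
  | .op o x y, t => .seq (x.comp t) (.seq (y.comp (t + 1)) (.instr (.op o t t (t + 1))))
  | .get A x, t => .seq (x.comp t) (.seq (toAddr A t) (.instr (.load t t)))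

/-- Translation of commands into programs of the word RAM. -/
def Cmd.comp : Cmd → Program
  | .skip => .skip
  | .asg r e => .seq (e.comp 100) (.instr (.copy r.idx 100))
  | .put A x e => .seq (x.comp 100) (.seq (toAddr A 100)
      (.seq (e.comp 101) (.instr (.store 100 101))))
  | .seq p q => .seq p.comp q.comp
  | .ite e p q => .seq (e.comp 100) (.branch 100 p.comp q.comp)
  | .loop e p => .seq (e.comp 100) (.loop 100 (.seq p.comp (e.comp 100)))

/-- Let `c` units of time pass. -/
def Store.tick (a : Store) (c : ℕ) : Store := ⟨a.v, a.m, a.t + c⟩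

/-- Assign `x` to the variable `r` in time `c`. -/
def Store.set (a : Store) (r : Reg) (x c : ℕ) : Store := ⟨Function.update a.v r x, a.m, a.t + c⟩

/-- Assign `x` to cell `i` of the array `A` in time `c`. -/
def Store.put (a : Store) (A : Arr) (i x c : ℕ) : Store :=
  ⟨a.v, Function.update a.m A (Function.update (a.m A) i x), a.t + c⟩

@[simp] lemma Store.tick_v (a : Store) (c : ℕ) : (a.tick c).v = a.v := rfl
@[simp] lemma Store.tick_m (a : Store) (c : ℕ) : (a.tick c).m = a.m := rfl
@[simp] lemma Store.tick_t (a : Store) (c : ℕ) : (a.tick c).t = a.t + c := rfl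
@[simp] lemma Store.set_v (a : Store) (r : Reg) (x c : ℕ) (r' : Reg) :
    (a.set r x c).v r' = if r' = r then x else a.v r' := by
  simp [Store.set, Function.update_apply]
@[simp] lemma Store.set_m (a : Store) (r : Reg) (x c : ℕ) : (a.set r x c).m = a.m := rfl
@[simp] lemma Store.set_t (a : Store) (r : Reg) (x c : ℕ) : (a.set r x c).t = a.t + c := rfl
@[simp] lemma Store.put_v (a : Store) (A : Arr) (i x c : ℕ) : (a.put A i x c).v = a.v := rfl
@[simp] lemma Store.put_m (a : Store) (A : Arr) (i x c : ℕ) (A' : Arr) :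
    (a.put A i x c).m A' = if A' = A then Function.update (a.m A) i x else a.m A' := by
  simp [Store.put, Function.update_apply]
@[simp] lemma Store.put_t (a : Store) (A : Arr) (i x c : ℕ) : (a.put A i x c).t = a.t + c := rfl

/-- Weakest precondition: the command, started in the store `a`, terminates without overflow or
illegal address in a store that satisfies `Q`. The loop is a least fixed point. -/
def Cmd.wp (M : Machine) : Cmd → Store → (Store → Prop) → Prop
  | .skip, a, Q => Q (a.tick 1)
  | .asg r e, a, Q => e.ok M a ∧ Q (a.set r (e.eval a) (e.cost + 1))
  | .put A x e, a, Q => x.ok M a ∧ e.ok M a ∧ x.eval a < M.size A ∧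
      Q (a.put A (x.eval a) (e.eval a) (x.cost + e.cost + 6))
  | .seq p q, a, Q => p.wp M a (fun a' => q.wp M a' Q)
  | .ite e p q, a, Q => e.ok M a ∧ (e.eval a ≠ 0 → p.wp M (a.tick (e.cost + 1)) Q) ∧
      (e.eval a = 0 → q.wp M (a.tick (e.cost + 1)) Q)
  | .loop e p, a, Q => ∀ J : Store → Prop,
      (∀ a', e.ok M a' ∧ (e.eval a' ≠ 0 → p.wp M (a'.tick (e.cost + 1)) J) ∧
        (e.eval a' = 0 → Q (a'.tick (e.cost + 1))) → J a') → J a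

lemma Cmd.wp_mono {M : Machine} (p : Cmd) :
    ∀ {a : Store} {Q R : Store → Prop}, p.wp M a Q → (∀ a', Q a' → R a') → p.wp M a R := by
  induction p with
  | skip => intro a Q R hp h; exact h _ hp
  | asg r e => intro a Q R hp h; exact ⟨hp.1, h _ hp.2⟩
  | put A x e => intro a Q R hp h; exact ⟨hp.1, hp.2.1, hp.2.2.1, h _ hp.2.2.2⟩
  | seq p q ihp ihq => intro a Q R hp h; exact ihp hp fun a' ha' => ihq ha' h
  | ite e p q ihp ihq =>
    intro a Q R hp h
    exact ⟨hp.1, fun he => ihp (hp.2.1 he) h, fun he => ihq (hp.2.2 he) h⟩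
  | loop e p ih =>
    intro a Q R hp h J hJ
    exact hp J fun a' ha' => hJ a' ⟨ha'.1, ha'.2.1, fun he => h _ (ha'.2.2 he)⟩

/-- The rule for loops: an invariant that is indexed by a decreasing natural number. -/
lemma Cmd.wp_loop {M : Machine} {e : Ex} {p : Cmd} {Q : Store → Prop} (J : ℕ → Store → Prop)
    (hJ : ∀ k a, J k a → e.ok M a ∧
      (e.eval a ≠ 0 → p.wp M (a.tick (e.cost + 1)) fun a' => ∃ k' < k, J k' a') ∧
      (e.eval a = 0 → Q (a.tick (e.cost + 1))))
    (k : ℕ) (a : Store) (ha : J k a) : (Cmd.loop e p).wp M a Q := by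
  induction k using Nat.strong_induction_on generalizing a with
  | _ k ih =>
    intro K hK
    obtain ⟨h1, h2, h3⟩ := hJ k a ha
    refine hK a ⟨h1, fun he => Cmd.wp_mono p (h2 he) ?_, h3⟩
    rintro a' ⟨k', hk', ha'⟩
    exact ih k' hk' a' ha' K hK

/-- The registers and the memory of the word RAM represent the given store. -/
structure Rep (M : Machine) (σ : State) (a : Store) : Prop where
  reg : ∀ r : Reg, σ.reg r.idx = a.v r
  base : σ.reg 0 = M.D
  reg_lt : ∀ r, σ.reg r < 2 ^ M.w
  mem_lt : ∀ x, σ.mem x < 2 ^ M.w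
  arr : ∀ A i, A ≠ Arr.io → σ.mem (M.D + 32 * i + A.idx) = a.m A i
  io : ∀ i < M.D, σ.mem i = a.m .io i

/-- Changing registers from `100` on does not affect the represented store. -/
lemma Rep.of_eq {M : Machine} {σ : State} {a : Store} (h : Rep M σ a) {ρ : ℕ → ℕ}
    (hreg : ∀ r < 100, ρ r = σ.reg r) (hlt : ∀ r, ρ r < 2 ^ M.w) (c : ℕ) :
    Rep M ⟨ρ, σ.mem⟩ (a.tick c) where
  reg r := (hreg _ r.idx_lt).trans (h.reg r)
  base := (hreg 0 (by norm_num)).trans h.base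
  reg_lt := hlt
  mem_lt := h.mem_lt
  arr := h.arr
  io := h.io

lemma setReg_eq {w : ℕ} {σ : State} {r v : ℕ} (h : v < 2 ^ w) :
    σ.setReg w r v = some ⟨Function.update σ.reg r v, σ.mem⟩ := by
  simp [State.setReg, h]

lemma shrinking_eval {o : Op} (ho : shrinking o = true) (x y : ℕ) : o.eval x y ≤ max x 1 := by
  cases o <;> simp [shrinking] at ho <;> simp only [Op.eval]
  · omega
  · exact (Nat.div_le_self x y).trans (le_max_left _ _)
  · exact (Nat.div_le_self x _).trans (le_max_left _ _)
  · split_ifs <;> omega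
  · split_ifs <;> omega

lemma update_lt {W : ℕ} {f : ℕ → ℕ} (hf : ∀ r, f r < W) {x v : ℕ} (hv : v < W) (r : ℕ) :
    Function.update f x v r < W := by
  rw [Function.update_apply]; split_ifs; exacts [hv, hf r]

/-- The address computation leaves the address in register `t` and changes no register below. -/
lemma toAddr_runs {M : Machine} {A : Arr} {t : ℕ} (ht : 100 ≤ t) {σ : State}
    (hD : σ.reg 0 = M.D) (hlt : ∀ r, σ.reg r < 2 ^ M.w) (hi : σ.reg t < M.size A) :
    ∃ c ≤ 5, ∃ ρ : ℕ → ℕ, Runs M.w M.s (toAddr A t) σ c ⟨ρ, σ.mem⟩ ∧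
      ρ t = (if A = .io then σ.reg t else M.D + 32 * σ.reg t + A.idx) ∧
      (∀ r < t, ρ r = σ.reg r) ∧ (∀ r, ρ r < 2 ^ M.w) ∧ ρ t < M.s := by
  have hf := M.fits
  have hs := M.small
  have hl := M.large
  unfold Machine.size at hi
  by_cases hA : A = .io
  · rw [if_pos hA] at hi
    simp only [toAddr, if_pos hA]
    exact ⟨1, by norm_num, σ.reg, .skip _, rfl, fun _ _ => rfl, hlt, by omega⟩
  · rw [if_neg hA] at hi
    have hk := Arr.idx_lt hA
    simp only [toAddr, if_neg hA]
    refine ⟨1 + (1 + (1 + (1 + 1))), by norm_num, _,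
      .seq (.instr (setReg_eq (by omega))) (.seq (.instr (setReg_eq ?_))
      (.seq (.instr (setReg_eq (by omega))) (.seq (.instr (setReg_eq ?_))
        (.instr (setReg_eq ?_))))), ?_, ?_, ?_, ?_⟩
    all_goals
      have h2 : 0 ≠ t := by omega
    · simp [Op.eval]; omega
    · simp [Op.eval]; omega
    · simp [Op.eval, h2, hD]; omega
    · simp [Op.eval, h2, hD]; omega
    · intro r hr
      have h4 : r ≠ t := by omega
      have h5 : r ≠ t + 1 := by omega
      simp [h4, h5]
    · refine update_lt (update_lt (update_lt (update_lt (update_lt hlt ?_) ?_) ?_) ?_) ?_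
      · omega
      · simp [Op.eval]; omega
      · omega
      · simp [Op.eval]; omega
      · simp [Op.eval, h2, hD]; omega
    · simp [Op.eval, h2, hD]; omega

/-- Compiled expressions compute the value of the expression. -/
lemma Ex.comp_runs {M : Machine} {a : Store} (e : Ex) :
    ∀ {t : ℕ} {σ : State}, 100 ≤ t → Rep M σ a → e.ok M a →
      ∃ c ≤ e.cost, ∃ ρ : ℕ → ℕ, Runs M.w M.s (e.comp t) σ c ⟨ρ, σ.mem⟩ ∧ ρ t = e.eval a ∧
        (∀ r < t, ρ r = σ.reg r) ∧ (∀ r, ρ r < 2 ^ M.w) := by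
  induction e with
  | var r =>
    intro t σ ht hσ _
    refine ⟨1, le_rfl, _, .instr (setReg_eq (hσ.reg_lt _)), ?_, ?_, ?_⟩
    · simp [Ex.eval, hσ.reg]
    · intro r' hr'; simp [hr'.ne]
    · exact update_lt hσ.reg_lt (hσ.reg_lt _)
  | lit k =>
    intro t σ ht hσ hk
    have hk' : k < 2 ^ M.w := lt_of_lt_of_le hk M.large
    refine ⟨1, le_rfl, _, .instr (setReg_eq hk'), ?_, ?_, ?_⟩
    · simp [Ex.eval]
    · intro r' hr'; simp [hr'.ne]
    · exact update_lt hσ.reg_lt hk'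
  | op o x y ihx ihy =>
    intro t σ ht hσ hok
    obtain ⟨hx, hy, ho⟩ := hok
    obtain ⟨c₁, hc₁, ρ₁, hr₁, hv₁, hf₁, hl₁⟩ := ihx ht hσ hx
    have hσ₁ : Rep M ⟨ρ₁, σ.mem⟩ a := hσ.of_eq (fun r hr => hf₁ r (by omega)) hl₁ 0
    obtain ⟨c₂, hc₂, ρ₂, hr₂, hv₂, hf₂, hl₂⟩ := ihy (t := t + 1) (by omega) hσ₁ hy
    have hx' : ρ₂ t = x.eval a := by rw [hf₂ t (by omega)]; exact hv₁
    have hb : o.eval (ρ₂ t) (ρ₂ (t + 1)) < 2 ^ M.w := by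
      rcases ho with ho | ho
      · have h1 := shrinking_eval ho (ρ₂ t) (ρ₂ (t + 1))
        have h2 := hl₂ t
        have h3 := M.large
        omega
      · rwa [hx', hv₂]
    refine ⟨c₁ + (c₂ + 1), by simp only [Ex.cost]; omega, _,
      .seq hr₁ (.seq hr₂ (.instr (setReg_eq hb))), ?_, ?_, ?_⟩
    · simp [Ex.eval, hx', hv₂]
    · intro r hr
      rw [Function.update_of_ne hr.ne]
      exact (hf₂ r (by omega)).trans (hf₁ r hr)
    · exact update_lt hl₂ hb
  | get A x ih =>
    intro t σ ht hσ hok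
    obtain ⟨hx, hi⟩ := hok
    obtain ⟨c₁, hc₁, ρ₁, hr₁, hv₁, hf₁, hl₁⟩ := ih ht hσ hx
    have hD : ρ₁ 0 = M.D := by rw [hf₁ 0 (by omega), hσ.base]
    obtain ⟨c₂, hc₂, ρ₂, hr₂, hv₂, hf₂, hl₂, hs₂⟩ :=
      toAddr_runs (A := A) (σ := ⟨ρ₁, σ.mem⟩) ht hD hl₁ (by simpa only [hv₁] using hi)
    have hload : (Instr.load t t).exec M.w M.s ⟨ρ₂, σ.mem⟩ =
        some ⟨Function.update ρ₂ t (σ.mem (ρ₂ t)), σ.mem⟩ := by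
      simp only [Instr.exec, if_pos hs₂]
      exact setReg_eq (hσ.mem_lt _)
    refine ⟨c₁ + (c₂ + 1), by simp only [Ex.cost]; omega, _, .seq hr₁ (.seq hr₂ (.instr hload)),
      ?_, ?_, ?_⟩
    · rw [Function.update_self, hv₂]
      by_cases hA : A = .io
      · subst hA
        simp only [if_true, Ex.eval, hv₁]
        exact hσ.io _ (by simpa [Machine.size] using hi)
      · simp only [if_neg hA, Ex.eval, hv₁]
        exact hσ.arr _ _ hA
    · intro r hr
      rw [Function.update_of_ne hr.ne]
      exact (hf₂ r hr).trans (hf₁ r hr)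
    · exact update_lt hl₂ (hσ.mem_lt _)

/-- The program terminates in a state that represents a store with `Q`, and the running time is at
most the time that has passed in the stores. -/
def Ends (M : Machine) (p : Program) (a : Store) (Q : Store → Prop) : Prop :=
  ∀ σ, Rep M σ a → ∃ t σ' a', Runs M.w M.s p σ t σ' ∧ Rep M σ' a' ∧ a.t + t ≤ a'.t ∧ Q a'

lemma Rep.put {M : Machine} {σ : State} {a : Store} (h : Rep M σ a) {A : Arr} {i x : ℕ}
    (hi : i < M.size A) (hx : x < 2 ^ M.w) {ρ : ℕ → ℕ} (hreg : ∀ r < 100, ρ r = σ.reg r)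
    (hlt : ∀ r, ρ r < 2 ^ M.w) (c : ℕ) :
    Rep M ⟨ρ, Function.update σ.mem (if A = .io then i else M.D + 32 * i + A.idx) x⟩
      (a.put A i x c) where
  reg r := by simp only [Store.put_v, ← h.reg]; exact hreg _ r.idx_lt
  base := by simp only [hreg 0 (by norm_num), h.base]
  reg_lt := hlt
  mem_lt := update_lt h.mem_lt hx
  arr A' i' hA' := by
    have h1 := Arr.idx_lt hA'
    simp only [Store.put_m]
    by_cases hA : A = .io
    · subst hA
      have hi' : i < M.D := by simpa [Machine.size] using hi
      rw [if_neg hA', if_pos rfl, Function.update_of_ne (by omega), h.arr _ _ hA']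
    · have h2 := Arr.idx_lt hA
      rw [if_neg hA]
      by_cases hAA : A' = A
      · subst hAA
        rw [if_pos rfl]
        by_cases hii : i' = i
        · subst hii; simp
        · rw [Function.update_of_ne (by omega), Function.update_of_ne hii, h.arr _ _ hA]
      · have h3 : A'.idx ≠ A.idx := fun he => hAA (Arr.idx_injective he)
        rw [if_neg hAA, Function.update_of_ne (by omega), h.arr _ _ hA']
  io i' hi' := by
    simp only [Store.put_m]
    by_cases hA : A = .io
    · subst hA
      simp only [if_true, Function.update_apply, h.io _ hi']
    · rw [if_neg hA, if_neg (Ne.symm hA), Function.update_of_ne (by omega), h.io _ hi']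

/-- Commands are translated correctly. -/
theorem Cmd.ends_comp {M : Machine} (p : Cmd) :
    ∀ {a : Store} {Q : Store → Prop}, p.wp M a Q → Ends M p.comp a Q := by
  induction p with
  | skip =>
    intro a Q hQ σ hσ
    exact ⟨1, σ, a.tick 1, .skip σ, hσ.of_eq (fun _ _ => rfl) hσ.reg_lt 1, le_rfl, hQ⟩
  | asg r e =>
    intro a Q hQ σ hσ
    obtain ⟨c, hc, ρ, hr, hv, hf, hl⟩ := e.comp_runs le_rfl hσ hQ.1
    refine ⟨c + 1, _, a.set r (e.eval a) (e.cost + 1), .seq hr (.instr (setReg_eq (hl _))), ?_,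
      by simp only [Store.set_t]; omega, hQ.2⟩
    refine ⟨fun r' => ?_, ?_, update_lt hl (hl _), hσ.mem_lt, hσ.arr, hσ.io⟩
    · by_cases hrr : r' = r
      · subst hrr; simp [hv]
      · have h1 : r'.idx ≠ r.idx := fun he => hrr (Reg.idx_injective he)
        simp only [Store.set_v, if_neg hrr]
        rw [Function.update_of_ne h1]
        exact (hf _ r'.idx_lt).trans (hσ.reg r')
    · have h1 := r.idx_pos
      simp only
      rw [Function.update_of_ne h1.ne]
      exact (hf 0 (by norm_num)).trans hσ.base
  | put A x e =>
    intro a Q hQ σ hσ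
    obtain ⟨hx, he, hi, hQ⟩ := hQ
    obtain ⟨c₁, hc₁, ρ₁, hr₁, hv₁, hf₁, hl₁⟩ := x.comp_runs le_rfl hσ hx
    have hD : ρ₁ 0 = M.D := by rw [hf₁ 0 (by omega), hσ.base]
    obtain ⟨c₂, hc₂, ρ₂, hr₂, hv₂, hf₂, hl₂, hs₂⟩ :=
      toAddr_runs (A := A) (σ := ⟨ρ₁, σ.mem⟩) le_rfl hD hl₁ (by simpa only [hv₁] using hi)
    have hσ₂ : Rep M ⟨ρ₂, σ.mem⟩ a :=
      hσ.of_eq (fun r hr => (hf₂ r hr).trans (hf₁ r hr)) hl₂ 0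
    obtain ⟨c₃, hc₃, ρ₃, hr₃, hv₃, hf₃, hl₃⟩ := e.comp_runs (t := 101) (by norm_num) hσ₂ he
    have h100 : ρ₃ 100 = ρ₂ 100 := hf₃ 100 (by norm_num)
    have hst : (Instr.store 100 101).exec M.w M.s ⟨ρ₃, σ.mem⟩ =
        some ⟨ρ₃, Function.update σ.mem (ρ₂ 100) (e.eval a)⟩ := by
      simp only [Instr.exec, h100, if_pos hs₂, hv₃]
    refine ⟨c₁ + (c₂ + (c₃ + 1)), _, _, .seq hr₁ (.seq hr₂ (.seq hr₃ (.instr hst))), ?_, ?_, hQ⟩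
    · rw [hv₂]
      simp only [hv₁]
      exact hσ.put hi (hv₃ ▸ hl₃ 101) (fun r hr => (hf₃ r (by omega)).trans
        ((hf₂ r hr).trans (hf₁ r hr))) hl₃ _
    · simp only [Store.put_t]; omega
  | seq p q ihp ihq =>
    intro a Q hQ σ hσ
    obtain ⟨t₁, σ₁, a₁, hr₁, hσ₁, ht₁, hQ₁⟩ := ihp hQ σ hσ
    obtain ⟨t₂, σ₂, a₂, hr₂, hσ₂, ht₂, hQ₂⟩ := ihq hQ₁ σ₁ hσ₁
    exact ⟨t₁ + t₂, σ₂, a₂, .seq hr₁ hr₂, hσ₂, by omega, hQ₂⟩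
  | ite e p q ihp ihq =>
    intro a Q hQ σ hσ
    obtain ⟨c, hc, ρ, hr, hv, hf, hl⟩ := e.comp_runs le_rfl hσ hQ.1
    have hσ₁ : Rep M ⟨ρ, σ.mem⟩ (a.tick (e.cost + 1)) := hσ.of_eq hf hl _
    by_cases he : e.eval a = 0
    · obtain ⟨t₂, σ₂, a₂, hr₂, hσ₂, ht₂, hQ₂⟩ := ihq (hQ.2.2 he) _ hσ₁
      refine ⟨c + (t₂ + 1), σ₂, a₂, .seq hr (.branch_false (hv.trans he) hr₂), hσ₂, ?_, hQ₂⟩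
      simp only [Store.tick_t] at ht₂; omega
    · obtain ⟨t₂, σ₂, a₂, hr₂, hσ₂, ht₂, hQ₂⟩ := ihp (hQ.2.1 he) _ hσ₁
      refine ⟨c + (t₂ + 1), σ₂, a₂, .seq hr (.branch_true (by simpa only [hv] using he) hr₂), hσ₂,
        ?_, hQ₂⟩
      simp only [Store.tick_t] at ht₂; omega
  | loop e p ih =>
    intro a Q hQ
    refine hQ (fun a => Ends M (Cmd.loop e p).comp a Q) ?_
    rintro a ⟨hok, hstep, hdone⟩ σ hσ
    obtain ⟨c, hc, ρ, hr, hv, hf, hl⟩ := e.comp_runs le_rfl hσ hok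
    have hσ₁ : Rep M ⟨ρ, σ.mem⟩ (a.tick (e.cost + 1)) := hσ.of_eq hf hl _
    by_cases he : e.eval a = 0
    · exact ⟨c + 1, _, _, .seq hr (.loop_done (hv.trans he)), hσ₁,
        by simp only [Store.tick_t]; omega, hdone he⟩
    · obtain ⟨t₂, σ₂, a₂, hr₂, hσ₂, ht₂, hQ₂⟩ := ih (hstep he) _ hσ₁
      obtain ⟨t₃, σ₃, a₃, hr₃, hσ₃, ht₃, hQ₃⟩ := hQ₂ σ₂ hσ₂
      simp only [Store.tick_t] at ht₂
      -- The evaluation of the test after the body belongs to the next round of the loop.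
      cases hr₃ with
      | @seq _ _ _ σ₄ _ t₄ t₅ h4 h5 =>
        refine ⟨c + (t₂ + t₄ + t₅ + 1), σ₃, a₃,
          .seq hr (.loop_step (by simpa only [hv] using he) (.seq hr₂ h4) h5), hσ₃, by omega, hQ₃⟩

/-! ### Searching a set of keys in a binary trie -/

/-- `v` is the index, in heap order, of a node at height `e` above the leaves `N, …, 2 * N - 1`. -/
def IsNode (N e v : ℕ) : Prop := N ≤ v * 2 ^ e ∧ v * 2 ^ e < 2 * N

/-- The entries of node `v` at height `e` are the largest and the least key of the set `F` in the
subtree of `v`, and both are `0` if there is none. -/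
def TrieAt (F : Finset ℕ) (mx mn : ℕ → ℕ) (e v : ℕ) : Prop :=
  (∀ s ∈ F, s / 2 ^ e = v → s ≤ mx v ∧ mn v ≤ s ∧ mx v ≠ 0) ∧
  (mx v ≠ 0 ∨ mn v ≠ 0 → mx v ∈ F ∧ mx v / 2 ^ e = v ∧ mn v ∈ F ∧ mn v / 2 ^ e = v)

/-- All entries of the trie are right. -/
def TrieInv (h : ℕ) (F : Finset ℕ) (mx mn : ℕ → ℕ) : Prop :=
  ∀ e v, e ≤ h → IsNode (2 ^ h) e v → TrieAt F mx mn e v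

/-- All entries of the trie are right, except perhaps those above height `e` on the path from the
leaf `u` to the root. -/
def TrieInvBut (h u : ℕ) (F : Finset ℕ) (mx mn : ℕ → ℕ) (e : ℕ) : Prop :=
  ∀ e' v, e' ≤ h → IsNode (2 ^ h) e' v → (e' ≤ e ∨ v ≠ u / 2 ^ e') → TrieAt F mx mn e' v

lemma IsNode.height_eq {N e e' v : ℕ} (h : IsNode N e v) (h' : IsNode N e' v) : e = e' := by
  have key : ∀ a b : ℕ, IsNode N a v → IsNode N b v → ¬ a < b := by
    intro a b ha hb hab
    have h1 : 2 ^ (a + 1) ≤ 2 ^ b := Nat.pow_le_pow_right (by norm_num) hab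
    have h2 := Nat.mul_le_mul_left v h1
    have h3 := ha.1
    have h4 := hb.2
    rw [pow_succ] at h2
    nlinarith
  have h1 := key e e' h h'
  have h2 := key e' e h' h
  omega

lemma isNode_div {h u e : ℕ} (hu : 2 ^ h ≤ u) (hu' : u < 2 * 2 ^ h) (he : e ≤ h) :
    IsNode (2 ^ h) e (u / 2 ^ e) := by
  refine ⟨?_, lt_of_le_of_lt (Nat.div_mul_le_self _ _) hu'⟩
  have h1 : 2 ^ h = 2 ^ (h - e) * 2 ^ e := by rw [← pow_add]; congr 1; omega
  rw [h1]
  refine Nat.mul_le_mul_right _ ?_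
  rw [Nat.le_div_iff_mul_le (by positivity), ← h1]
  exact hu

lemma IsNode.lt {N e v : ℕ} (h : IsNode N e v) : v < 2 * N :=
  lt_of_le_of_lt (Nat.le_mul_of_pos_right v (by positivity)) h.2

lemma IsNode.children {h e v : ℕ} (he : e + 1 ≤ h) (hv : IsNode (2 ^ h) (e + 1) v) :
    IsNode (2 ^ h) e (2 * v) ∧ IsNode (2 ^ h) e (2 * v + 1) := by
  obtain ⟨h1, h2⟩ := hv
  have h3 : (2 * v) * 2 ^ e = v * 2 ^ (e + 1) := by ring
  have h4 : 2 * 2 ^ h = 2 ^ (h - e) * 2 ^ (e + 1) := by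
    rw [← pow_add, ← pow_succ']; congr 1; omega
  have h5 : v < 2 ^ (h - e) := by
    rw [h4] at h2; exact lt_of_mul_lt_mul_right h2 (Nat.zero_le _)
  have h6 : (v + 1) * 2 ^ (e + 1) ≤ 2 * 2 ^ h := by
    rw [h4]; exact Nat.mul_le_mul_right _ h5
  have h7 : 0 < 2 ^ e := by positivity
  have h8 : (2 * v + 1) * 2 ^ e = v * 2 ^ (e + 1) + 2 ^ e := by ring
  have h9 : (v + 1) * 2 ^ (e + 1) = v * 2 ^ (e + 1) + 2 * 2 ^ e := by ring
  refine ⟨⟨by omega, by omega⟩, ⟨by omega, by omega⟩⟩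

lemma div_pow_succ (s e : ℕ) : s / 2 ^ (e + 1) = s / 2 ^ e / 2 := by
  rw [pow_succ, Nat.div_div_eq_div_mul]

lemma TrieAt.congr {F F' : Finset ℕ} {mx mn mx' mn' : ℕ → ℕ} {e v : ℕ}
    (h : TrieAt F mx mn e v) (hF : ∀ s, s / 2 ^ e = v → (s ∈ F ↔ s ∈ F'))
    (h1 : mx' v = mx v) (h2 : mn' v = mn v) : TrieAt F' mx' mn' e v := by
  unfold TrieAt
  rw [h1, h2]
  refine ⟨fun s hs hsv => h.1 s ((hF s hsv).2 hs) hsv, fun h0 => ?_⟩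
  obtain ⟨a, b, c, d⟩ := h.2 h0
  exact ⟨(hF _ b).1 a, b, (hF _ d).1 c, d⟩

/-- Recomputing the entries of an inner node from those of its children. -/
lemma TrieInvBut.step {h u e : ℕ} {F : Finset ℕ} {mx mn : ℕ → ℕ} (hu : 2 ^ h ≤ u)
    (hu' : u < 2 * 2 ^ h) (hF : ∀ s ∈ F, 0 < s) (he : e < h)
    (hinv : TrieInvBut h u F mx mn e) :
    TrieInvBut h u F
      (Function.update mx (u / 2 ^ (e + 1)) (if mx (2 * (u / 2 ^ (e + 1)) + 1) = 0
        then mx (2 * (u / 2 ^ (e + 1))) else mx (2 * (u / 2 ^ (e + 1)) + 1)))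
      (Function.update mn (u / 2 ^ (e + 1)) (if mn (2 * (u / 2 ^ (e + 1))) = 0
        then mn (2 * (u / 2 ^ (e + 1)) + 1) else mn (2 * (u / 2 ^ (e + 1))))) (e + 1) := by
  have hnode : IsNode (2 ^ h) (e + 1) (u / 2 ^ (e + 1)) := isNode_div hu hu' he
  generalize hvdef : u / 2 ^ (e + 1) = v at *
  obtain ⟨hc0, hc1⟩ := hnode.children he
  obtain ⟨a1, a2⟩ := hinv e (2 * v) (by omega) hc0 (Or.inl le_rfl)
  obtain ⟨b1, b2⟩ := hinv e (2 * v + 1) (by omega) hc1 (Or.inl le_rfl)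
  intro e' v' he' hv' hor
  by_cases hvv : v' = v
  · subst hvv
    obtain rfl : e' = e + 1 := hv'.height_eq hnode
    simp only [TrieAt, Function.update_self]
    constructor
    · intro s hs hsv
      have hs0 := hF s hs
      rw [div_pow_succ] at hsv
      rcases Nat.even_or_odd' (s / 2 ^ e) with ⟨k, hk | hk⟩
      · have hk' : k = v' := by omega
        subst hk'
        obtain ⟨c1, c2, c3⟩ := a1 s hs hk
        obtain ⟨d1, d2, d3, d4⟩ := a2 (Or.inl c3)
        have d5 := hF _ d3
        refine ⟨?_, ?_, ?_⟩
        · split_ifs with h0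
          · exact c1
          · have h3 := (b2 (Or.inl h0)).2.1
            have : s / 2 ^ e < mx (2 * k + 1) / 2 ^ e := by omega
            exact (Nat.lt_of_div_lt_div this).le
        · rw [if_neg (by omega)]; exact c2
        · split_ifs with h0 <;> assumption
      · have hk' : k = v' := by omega
        subst hk'
        obtain ⟨c1, c2, c3⟩ := b1 s hs hk
        refine ⟨?_, ?_, ?_⟩
        · rw [if_neg c3]; exact c1
        · split_ifs with h0
          · exact c2
          · have h3 := (a2 (Or.inr h0)).2.2.2
            have : mn (2 * k) / 2 ^ e < s / 2 ^ e := by omega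
            exact (Nat.lt_of_div_lt_div this).le
        · rw [if_neg c3]; exact c3
    · intro h0
      have key : (mx (2 * v') ≠ 0 ∨ mn (2 * v') ≠ 0) ∨
          (mx (2 * v' + 1) ≠ 0 ∨ mn (2 * v' + 1) ≠ 0) := by
        by_contra hcon
        push Not at hcon
        obtain ⟨⟨h1, h2⟩, h3, h4⟩ := hcon
        simp [h1, h2, h3, h4] at h0
      have hX : (if mx (2 * v' + 1) = 0 then mx (2 * v') else mx (2 * v' + 1)) ∈ F ∧
          (if mx (2 * v' + 1) = 0 then mx (2 * v') else mx (2 * v' + 1)) / 2 ^ (e + 1) = v' := by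
        rw [div_pow_succ]
        split_ifs with h1
        · rcases key with k | k
          · have := a2 k; exact ⟨this.1, by omega⟩
          · have := hF _ (b2 k).1; omega
        · have := b2 (Or.inl h1); exact ⟨this.1, by omega⟩
      have hN : (if mn (2 * v') = 0 then mn (2 * v' + 1) else mn (2 * v')) ∈ F ∧
          (if mn (2 * v') = 0 then mn (2 * v' + 1) else mn (2 * v')) / 2 ^ (e + 1) = v' := by
        rw [div_pow_succ]
        split_ifs with h1
        · rcases key with k | k
          · have := hF _ (a2 k).2.2.1; omega
          · have := b2 k; exact ⟨this.2.2.1, by omega⟩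
        · have := a2 (Or.inr h1); exact ⟨this.2.2.1, by omega⟩
      exact ⟨hX.1, hX.2, hN.1, hN.2⟩
  · refine (hinv e' v' he' hv' ?_).congr (fun _ _ => Iff.rfl) (Function.update_of_ne hvv _ _)
      (Function.update_of_ne hvv _ _)
    rcases hor with h1 | h1
    · rcases Nat.lt_or_ge e' (e + 1) with h2 | h2
      · left; omega
      · right
        obtain rfl : e' = e + 1 := by omega
        rw [hvdef]; exact hvv
    · exact Or.inr h1

/-- After a change of the leaf `u` only the path from `u` to the root has to be recomputed. -/
lemma TrieInv.leaf {h u x : ℕ} {F F' : Finset ℕ} {mx mn : ℕ → ℕ} (hu : 2 ^ h ≤ u)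
    (hinv : TrieInv h F mx mn) (hF : ∀ s, s ≠ u → (s ∈ F ↔ s ∈ F'))
    (hx : x = if u ∈ F' then u else 0) :
    TrieInvBut h u F' (Function.update mx u x) (Function.update mn u x) 0 := by
  intro e v he hv hor
  have hpos : 0 < 2 ^ h := by positivity
  by_cases hvu : v = u
  · subst hvu
    have he0 : e = 0 := by
      by_contra hne
      have h1 : 2 ^ 1 ≤ 2 ^ e := Nat.pow_le_pow_right (by norm_num) (by omega)
      have h2 := hv.2
      nlinarith
    subst he0
    simp only [TrieAt, Function.update_self, pow_zero, Nat.div_one]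
    constructor
    · rintro s hs rfl
      rw [if_pos hs] at hx
      omega
    · intro h0
      split_ifs at hx with h1
      · subst hx; exact ⟨h1, rfl, h1, rfl⟩
      · omega
  · refine (hinv e v he hv).congr (fun s hs => hF s ?_) (Function.update_of_ne hvu _ _)
      (Function.update_of_ne hvu _ _)
    rintro rfl
    rcases hor with h1 | h1
    · obtain rfl : e = 0 := by omega
      simp at hs; exact hvu hs.symm
    · exact h1 hs.symm

lemma TrieInvBut.full {h u : ℕ} {F : Finset ℕ} {mx mn : ℕ → ℕ}
    (hinv : TrieInvBut h u F mx mn h) : TrieInv h F mx mn :=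
  fun e v he hv => hinv e v he hv (Or.inl he)

/-- The heights at which the ancestor of `u` has a key below it are upward closed. -/
lemma TrieInv.mx_ne_zero {h u e e' : ℕ} {F : Finset ℕ} {mx mn : ℕ → ℕ} (hinv : TrieInv h F mx mn)
    (hu : 2 ^ h ≤ u) (hu' : u < 2 * 2 ^ h) (hee : e ≤ e') (he' : e' ≤ h)
    (hm : mx (u / 2 ^ e) ≠ 0) : mx (u / 2 ^ e') ≠ 0 := by
  obtain ⟨h1, h2, -, -⟩ := (hinv e _ (by omega) (isNode_div hu hu' (by omega))).2 (Or.inl hm)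
  refine ((hinv e' _ he' (isNode_div hu hu' he')).1 _ h1 ?_).2.2
  have h3 : 2 ^ e' = 2 ^ e * 2 ^ (e' - e) := by rw [← pow_add]; congr 1; omega
  rw [h3, ← Nat.div_div_eq_div_mul, ← Nat.div_div_eq_div_mul, h2]

/-- `c` is a neighbour of `u` in the set `F`: its predecessor or its successor. -/
def IsNeighbour (F : Finset ℕ) (u c : ℕ) : Prop :=
  c ∈ F ∧ ((c ≤ u ∧ ∀ s ∈ F, s ≤ u → s ≤ c) ∨ (u < c ∧ ∀ s ∈ F, u < s → c ≤ s))

/-- The lowest ancestor of `u` with a key below it yields a neighbour of `u`. -/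
lemma TrieInv.neighbour {h u e : ℕ} {F : Finset ℕ} {mx mn : ℕ → ℕ} (hinv : TrieInv h F mx mn)
    (hu : 2 ^ h ≤ u) (hu' : u < 2 * 2 ^ h) (he : e ≤ h) (hm : mx (u / 2 ^ e) ≠ 0)
    (hlow : ∀ e' < e, mx (u / 2 ^ e') = 0) :
    IsNeighbour F u (if u < mx (u / 2 ^ e) then mn (u / 2 ^ e) else mx (u / 2 ^ e)) := by
  obtain ⟨h1, h2⟩ := hinv e _ he (isNode_div hu hu' he)
  obtain ⟨k1, k2, k3, k4⟩ := h2 (Or.inl hm)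
  split_ifs with hlt
  · have hlt' : u < mn (u / 2 ^ e) := by
      by_contra hle
      push Not at hle
      rcases e with _ | e
      · simp only [pow_zero, Nat.div_one] at k2 hlt; omega
      · have h3 := (hinv e _ (by omega) (isNode_div hu hu' (by omega))).1
        have h4 := hlow e (by omega)
        have h5 : mn (u / 2 ^ (e + 1)) / 2 ^ e ≤ u / 2 ^ e := Nat.div_le_div_right hle
        have h6 : u / 2 ^ e ≤ mx (u / 2 ^ (e + 1)) / 2 ^ e := Nat.div_le_div_right hlt.le
        have h7 := div_pow_succ (mn (u / 2 ^ (e + 1))) e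
        have h8 := div_pow_succ (mx (u / 2 ^ (e + 1))) e
        have h9 := div_pow_succ u e
        have h10 : mn (u / 2 ^ (e + 1)) / 2 ^ e = u / 2 ^ e ∨
            mx (u / 2 ^ (e + 1)) / 2 ^ e = u / 2 ^ e := by omega
        rcases h10 with h10 | h10
        · exact (h3 _ k3 h10).2.2 h4
        · exact (h3 _ k1 h10).2.2 h4
    refine ⟨k3, Or.inr ⟨hlt', fun s hs hus => ?_⟩⟩
    have h3 : u / 2 ^ e ≤ s / 2 ^ e := Nat.div_le_div_right hus.le
    rcases h3.eq_or_lt with h4 | h4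
    · exact (h1 s hs h4.symm).2.1
    · exact (Nat.lt_of_div_lt_div (c := 2 ^ e) (by omega)).le
  · refine ⟨k1, Or.inl ⟨by omega, fun s hs hsu => ?_⟩⟩
    have h3 : s / 2 ^ e ≤ u / 2 ^ e := Nat.div_le_div_right hsu
    rcases h3.eq_or_lt with h4 | h4
    · exact (h1 s hs h4).1
    · exact (Nat.lt_of_div_lt_div (c := 2 ^ e) (by omega)).le

/-! ### Separators in the sorted array of tails -/

/-- The array `T` is sorted on `0, …, l - 1`. The keys in `F`, called separators, cut it into
groups: `pos s` is the index of the first tail that is at least `s`, and `S` is the inverse of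
`pos`, with `S j = 0` if no group begins at `j`. The group that ends at `s` has at most `B + cnt s`
tails. The key `N + n + 1`, larger than all tails, is always a separator. -/
structure SepInv (N n B l : ℕ) (T S pos cnt : ℕ → ℕ) (F : Finset ℕ) : Prop where
  mono : ∀ i j, i < j → j < l → T i < T j
  tail : ∀ j < l, N < T j ∧ T j ≤ N + n
  range : ∀ s ∈ F, N < s ∧ s ≤ N + n + 1
  top : N + n + 1 ∈ F
  pos_le : ∀ s ∈ F, pos s ≤ l
  S_pos : ∀ s ∈ F, S (pos s) = s
  S_mem : ∀ j, S j ≠ 0 → S j ∈ F ∧ pos (S j) = j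
  below : ∀ s ∈ F, ∀ j < pos s, T j < s
  above : ∀ s ∈ F, ∀ j < l, pos s ≤ j → s ≤ T j
  gap : ∀ s ∈ F, pos s ≤ B + cnt s ∨ ∃ t ∈ F, pos t < pos s ∧ pos s ≤ pos t + B + cnt s
  cnt_le : ∀ s ∈ F, cnt s ≤ B

namespace SepInv

variable {N n B l : ℕ} {T S pos cnt : ℕ → ℕ} {F : Finset ℕ}

lemma pos_ne (I : SepInv N n B l T S pos cnt F) {s t : ℕ} (hs : s ∈ F) (ht : t ∈ F)
    (hst : s ≠ t) : pos s ≠ pos t := by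
  intro he
  have h1 := I.S_pos s hs
  rw [he, I.S_pos t ht] at h1
  exact hst h1.symm

lemma pos_lt (I : SepInv N n B l T S pos cnt F) {s t : ℕ} (hs : s ∈ F) (ht : t ∈ F)
    (hst : s < t) : pos s < pos t := by
  by_contra hle
  have h1 : pos t < pos s := lt_of_le_of_ne (by omega) (I.pos_ne ht hs hst.ne')
  have h2 := I.below s hs _ h1
  have h3 := I.above t ht (pos t) (lt_of_lt_of_le h1 (I.pos_le s hs)) le_rfl
  omega

lemma pos_top (I : SepInv N n B l T S pos cnt F) : pos (N + n + 1) = l := by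
  by_contra hne
  have h1 := I.pos_le _ I.top
  have h2 := I.above _ I.top (pos (N + n + 1)) (by omega) le_rfl
  have h3 := I.tail (pos (N + n + 1)) (by omega)
  omega

/-- The place of `u` among the tails is within distance `2 * B` of the position of a neighbour of
`u` among the separators. -/
lemma window (I : SepInv N n B l T S pos cnt F) {u c : ℕ} (hu : u ≤ N + n)
    (hc : IsNeighbour F u c) :
    (∀ j < pos c - 2 * B, j < l → T j < u) ∧ (∀ j < l, pos c + 2 * B ≤ j → u < T j) := by
  obtain ⟨hcF, ⟨hcu, hmax⟩ | ⟨huc, hmin⟩⟩ := hc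
  · refine ⟨fun j hj _ => lt_of_lt_of_le (I.below c hcF j (by omega)) hcu, fun j hj hjc => ?_⟩
    obtain ⟨s, hs⟩ : ∃ s, s ∈ F ∧ u < s ∧ ∀ t ∈ F, u < t → s ≤ t := by
      have hne : (F.filter (u < ·)).Nonempty :=
        ⟨N + n + 1, Finset.mem_filter.2 ⟨I.top, by omega⟩⟩
      refine ⟨(F.filter (u < ·)).min' hne, ?_⟩
      have h1 := Finset.min'_mem _ hne
      rw [Finset.mem_filter] at h1
      exact ⟨h1.1, h1.2, fun t ht hut =>
        Finset.min'_le _ _ (Finset.mem_filter.2 ⟨ht, hut⟩)⟩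
    obtain ⟨hsF, hus, hsmin⟩ := hs
    have hcnt := I.cnt_le s hsF
    have hps : pos s ≤ pos c + 2 * B := by
      rcases I.gap s hsF with h1 | ⟨t, htF, ht1, ht2⟩
      · omega
      · have hts : t < s := by
          by_contra hle
          rcases (not_lt.1 hle).eq_or_lt with h3 | h3
          · subst h3; omega
          · have := I.pos_lt hsF htF h3; omega
        have htu : t ≤ u := by
          by_contra hlt
          have := hsmin t htF (by omega); omega
        rcases (hmax t htF htu).eq_or_lt with h3 | h3
        · subst h3; omega
        · have := I.pos_lt htF hcF h3; omega
    exact lt_of_lt_of_le hus (I.above s hsF j hj (by omega))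
  · refine ⟨fun j hj _ => ?_,
      fun j hj hjc => lt_of_lt_of_le huc (I.above c hcF j hj (by omega))⟩
    have hcnt := I.cnt_le c hcF
    rcases I.gap c hcF with h1 | ⟨t, htF, ht1, ht2⟩
    · omega
    · have htc : t < c := by
        by_contra hle
        rcases (not_lt.1 hle).eq_or_lt with h3 | h3
        · subst h3; omega
        · have := I.pos_lt hcF htF h3; omega
      have htu : t ≤ u := by
        by_contra hlt
        have := hmin t htF (by omega); omega
      exact lt_of_lt_of_le (I.below t htF j (by omega)) htu

variable {u j : ℕ}

lemma mono_update (I : SepInv N n B l T S pos cnt F) (hlow : ∀ i < j, T i < u)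
    (hhigh : ∀ i < l, j ≤ i → u < T i) (a b : ℕ) (hab : a < b)
    (hb : b < if j = l then l + 1 else l) :
    Function.update T j u a < Function.update T j u b := by
  simp only [Function.update_apply]
  split_ifs at hb ⊢ with h1 h2 h3
  all_goals first
    | omega
    | exact hhigh b (by omega) (by omega)
    | exact hlow a (by omega)
    | exact I.mono a b hab (by omega)

lemma tail_update (I : SepInv N n B l T S pos cnt F) (hu : N < u ∧ u ≤ N + n)
    (a : ℕ) (ha : a < if j = l then l + 1 else l) :
    N < Function.update T j u a ∧ Function.update T j u a ≤ N + n := by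
  simp only [Function.update_apply]
  split_ifs at ha ⊢ with h1 h2
  all_goals first | exact hu | exact I.tail a (by omega)

/-- Replacing a tail when no group boundary has to move. -/
lemma replace (I : SepInv N n B l T S pos cnt F) (hu : N < u ∧ u ≤ N + n) (hj : j ≤ l)
    (hlow : ∀ i < j, T i < u) (hhigh : ∀ i < l, j ≤ i → u < T i) (hS : S j ≤ u) :
    j ≠ l ∧ SepInv N n B l (Function.update T j u) S pos cnt F := by
  have hjl : j ≠ l := by
    rintro rfl
    have h1 := I.S_pos _ I.top
    rw [I.pos_top] at h1
    omega
  refine ⟨hjl, ⟨fun a b hab hb => I.mono_update hlow hhigh a b hab (by rwa [if_neg hjl]),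
    fun a ha => I.tail_update hu a (by rwa [if_neg hjl]), I.range, I.top, I.pos_le,
    I.S_pos, I.S_mem, ?_, ?_, I.gap, I.cnt_le⟩⟩
  · intro s hs a ha
    by_cases haj : a = j
    · subst haj
      rw [Function.update_self]
      exact (hhigh a (by omega) le_rfl).trans (I.below s hs a ha)
    · rw [Function.update_of_ne haj]; exact I.below s hs a ha
  · intro s hs a ha hsa
    by_cases haj : a = j
    · subst haj
      rw [Function.update_self]
      rcases hsa.eq_or_lt with h1 | h1
      · rw [← h1, I.S_pos s hs] at hS; exact hS
      · exact (I.above s hs _ (by omega) le_rfl).trans (hlow _ h1).le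
    · rw [Function.update_of_ne haj]; exact I.above s hs a ha hsa

/-- Replacing a tail when the group boundary at `j` has to move, and the cell to the right is
free. -/
lemma move (I : SepInv N n B l T S pos cnt F) (hu : N < u ∧ u ≤ N + n) (hj : j ≤ l)
    (hlow : ∀ i < j, T i < u) (hhigh : ∀ i < l, j ≤ i → u < T i) (hS : u < S j)
    (hS' : S (j + 1) = 0) (hcnt : cnt (S j) < B) :
    SepInv N n B (if j = l then l + 1 else l) (Function.update T j u)
      (Function.update (Function.update S j 0) (j + 1) (S j)) (Function.update pos (S j) (j + 1))
      (Function.update cnt (S j) (cnt (S j) + 1)) F := by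
  obtain ⟨hsF, hps⟩ := I.S_mem j (by omega)
  generalize hs : S j = s at *
  have hne : ∀ t ∈ F, t ≠ s → pos t ≠ j ∧ pos t ≠ j + 1 := by
    intro t ht hts
    refine ⟨fun h => hts ?_, fun h => ?_⟩
    · rw [← I.S_pos t ht, h, hs]
    · have h1 := I.S_pos t ht
      rw [h, hS'] at h1
      have := I.range t ht
      omega
  refine ⟨I.mono_update hlow hhigh, I.tail_update hu, I.range, I.top, ?_, ?_, ?_, ?_, ?_, ?_,
    ?_⟩
  · intro t ht
    have h1 := I.pos_le t ht
    rw [Function.update_apply]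
    split_ifs <;> omega
  · intro t ht
    by_cases hts : t = s
    · subst hts; simp
    · obtain ⟨h1, h2⟩ := hne t ht hts
      rw [Function.update_of_ne hts, Function.update_of_ne h2, Function.update_of_ne h1,
        I.S_pos t ht]
  · intro a ha
    by_cases h1 : a = j + 1
    · subst h1; simp [hsF]
    · rw [Function.update_of_ne h1] at ha ⊢
      by_cases h2 : a = j
      · subst h2; simp at ha
      · rw [Function.update_of_ne h2] at ha ⊢
        obtain ⟨h3, h4⟩ := I.S_mem a ha
        refine ⟨h3, ?_⟩
        rw [Function.update_of_ne, h4]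
        intro h5
        rw [h5] at h4
        omega
  · intro t ht a ha
    have h1 := I.pos_le t ht
    by_cases haj : a = j
    · subst haj
      rw [Function.update_self]
      by_cases hts : t = s
      · subst hts; exact hS
      · rw [Function.update_of_ne hts] at ha
        exact (hhigh a (by omega) le_rfl).trans (I.below t ht a ha)
    · rw [Function.update_of_ne haj]
      by_cases hts : t = s
      · subst hts
        rw [Function.update_self] at ha
        exact I.below t ht a (by omega)
      · rw [Function.update_of_ne hts] at ha
        exact I.below t ht a ha
  · intro t ht a ha hta
    by_cases haj : a = j
    · subst haj
      rw [Function.update_self]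
      by_cases hts : t = s
      · subst hts; rw [Function.update_self] at hta; omega
      · rw [Function.update_of_ne hts] at hta
        have h4 := (hne t ht hts).1
        exact (I.above t ht _ (by omega) le_rfl).trans (hlow _ (by omega)).le
    · have hal : a < l := by split_ifs at ha <;> omega
      rw [Function.update_of_ne haj]
      by_cases hts : t = s
      · subst hts
        rw [Function.update_self] at hta
        exact I.above t ht a hal (by omega)
      · rw [Function.update_of_ne hts] at hta
        exact I.above t ht a hal hta
  · intro t ht
    by_cases hts : t = s
    · subst hts
      simp only [Function.update_self]
      rcases I.gap t ht with h1 | ⟨r, hr, h1, h2⟩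
      · left; omega
      · right
        refine ⟨r, hr, ?_⟩
        rw [Function.update_of_ne (by rintro rfl; omega)]
        omega
    · obtain ⟨h3, h4⟩ := hne t ht hts
      simp only [Function.update_of_ne hts]
      rcases I.gap t ht with h1 | ⟨r, hr, h1, h2⟩
      · left; omega
      · right
        refine ⟨r, hr, ?_⟩
        rw [Function.update_apply]
        split_ifs with h5
        · subst h5; omega
        · exact ⟨h1, h2⟩
  · intro t ht
    have h1 := I.cnt_le t ht
    rw [Function.update_apply]
    split_ifs <;> omega

/-- Replacing a tail when the group boundary at `j` has to move and meets the next one: the group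
in between becomes empty, and its separator is removed. -/
lemma merge (I : SepInv N n B l T S pos cnt F) (hu : N < u ∧ u ≤ N + n) (hj : j ≤ l)
    (hlow : ∀ i < j, T i < u) (hhigh : ∀ i < l, j ≤ i → u < T i) (hS : u < S j)
    (hS' : S (j + 1) ≠ 0) (hcnt : cnt (S j) < B) :
    j ≠ l ∧ SepInv N n B l (Function.update T j u) (Function.update S j 0)
      (Function.update pos (S (j + 1)) (j + 1))
      (Function.update cnt (S (j + 1)) (cnt (S j) + 1)) (F.erase (S j)) := by
  obtain ⟨hsF, hps⟩ := I.S_mem j (by omega)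
  obtain ⟨hrF, hpr⟩ := I.S_mem (j + 1) hS'
  generalize hs : S j = s at *
  generalize hr : S (j + 1) = r at *
  have hjl : j ≠ l := by have := I.pos_le r hrF; omega
  have hpos : Function.update pos r (j + 1) = pos := by
    rw [← hpr]; exact Function.update_eq_self _ _
  rw [hpos]
  have hrs : r ≠ s := by rintro rfl; omega
  have hsr : s < r := by
    by_contra h
    have := I.pos_lt hrF hsF (by omega); omega
  have hne : ∀ t ∈ F, t ≠ s → pos t ≠ j := by
    intro t ht hts h
    exact hts (by rw [← I.S_pos t ht, h, hs])
  have hne' : ∀ t ∈ F, t ≠ r → pos t ≠ j + 1 := by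
    intro t ht hts h
    exact hts (by rw [← I.S_pos t ht, h, hr])
  refine ⟨hjl, ⟨fun a b hab hb => I.mono_update hlow hhigh a b hab (by rwa [if_neg hjl]),
    fun a ha => I.tail_update hu a (by rwa [if_neg hjl]),
    fun t ht => I.range t (Finset.mem_of_mem_erase ht), ?_,
    fun t ht => I.pos_le t (Finset.mem_of_mem_erase ht), ?_, ?_, ?_, ?_, ?_, ?_⟩⟩
  · refine Finset.mem_erase.2 ⟨?_, I.top⟩
    have := I.range r hrF
    omega
  · intro t ht
    obtain ⟨h1, h2⟩ := Finset.mem_erase.1 ht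
    rw [Function.update_of_ne (hne t h2 h1), I.S_pos t h2]
  · intro a ha
    by_cases h2 : a = j
    · subst h2; simp at ha
    · rw [Function.update_of_ne h2] at ha ⊢
      obtain ⟨h3, h4⟩ := I.S_mem a ha
      refine ⟨Finset.mem_erase.2 ⟨?_, h3⟩, h4⟩
      rintro h5
      rw [h5] at h4
      omega
  · intro t ht a ha
    obtain ⟨h1, h2⟩ := Finset.mem_erase.1 ht
    rw [Function.update_apply]
    split_ifs with h3
    · subst h3; exact (hhigh a (by omega) le_rfl).trans (I.below t h2 a ha)
    · exact I.below t h2 a ha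
  · intro t ht a ha hta
    obtain ⟨h1, h2⟩ := Finset.mem_erase.1 ht
    rw [Function.update_apply]
    split_ifs with h3
    · subst h3
      have h4 := hne t h2 h1
      exact (I.above t h2 _ (by omega) le_rfl).trans (hlow _ (by omega)).le
    · exact I.above t h2 a ha hta
  · intro t ht
    obtain ⟨h1, h2⟩ := Finset.mem_erase.1 ht
    by_cases htr : t = r
    · subst htr
      rw [Function.update_self, hpr]
      rcases I.gap s hsF with h3 | ⟨x, hx, h3, h4⟩
      · left; omega
      · right
        exact ⟨x, Finset.mem_erase.2 ⟨by rintro rfl; omega, hx⟩, by omega, by omega⟩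
    · rw [Function.update_of_ne htr]
      rcases I.gap t h2 with h3 | ⟨x, hx, h3, h4⟩
      · left; omega
      · right
        by_cases hxs : x = s
        · subst hxs
          have := hne' t h2 htr
          exact ⟨r, Finset.mem_erase.2 ⟨hrs, hrF⟩, by omega, by omega⟩
        · exact ⟨x, Finset.mem_erase.2 ⟨hxs, hx⟩, h3, h4⟩
  · intro t ht
    have h1 := I.cnt_le t (Finset.mem_of_mem_erase ht)
    rw [Function.update_apply]
    split_ifs <;> omega

variable {s : ℕ}

/-- If another group begins among the last `B` tails before `s`, then the group that ends at `s` is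
short enough for a restart of its counter. -/
lemma reset (I : SepInv N n B l T S pos cnt F) (hs : s ∈ F) {q : ℕ} (hq : q < pos s)
    (hq' : pos s ≤ q + B) (hSq : S q ≠ 0) :
    SepInv N n B l T S pos (Function.update cnt s 0) F := by
  refine ⟨I.mono, I.tail, I.range, I.top, I.pos_le, I.S_pos, I.S_mem, I.below, I.above, ?_, ?_⟩
  · intro t ht
    by_cases hts : t = s
    · subst hts
      obtain ⟨h1, h2⟩ := I.S_mem q hSq
      right
      exact ⟨S q, h1, by omega, by simp; omega⟩
    · rw [Function.update_of_ne hts]; exact I.gap t ht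
  · intro t ht
    have h1 := I.cnt_le t ht
    rw [Function.update_apply]
    split_ifs <;> omega

/-- If no group begins among the last `B` tails before `s`, then these tails can be made a group of
their own. -/
lemma split (I : SepInv N n B l T S pos cnt F) (hB : 0 < B) (hs : s ∈ F) (hps : 0 < pos s)
    (hnone : ∀ q, pos s - B ≤ q → q < pos s → S q = 0) :
    T (pos s - B) ∉ F ∧ SepInv N n B l T (Function.update S (pos s - B) (T (pos s - B)))
      (Function.update pos (T (pos s - B)) (pos s - B))
      (Function.update (Function.update cnt s 0) (T (pos s - B)) 0)
      (insert (T (pos s - B)) F) := by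
  have hsl := I.pos_le s hs
  generalize hm : pos s - B = m at *
  have hml : m < l := by omega
  have hzT := I.tail m hml
  generalize hz : T m = z at *
  have hzF : z ∉ F := by
    intro hzF
    have h1 := I.S_pos z hzF
    rcases lt_trichotomy (pos z) m with h2 | h2 | h2
    · have h3 := I.above z hzF (pos z) (by omega) le_rfl
      have h4 := I.mono _ _ h2 hml
      omega
    · rw [h2, hnone m le_rfl (by omega)] at h1; omega
    · have := I.below z hzF m h2; omega
  have hneF : ∀ t ∈ F, t ≠ z := fun t ht h => hzF (h ▸ ht)
  refine ⟨hzF, ⟨I.mono, I.tail, ?_, Finset.mem_insert_of_mem I.top, ?_, ?_, ?_, ?_, ?_, ?_, ?_⟩⟩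
  · intro t ht
    rcases Finset.mem_insert.1 ht with rfl | ht
    · omega
    · exact I.range t ht
  · intro t ht
    rcases Finset.mem_insert.1 ht with rfl | ht
    · rw [Function.update_self]; omega
    · rw [Function.update_of_ne (hneF t ht)]; exact I.pos_le t ht
  · intro t ht
    rcases Finset.mem_insert.1 ht with rfl | ht
    · simp
    · have h1 : pos t ≠ m := by
        intro h
        have h1 := I.S_pos t ht
        rw [h, hnone m le_rfl (by omega)] at h1
        have := I.range t ht
        omega
      rw [Function.update_of_ne (hneF t ht), Function.update_of_ne h1, I.S_pos t ht]
  · intro a ha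
    by_cases h1 : a = m
    · subst h1; simp
    · rw [Function.update_of_ne h1] at ha ⊢
      obtain ⟨h2, h3⟩ := I.S_mem a ha
      rw [Function.update_of_ne (hneF _ h2)]
      exact ⟨Finset.mem_insert_of_mem h2, h3⟩
  · intro t ht a ha
    rcases Finset.mem_insert.1 ht with rfl | ht
    · rw [Function.update_self] at ha
      rw [← hz]; exact I.mono _ _ ha hml
    · rw [Function.update_of_ne (hneF t ht)] at ha
      exact I.below t ht a ha
  · intro t ht a ha hta
    rcases Finset.mem_insert.1 ht with rfl | ht
    · rw [Function.update_self] at hta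
      rcases hta.eq_or_lt with h1 | h1
      · rw [← h1, hz]
      · rw [← hz]; exact (I.mono _ _ h1 ha).le
    · rw [Function.update_of_ne (hneF t ht)] at hta
      exact I.above t ht a ha hta
  · intro t ht
    rcases Finset.mem_insert.1 ht with rfl | ht
    · simp only [Function.update_self]
      have hc := I.cnt_le s hs
      rcases I.gap s hs with h1 | ⟨x, hx, h1, h2⟩
      · left; omega
      · right
        have h3 : pos x < m := by
          by_contra h3
          have h4 := hnone (pos x) (by omega) h1
          rw [I.S_pos x hx] at h4
          have := I.range x hx
          omega
        refine ⟨x, Finset.mem_insert_of_mem hx, ?_⟩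
        rw [Function.update_of_ne (hneF x hx)]
        omega
    · have htz : t ≠ z := hneF t ht
      rw [Function.update_of_ne htz, Function.update_of_ne htz]
      by_cases hts : t = s
      · subst hts
        right
        refine ⟨z, Finset.mem_insert_self _ _, ?_⟩
        simp only [Function.update_self]
        omega
      · rw [Function.update_of_ne hts]
        rcases I.gap t ht with h1 | ⟨x, hx, h1, h2⟩
        · left; exact h1
        · right
          refine ⟨x, Finset.mem_insert_of_mem hx, ?_⟩
          rw [Function.update_of_ne (hneF x hx)]
          exact ⟨h1, h2⟩
  · intro t ht
    rcases Finset.mem_insert.1 ht with rfl | ht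
    · simp
    · have h1 := I.cnt_le t ht
      simp only [Function.update_apply]
      split_ifs <;> omega

end SepInv

/-! ### Notation for programs, and simplification of weakest preconditions -/

instance : Coe Reg Ex := ⟨.var⟩
instance (k : ℕ) : OfNat Ex k := ⟨.lit k⟩
instance : Add Ex := ⟨.op .add⟩
instance : Sub Ex := ⟨.op .sub⟩
instance : Mul Ex := ⟨.op .mul⟩
instance : Div Ex := ⟨.op .div⟩

/-- The expression `x / 2 ^ y`. -/
def Ex.shr (x y : Ex) : Ex := .op .shiftRight x y

/-- The expression `x < y`. -/
def Ex.less (x y : Ex) : Ex := .op .lt x y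

/-- The expression `x = y`. -/
def Ex.equal (x y : Ex) : Ex := .op .eq x y

section simplification

variable (M : Machine) (a : Store) (x y : Ex) (r : Reg) (A : Arr) (k c : ℕ) (Q : Store → Prop)

@[simp] lemma eval_var : (Ex.var r).eval a = a.v r := rfl
@[simp] lemma eval_lit : (no_index (OfNat.ofNat k) : Ex).eval a = k := rfl
@[simp] lemma eval_get : (Ex.get A x).eval a = a.m A (x.eval a) := rfl
@[simp] lemma eval_add : (x + y).eval a = x.eval a + y.eval a := rfl
@[simp] lemma eval_sub : (x - y).eval a = x.eval a - y.eval a := rfl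
@[simp] lemma eval_mul : (x * y).eval a = x.eval a * y.eval a := rfl
@[simp] lemma eval_div : (x / y).eval a = x.eval a / y.eval a := rfl
@[simp] lemma eval_shr : (x.shr y).eval a = x.eval a / 2 ^ y.eval a := rfl
lemma eval_less : (x.less y).eval a = if x.eval a < y.eval a then 1 else 0 := rfl
lemma eval_equal : (x.equal y).eval a = if x.eval a = y.eval a then 1 else 0 := rfl
@[simp] lemma less_ne_zero : (x.less y).eval a ≠ 0 ↔ x.eval a < y.eval a := by
  rw [eval_less]; split_ifs <;> simp [*]
@[simp] lemma less_eq_zero : (x.less y).eval a = 0 ↔ y.eval a ≤ x.eval a := by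
  rw [eval_less]; split_ifs <;> simp <;> omega
@[simp] lemma equal_ne_zero : (x.equal y).eval a ≠ 0 ↔ x.eval a = y.eval a := by
  rw [eval_equal]; split_ifs <;> simp [*]
@[simp] lemma equal_eq_zero : (x.equal y).eval a = 0 ↔ x.eval a ≠ y.eval a := by
  rw [eval_equal]; split_ifs <;> simp [*]

@[simp] lemma ok_var : (Ex.var r).ok M a := trivial
@[simp] lemma ok_lit : (no_index (OfNat.ofNat k) : Ex).ok M a ↔ k < 64 := Iff.rfl
@[simp] lemma ok_get : (Ex.get A x).ok M a ↔ x.ok M a ∧ x.eval a < M.size A := Iff.rfl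
@[simp] lemma ok_add :
    (x + y).ok M a ↔ x.ok M a ∧ y.ok M a ∧ x.eval a + y.eval a < 2 ^ M.w := by
  change _ ∧ _ ∧ (_ ∨ _) ↔ _; simp [shrinking, Op.eval]
@[simp] lemma ok_mul :
    (x * y).ok M a ↔ x.ok M a ∧ y.ok M a ∧ x.eval a * y.eval a < 2 ^ M.w := by
  change _ ∧ _ ∧ (_ ∨ _) ↔ _; simp [shrinking, Op.eval]
@[simp] lemma ok_sub : (x - y).ok M a ↔ x.ok M a ∧ y.ok M a := by
  change _ ∧ _ ∧ (_ ∨ _) ↔ _; simp [shrinking]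
@[simp] lemma ok_div : (x / y).ok M a ↔ x.ok M a ∧ y.ok M a := by
  change _ ∧ _ ∧ (_ ∨ _) ↔ _; simp [shrinking]
@[simp] lemma ok_shr : (x.shr y).ok M a ↔ x.ok M a ∧ y.ok M a := by
  change _ ∧ _ ∧ (_ ∨ _) ↔ _; simp [shrinking]
@[simp] lemma ok_less : (x.less y).ok M a ↔ x.ok M a ∧ y.ok M a := by
  change _ ∧ _ ∧ (_ ∨ _) ↔ _; simp [shrinking]
@[simp] lemma ok_equal : (x.equal y).ok M a ↔ x.ok M a ∧ y.ok M a := by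
  change _ ∧ _ ∧ (_ ∨ _) ↔ _; simp [shrinking]

@[simp] lemma cost_var : (Ex.var r).cost = 1 := rfl
@[simp] lemma cost_lit : (no_index (OfNat.ofNat k) : Ex).cost = 1 := rfl
@[simp] lemma cost_get : (Ex.get A x).cost = x.cost + 6 := rfl
@[simp] lemma cost_add : (x + y).cost = x.cost + y.cost + 1 := rfl
@[simp] lemma cost_sub : (x - y).cost = x.cost + y.cost + 1 := rfl
@[simp] lemma cost_mul : (x * y).cost = x.cost + y.cost + 1 := rfl
@[simp] lemma cost_div : (x / y).cost = x.cost + y.cost + 1 := rfl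
@[simp] lemma cost_shr : (x.shr y).cost = x.cost + y.cost + 1 := rfl
@[simp] lemma cost_less : (x.less y).cost = x.cost + y.cost + 1 := rfl
@[simp] lemma cost_equal : (x.equal y).cost = x.cost + y.cost + 1 := rfl

@[simp] lemma size_io : M.size .io = M.D := rfl

@[simp] lemma wp_skip : Cmd.skip.wp M a Q ↔ Q (a.tick 1) := Iff.rfl
@[simp] lemma wp_asg :
    (Cmd.asg r x).wp M a Q ↔ x.ok M a ∧ Q (a.set r (x.eval a) (x.cost + 1)) := Iff.rfl
@[simp] lemma wp_put : (Cmd.put A x y).wp M a Q ↔ x.ok M a ∧ y.ok M a ∧ x.eval a < M.size A ∧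
    Q (a.put A (x.eval a) (y.eval a) (x.cost + y.cost + 6)) := Iff.rfl
@[simp] lemma wp_ite (p q : Cmd) : (Cmd.ite x p q).wp M a Q ↔
    x.ok M a ∧ (x.eval a ≠ 0 → p.wp M (a.tick (x.cost + 1)) Q) ∧
      (x.eval a = 0 → q.wp M (a.tick (x.cost + 1)) Q) := Iff.rfl
@[simp] lemma wp_nil : (Cmd.block []).wp M a Q ↔ Q (a.tick 1) := Iff.rfl
@[simp] lemma wp_cons (p : Cmd) (ps : List Cmd) : (Cmd.block (p :: ps)).wp M a Q ↔
    p.wp M a (fun a' => (Cmd.block ps).wp M a' Q) := Iff.rfl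

end simplification

lemma size_arr (M : Machine) {A : Arr} (hA : A ≠ .io) : M.size A = M.cap := if_neg hA

/-- A machine for inputs of length `n`, with a trie of height `h` over `2 ^ h = N` leaves. -/
structure Setting (M : Machine) (n N h : ℕ) : Prop where
  pow : N = 2 ^ h
  le : n + 2 ≤ N
  D : M.D = 2 * n + 2
  cap : M.cap = 4 * N

lemma Setting.bound {M : Machine} {n N h : ℕ} (S : Setting M n N h) :
    M.cap = 4 * N ∧ n + 2 ≤ N ∧ h < N ∧ 128 * N + 2 ≤ 2 ^ M.w ∧ 1 ≤ h := by
  have h1 := M.fits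
  have h2 := M.small
  have h3 := S.D
  have h4 := S.cap
  have h5 := S.le
  refine ⟨h4, h5, ?_, by omega, ?_⟩
  · rw [S.pow]; exact Nat.lt_two_pow_self
  · by_contra h0
    have h6 := S.pow
    obtain rfl : h = 0 := by omega
    simp at h6
    omega

/-- The variables that hold the parameters of the computation have the right values. -/
structure Globals (n N h : ℕ) (a : Store) : Prop where
  n : a.v .n = n
  N : a.v .N = N
  h : a.v .h = h

/-! ### Binary search -/

section
open Reg

/-- Binary search for the first index in the range from `lo` to `hi` that passes the test `e` of
`mid`. -/
def bsearch (e : Ex) : Cmd :=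
  .loop (Ex.less lo hi) (.block [
    .asg mid ((lo + hi) / 2),
    .ite e (.asg hi mid) (.asg lo (mid + 1))])

end

lemma bsearch_wp {M : Machine} {e : Ex} {a : Store} (p : ℕ → Prop) (K : ℕ)
    (hle : a.v .lo ≤ a.v .hi) (hK : a.v .hi - a.v .lo < 2 ^ K)
    (hw : a.v .hi + a.v .hi < 2 ^ M.w)
    (htest : ∀ a' : Store, (∀ r, r ≠ .lo → r ≠ .hi → r ≠ .mid → a'.v r = a.v r) → a'.m = a.m →
      a.v .lo ≤ a'.v .mid → a'.v .mid < a.v .hi →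
      e.ok M a' ∧ (e.eval a' ≠ 0 ↔ p (a'.v .mid)))
    (hup : ∀ x y, p x → x ≤ y → y < a.v .hi → p y) {Q : Store → Prop}
    (hQ : ∀ a' : Store, (∀ r, r ≠ .lo → r ≠ .hi → r ≠ .mid → a'.v r = a.v r) → a'.m = a.m →
      a.v .lo ≤ a'.v .lo → a'.v .lo ≤ a.v .hi → (∀ x, a.v .lo ≤ x → x < a'.v .lo → ¬ p x) →
      (∀ x, a'.v .lo ≤ x → x < a.v .hi → p x) → a'.t ≤ a.t + (e.cost + 20) * K + 10 → Q a') :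
    (bsearch e).wp M a Q := by
  refine Cmd.wp_loop (fun k a' => (∀ r, r ≠ .lo → r ≠ .hi → r ≠ .mid → a'.v r = a.v r) ∧
    a'.m = a.m ∧ a.v .lo ≤ a'.v .lo ∧ a'.v .lo ≤ a'.v .hi ∧ a'.v .hi ≤ a.v .hi ∧
    (∀ x, a.v .lo ≤ x → x < a'.v .lo → ¬ p x) ∧ (∀ x, a'.v .hi ≤ x → x < a.v .hi → p x) ∧
    a'.v .hi - a'.v .lo < 2 ^ k ∧ a'.t + (e.cost + 20) * k ≤ a.t + (e.cost + 20) * K) ?_ K a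
    ⟨fun _ _ _ _ => rfl, rfl, le_rfl, hle, le_rfl, fun x h1 h2 => by omega,
      fun x h1 h2 => by omega, hK, le_rfl⟩
  rintro k a' ⟨h1, h2, h3, h4, h5, h6, h7, h8, h9⟩
  simp only [ok_less, ok_var, and_self, true_and, less_ne_zero, less_eq_zero, eval_var, cost_less,
    cost_var]
  constructor
  · intro hlt'
    obtain ⟨k, rfl⟩ : ∃ k', k = k' + 1 := by
      rcases k with _ | k
      · simp at h8; omega
      · exact ⟨k, rfl⟩
    rw [mul_add] at h9
    rw [pow_succ] at h8
    have hmid1 : a'.v .lo ≤ (a'.v .lo + a'.v .hi) / 2 := by omega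
    have hmid2 : (a'.v .lo + a'.v .hi) / 2 < a'.v .hi := by omega
    simp only [wp_cons, wp_nil, wp_asg, ok_div, ok_add, ok_var, ok_lit, eval_var, Store.tick_v,
      eval_div, eval_add, eval_lit, cost_div, cost_add, cost_var, cost_lit, true_and, wp_ite]
    obtain ⟨hok, hp⟩ := htest (((a'.tick (1 + 1 + 1 + 1)).set .mid ((a'.v .lo + a'.v .hi) / 2)
      (1 + 1 + 1 + 1 + 1 + 1))) (fun r hr1 hr2 hr3 => by simp [hr3, h1 r hr1 hr2])
      (by simp [h2]) (by simp; omega) (by simp; omega)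
    simp only [Store.set_v, if_true] at hp
    refine ⟨⟨by omega, by norm_num⟩, hok, fun he => ⟨k, by omega, ?_⟩,
      fun he => ⟨by simp; omega, k, by omega, ?_⟩⟩
    · rw [hp] at he
      refine ⟨fun r hr1 hr2 hr3 => by simp [hr2, hr3, h1 r hr1 hr2], by simp [h2],
        by simpa using h3,
        by simpa using hmid1, by simp; omega, by simpa using h6, ?_, by simp; omega,
        by simp; omega⟩
      intro x hx hx'
      simp only [Store.tick_v, Store.set_v] at hx
      exact hup _ _ he hx hx'
    · have he' : ¬ p ((a'.v .lo + a'.v .hi) / 2) := by rw [← hp]; simpa using he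
      refine ⟨fun r hr1 hr2 hr3 => by simp [hr1, hr3, h1 r hr1 hr2], by simp [h2],
        by simp; omega, by simp; omega, by simpa using h5, ?_, by simpa using h7,
        by simp; omega, by simp; omega⟩
      intro x hx hx' hpx
      simp at hx'
      exact he' (hup _ _ hpx (by omega) (by omega))
  · intro hge
    have hge' : a'.v .lo = a'.v .hi := by omega
    exact hQ _ (by simpa using h1) (by simpa using h2) (by simpa using h3) (by simp; omega)
      (by simpa using h6) (by simpa [hge'] using h7) (by simp; omega)

/-! ### Updating the trie -/

section
open Reg

/-- Recompute the entries of the trie on the path from the leaf `v` to the root. -/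
def trieUp (b : Bool) : Cmd :=
  .loop (Ex.less 1 v) (.block [
    .asg v (v / 2),
    .asg c (.get (.mx b) (2 * v + 1)),
    .ite c .skip (.asg c (.get (.mx b) (2 * v))),
    .put (.mx b) v c,
    .asg c (.get (.mn b) (2 * v)),
    .ite c .skip (.asg c (.get (.mn b) (2 * v + 1))),
    .put (.mn b) v c])

end

/-- The rule for replacing the value `0` of a variable by a default value. -/
lemma wp_default {M : Machine} {a : Store} {r : Reg} {e : Ex} {Q : Store → Prop}
    (hok : ∀ c, e.ok M (a.tick c))
    (hQ : ∀ a' : Store, a'.v = Function.update a.v r (if a.v r = 0 then e.eval a else a.v r) →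
      a'.m = a.m → a'.t ≤ a.t + e.cost + 4 → Q a') :
    (Cmd.ite (.var r) .skip (.asg r e)).wp M a Q := by
  have heval : ∀ c, e.eval (a.tick c) = e.eval a := by
    intro c
    clear hok hQ
    induction e with
    | var r => rfl
    | lit k => rfl
    | op o x y ihx ihy => simp only [Ex.eval, ihx, ihy]
    | get A x ih => simp only [Ex.eval, ih, Store.tick_m]
  refine ⟨trivial, fun h0 => ?_, fun h0 => ⟨hok _, ?_⟩⟩
  · simp only [eval_var] at h0
    refine hQ _ ?_ rfl (by simp [cost_var]; omega)
    rw [if_neg h0, Function.update_eq_self]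
    rfl
  · simp only [eval_var] at h0
    refine hQ _ ?_ rfl (by simp [cost_var]; omega)
    rw [if_pos h0, heval]
    rfl

lemma trieUp_wp {M : Machine} {n N h : ℕ} (S : Setting M n N h) {b : Bool} {a : Store} {u : ℕ}
    {F : Finset ℕ} (hv : a.v .v = u) (hu : N ≤ u) (hu' : u < 2 * N) (hF : ∀ s ∈ F, 0 < s)
    (hinv : TrieInvBut h u F (a.m (.mx b)) (a.m (.mn b)) 0) {Q : Store → Prop}
    (hQ : ∀ a' : Store, (∀ r, r ≠ .v → r ≠ .c → a'.v r = a.v r) →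
      (∀ A, A ≠ .mx b → A ≠ .mn b → a'.m A = a.m A) →
      TrieInv h F (a'.m (.mx b)) (a'.m (.mn b)) → a'.t ≤ a.t + 100 * h + 10 → Q a') :
    (trieUp b).wp M a Q := by
  obtain ⟨hcap, -, hhN, hw, -⟩ := S.bound
  have hpow := S.pow
  have hmx : M.size (.mx b) = 4 * N := by rw [size_arr M (by simp), hcap]
  have hmn : M.size (.mn b) = 4 * N := by rw [size_arr M (by simp), hcap]
  refine Cmd.wp_loop (fun k a' => ∃ e, e ≤ h ∧ k = h - e ∧ a'.v .v = u / 2 ^ e ∧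
    (∀ r, r ≠ .v → r ≠ .c → a'.v r = a.v r) ∧
    (∀ A, A ≠ .mx b → A ≠ .mn b → a'.m A = a.m A) ∧
    TrieInvBut h u F (a'.m (.mx b)) (a'.m (.mn b)) e ∧ a'.t ≤ a.t + 100 * e) ?_ h a
    ⟨0, by omega, rfl, by simpa using hv, fun _ _ _ => rfl, fun _ _ _ => rfl, hinv, by omega⟩
  rintro k a' ⟨e, he, hk, hve, hreg, hmem, hbut, ht⟩
  have hnode : IsNode (2 ^ h) e (u / 2 ^ e) := isNode_div (hpow ▸ hu) (hpow ▸ hu') he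
  simp only [ok_less, ok_var, ok_lit, less_ne_zero, less_eq_zero,
    eval_var, eval_lit, cost_less, cost_var,
    cost_lit]
  refine ⟨by norm_num, fun hlt => ?_, fun hge => ?_⟩
  · have hlt' : 1 < u / 2 ^ e := by by_contra h; simp [hve, h] at hlt
    have heh : e < h := by
      by_contra hne
      obtain rfl : e = h := by omega
      have h1 : u / 2 ^ e < 2 := by rw [Nat.div_lt_iff_lt_mul (by positivity)]; omega
      omega
    have hdiv : u / 2 ^ e / 2 = u / 2 ^ (e + 1) := (div_pow_succ u e).symm
    have hbut' := hbut.step (hpow ▸ hu) (hpow ▸ hu') hF heh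
    have hv4 : u / 2 ^ (e + 1) < N := by rw [← hdiv]; have := hnode.lt; omega
    simp only [wp_cons, wp_asg, ok_div, ok_var, ok_lit, eval_div, eval_var, eval_lit, Store.tick_v,
      hve, hdiv, ok_get, ok_add, ok_mul, eval_add, eval_mul, Store.set_v, if_true, eval_get,
      Store.set_m, Store.tick_m, hmx]
    generalize hvdef : u / 2 ^ (e + 1) = v at *
    refine ⟨by norm_num, ⟨⟨⟨by norm_num, trivial, by omega⟩, by norm_num, by omega⟩, by omega⟩, ?_⟩
    refine wp_default ?_ ?_
    · intro c; simp [hmx]; omega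
    intro a₁ hv₁ hm₁ ht₁
    have hv1v : a₁.v .v = v := by rw [hv₁]; simp
    simp only [wp_put, ok_var, eval_var, hmx,
      Store.put_v, hv1v, hmn, true_and]
    refine ⟨by omega, ⟨⟨by norm_num, by omega⟩, by omega⟩, ?_⟩
    refine wp_default ?_ ?_
    · intro c; simp [hmn, hv1v]; omega
    intro a₂ hv₂ hm₂ ht₂
    have hv2v : a₂.v .v = v := by rw [hv₂]; simp [hv1v]
    simp only [hv2v, wp_nil]
    refine ⟨by omega, k - 1, by omega, e + 1, heh, by omega, ?_, ?_, ?_, ?_, ?_⟩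
    · simp only [Store.tick_v, Store.put_v, hv2v, hvdef]
    · intro r hr1 hr2
      simp only [Store.tick_v, Store.put_v]
      rw [hv₂, Function.update_of_ne hr2, Store.set_v, if_neg hr2, Store.put_v, hv₁,
        Function.update_of_ne hr2, Store.set_v, if_neg hr2, Store.set_v, if_neg hr1, Store.tick_v,
        hreg r hr1 hr2]
    · intro A hA1 hA2
      simp [hm₂, hm₁, hA1, hA2, hmem A hA1 hA2]
    · convert hbut' using 1
      · simp [hm₂, hm₁, hv₁]
      · simp [hm₂, hm₁, hv₂, hv1v]
    · simp at ht₁ ht₂ ⊢; omega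
  · rw [hve] at hge
    have heh : e = h := by
      by_contra hne
      have h1 : 2 ^ (e + 1) ≤ 2 ^ h := Nat.pow_le_pow_right (by norm_num) (by omega)
      have h2 := hnode.1
      rw [pow_succ] at h1
      have h3 : 0 < 2 ^ e := by positivity
      nlinarith
    subst heh
    exact hQ _ (by simpa using hreg) (by simpa using hmem) (by simpa using hbut.full)
      (by simp; omega)

/-! ### Locating a key among the tails -/

section
open Reg

/-- Find a neighbour `c` of `u` among the separators: binary search for the lowest ancestor of the
leaf `u` that has a separator below it. -/
def findNeighbour (b : Bool) : Cmd := .block [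
  .asg lo 0,
  .asg hi h,
  bsearch (.get (.mx b) (Ex.shr u mid)),
  .asg v (Ex.shr u lo),
  .asg c (.get (.mx b) v),
  .ite (Ex.less u c) (.asg c (.get (.mn b) v)) .skip]

/-- Find the number `lo` of tails that are less than `u`. -/
def locate (b : Bool) : Cmd := .block [
  findNeighbour b,
  .asg mid (.get (.pos b) c),
  .asg lo (mid - 2 * h),
  .asg hi (mid + 2 * h),
  .ite (Ex.less l hi) (.asg hi l) .skip,
  bsearch (Ex.less u (.get (.T b) mid))]

end

lemma findNeighbour_wp {M : Machine} {n N h g : ℕ} (S : Setting M n N h) {b : Bool} {a : Store}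
    {u : ℕ} {F : Finset ℕ} (hg : h < 2 ^ g) (hah : a.v .h = h) (hau : a.v .u = u) (hu : N ≤ u)
    (hu' : u < 2 * N) (hF : ∃ s ∈ F, N ≤ s ∧ s < 2 * N)
    (hinv : TrieInv h F (a.m (.mx b)) (a.m (.mn b))) {Q : Store → Prop}
    (hQ : ∀ a' : Store,
      (∀ r, r ≠ .lo → r ≠ .hi → r ≠ .mid → r ≠ .v → r ≠ .c → a'.v r = a.v r) → a'.m = a.m →
      IsNeighbour F u (a'.v .c) → a'.t ≤ a.t + 30 * g + 60 → Q a') :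
    (findNeighbour b).wp M a Q := by
  obtain ⟨hcap, -, hhN, hw, -⟩ := S.bound
  have hpow := S.pow
  have hmx : M.size (.mx b) = 4 * N := by rw [size_arr M (by simp), hcap]
  have hmn : M.size (.mn b) = 4 * N := by rw [size_arr M (by simp), hcap]
  have hdiv : ∀ e, u / 2 ^ e < 4 * N := fun e => lt_of_le_of_lt (Nat.div_le_self _ _) (by omega)
  simp only [findNeighbour, wp_cons, wp_asg, ok_lit, ok_var, eval_lit, eval_var, Store.set_v]
  refine ⟨by norm_num, trivial, ?_⟩
  simp only [reduceCtorEq, if_false]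
  refine bsearch_wp (fun e => a.m (.mx b) (u / 2 ^ e) ≠ 0) g ?_ ?_ ?_ ?_ ?_ ?_
  · simp
  · simpa [hah] using hg
  · simp [hah]; omega
  · intro a' hr hm _ _
    have hau' : a'.v .u = u := by rw [hr _ (by simp) (by simp) (by simp)]; simpa using hau
    simp [hau', hm, hmx, hdiv]
  · intro x y hx hxy hy
    simp [hah] at hy
    exact hinv.mx_ne_zero (hpow ▸ hu) (hpow ▸ hu') hxy (by omega) hx
  intro a₁ hr₁ hm₁ _ hhi hlow hhigh ht₁
  simp only [Store.set_v, Store.set_m, Store.set_t, hah, if_true] at hr₁ hm₁ hhi hlow hhigh ht₁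
  simp only [reduceCtorEq, if_false] at hlow hhi hhigh
  have hau1 : a₁.v .u = u := by rw [hr₁ _ (by simp) (by simp) (by simp)]; simpa using hau
  have hroot : a.m (.mx b) (u / 2 ^ a₁.v .lo) ≠ 0 := by
    rcases hhi.eq_or_lt with h1 | h1
    · obtain ⟨s, hsF, hs1, hs2⟩ := hF
      rw [h1]
      refine ((hinv h _ le_rfl (isNode_div (hpow ▸ hu) (hpow ▸ hu') le_rfl)).1 s hsF ?_).2.2
      rw [Nat.div_eq_of_lt_le (k := 1) (by omega) (by omega),
        Nat.div_eq_of_lt_le (k := 1) (by omega) (by omega)]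
    · exact hhigh _ le_rfl h1
  have hnb := hinv.neighbour (hpow ▸ hu) (hpow ▸ hu') hhi hroot
    (fun e' he' => by simpa using hlow e' (Nat.zero_le _) he')
  generalize hve : a₁.v .lo = e at *
  have hd := hdiv e
  simp only [wp_asg, ok_shr, ok_var, eval_shr, eval_var, true_and, ok_get, Store.set_v, if_true,
    hau1, hve, hmx, eval_get, Store.set_m, hm₁, wp_ite, ok_less, hmn, wp_nil, Store.tick_v,
    Store.tick_m, wp_skip, less_ne_zero, less_eq_zero]
  simp only [reduceCtorEq, if_false]
  refine ⟨hd, fun hlt => ⟨hd, ?_⟩, fun hge => ?_⟩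
  · rw [if_pos hlt] at hnb
    refine hQ _ ?_ ?_ ?_ ?_
    · intro r h1 h2 h3 h4 h5
      simp [h1, h2, h3, h4, h5, hr₁ r]
    · simp [hm₁]
    · simpa using hnb
    · simp at ht₁ ⊢; omega
  · rw [if_neg (not_lt.2 hge)] at hnb
    refine hQ _ ?_ ?_ ?_ ?_
    · intro r h1 h2 h3 h4 h5
      simp [h1, h2, h3, h4, h5, hr₁ r]
    · simp [hm₁]
    · simpa using hnb
    · simp at ht₁ ⊢; omega

lemma locate_wp {M : Machine} {n N h g l : ℕ} (S : Setting M n N h) {b : Bool} {a : Store}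
    {u : ℕ} {F : Finset ℕ} (hg : h < 2 ^ g) (hah : a.v .h = h) (hau : a.v .u = u) (hal : a.v .l = l)
    (hl : l ≤ n) (hu : N < u) (hu' : u ≤ N + n)
    (hsep : SepInv N n h l (a.m (.T b)) (a.m (.S b)) (a.m (.pos b)) (a.m (.cnt b)) F)
    (hfresh : ∀ j < l, a.m (.T b) j ≠ u)
    (hinv : TrieInv h F (a.m (.mx b)) (a.m (.mn b))) {Q : Store → Prop}
    (hQ : ∀ a' : Store,
      (∀ r, r ≠ .lo → r ≠ .hi → r ≠ .mid → r ≠ .v → r ≠ .c → a'.v r = a.v r) → a'.m = a.m →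
      a'.v .lo ≤ l → (∀ j < a'.v .lo, a.m (.T b) j < u) →
      (∀ j < l, a'.v .lo ≤ j → u < a.m (.T b) j) → a'.t ≤ a.t + 60 * g + 200 → Q a') :
    (locate b).wp M a Q := by
  obtain ⟨hcap, hnN, hhN, hw, -⟩ := S.bound
  have hpos : M.size (.pos b) = 4 * N := by rw [size_arr M (by simp), hcap]
  have hT : M.size (.T b) = 4 * N := by rw [size_arr M (by simp), hcap]
  rw [locate, wp_cons]
  refine findNeighbour_wp S hg hah hau (by omega) (by omega)
    ⟨N + n + 1, hsep.top, by omega, by omega⟩ hinv ?_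
  intro a₁ hr₁ hm₁ hnb ht₁
  obtain ⟨hwin1, hwin2⟩ := hsep.window (by omega) hnb
  have hcF := hsep.range _ hnb.1
  have hcl := hsep.pos_le _ hnb.1
  have h1h : a₁.v .h = h := by rw [hr₁ _ (by simp) (by simp) (by simp) (by simp) (by simp), hah]
  have h1u : a₁.v .u = u := by rw [hr₁ _ (by simp) (by simp) (by simp) (by simp) (by simp), hau]
  have h1l : a₁.v .l = l := by rw [hr₁ _ (by simp) (by simp) (by simp) (by simp) (by simp), hal]
  generalize hc : a₁.v .c = c at *
  simp only [wp_cons, wp_asg, ok_get, ok_var, eval_var, true_and, hc, hpos, eval_get, hm₁, ok_sub,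
    ok_mul, ok_lit, ok_add, eval_lit, eval_mul, eval_sub, eval_add, Store.set_v, reduceCtorEq,
    if_false, if_true, h1h, wp_ite, ok_less, less_ne_zero, less_eq_zero, h1l, wp_skip]
  generalize hp : a.m (.pos b) c = p at *
  have key : ∀ a₂ : Store, (∀ r, r ≠ .lo → r ≠ .hi → r ≠ .mid → a₂.v r = a₁.v r) → a₂.m = a.m →
      a₂.v .lo = p - 2 * h → a₂.v .hi = min (p + 2 * h) l → a₂.t ≤ a₁.t + 50 →
      (Cmd.block [bsearch (Ex.less Reg.u (.get (.T b) Reg.mid))]).wp M a₂ Q := by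
    intro a₂ hr₂ hm₂ hlo hhi ht₂
    have h2u : a₂.v .u = u := by rw [hr₂ _ (by simp) (by simp) (by simp), h1u]
    have hpw : 2 ^ (g + 2) = 4 * 2 ^ g := by ring
    rw [wp_cons]
    refine bsearch_wp (fun j => u < a.m (.T b) j) (g + 2) (by omega) (by omega) (by omega) ?_ ?_ ?_
    · intro a' hr hm h1 h2
      have hau' : a'.v .u = u := by rw [hr _ (by simp) (by simp) (by simp), h2u]
      simp [hau', hm, hm₂, hT]
      omega
    · intro x y hx hxy hy
      rcases hxy.eq_or_lt with rfl | hxy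
      · exact hx
      · exact hx.trans (hsep.mono x y hxy (by omega))
    intro a₃ hr₃ hm₃ h1 h2 hlow hhigh ht₃
    rw [wp_nil]
    refine hQ _ ?_ (by simp [hm₃, hm₂]) (by simp; omega) ?_ ?_ ?_
    · intro r e1 e2 e3 e4 e5
      rw [Store.tick_v, hr₃ r e1 e2 e3, hr₂ r e1 e2 e3, hr₁ r e1 e2 e3 e4 e5]
    · intro j hj
      simp at hj
      by_cases hjp : j < p - 2 * h
      · exact hwin1 j hjp (by omega)
      · have h3 := hlow j (by omega) hj
        have h4 := hfresh j (by omega)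
        omega
    · intro j hj hj'
      simp at hj'
      by_cases hjp : p + 2 * h ≤ j
      · exact hwin2 j hj hjp
      · exact hhigh j hj' (by omega)
    · simp at ht₃ ⊢; omega
  refine ⟨by omega, ⟨by norm_num, by omega⟩, ⟨⟨by norm_num, by omega⟩, by omega⟩, fun hlt => ?_,
    fun hge => ?_⟩
  · refine key _ ?_ (by simp [hm₁]) (by simp) (by simp [h1l]; omega) (by simp)
    intro r e1 e2 e3
    simp [e1, e2, e3]
  · refine key _ ?_ (by simp [hm₁]) (by simp) (by simp; omega) (by simp)
    intro r e1 e2 e3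
    simp [e1, e2, e3]

/-! ### Moving group boundaries -/

section
open Reg

/-- Move the group boundary at index `lo`, which belongs to the separator `s`, one step to the
right. Afterwards `s` is the separator at the new place, and `q` its counter. -/
def advance (b : Bool) : Cmd := .block [
  .put (.S b) lo 0,
  .asg q (.get (.cnt b) s + 1),
  .asg z (.get (.S b) (lo + 1)),
  .ite z
    (.block [.put (.mx b) s 0, .put (.mn b) s 0, .asg v s, trieUp b, .asg s z])
    (.put (.S b) (lo + 1) s),
  .put (.pos b) s (lo + 1),
  .put (.cnt b) s q]

/-- Look for a group boundary among the last `h` indices before `lo + 1`, the position of the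
separator `s`, and create one if there is none. The test of the loop says that `S mid = 0` and
`mid < lo + 1`: a comparison has the value `0` or `1`, and nothing is less than `0`. -/
def splitGroup (b : Bool) : Cmd := .block [
  .put (.cnt b) s 0,
  .asg mid (lo + 1 - h),
  .asg z mid,
  .loop (Ex.less (.get (.S b) mid) (Ex.less mid (lo + 1))) (.asg mid (mid + 1)),
  .ite (Ex.less lo mid)
    (.block [.asg v (.get (.T b) z), .put (.S b) z v, .put (.pos b) v z, .put (.cnt b) v 0,
      .put (.mx b) v v, .put (.mn b) v v, trieUp b])
    .skip]

end

/-- The invariant of the search structure in the store, for `l` tails and the separators `F`. -/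
structure SearchInv (n N h : ℕ) (b : Bool) (l : ℕ) (F : Finset ℕ) (a : Store) : Prop where
  sep : SepInv N n h l (a.m (.T b)) (a.m (.S b)) (a.m (.pos b)) (a.m (.cnt b)) F
  trie : TrieInv h F (a.m (.mx b)) (a.m (.mn b))

/-- The time that has been saved for future updates of the trie: enough for the removal of each
separator, and for the creation of a new one by the time a counter has reached `h`. -/
def potential (h : ℕ) (F : Finset ℕ) (cnt : ℕ → ℕ) : ℕ := 200 * h * F.card + 400 * ∑ t ∈ F, cnt t

lemma sum_update_add {F : Finset ℕ} {s : ℕ} (hs : s ∈ F) (f : ℕ → ℕ) (x : ℕ) :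
    ∑ t ∈ F, Function.update f s x t + f s = ∑ t ∈ F, f t + x := by
  rw [Finset.sum_update_of_mem hs, ← Finset.sum_sdiff (Finset.singleton_subset_iff.2 hs),
    Finset.sum_singleton]
  omega

/-- Amortized over the potential, moving a boundary takes constant time: a removal of a separator
from the trie is paid for by its share of the potential. -/
lemma advance_wp {M : Machine} {n N h l j s u : ℕ} (S : Setting M n N h) {b : Bool} {a : Store}
    {F : Finset ℕ} {T : ℕ → ℕ} (hT : a.m (.T b) = Function.update T j u) (hl : l ≤ n)
    (hu : N < u ∧ u ≤ N + n) (hj : j ≤ l) (hlow : ∀ i < j, T i < u)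
    (hhigh : ∀ i < l, j ≤ i → u < T i)
    (hsep : SepInv N n h l T (a.m (.S b)) (a.m (.pos b)) (a.m (.cnt b)) F)
    (htrie : TrieInv h F (a.m (.mx b)) (a.m (.mn b))) (hcnt : ∀ t ∈ F, a.m (.cnt b) t < h)
    (hlo : a.v .lo = j) (hs : a.v .s = s) (hSj : a.m (.S b) j = s) (hus : u < s)
    {Q : Store → Prop}
    (hQ : ∀ (a' : Store) (F' : Finset ℕ),
      (∀ r, r ≠ .q → r ≠ .z → r ≠ .v → r ≠ .c → r ≠ .s → a'.v r = a.v r) →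
      (∀ A, A ≠ .S b → A ≠ .pos b → A ≠ .cnt b → A ≠ .mx b → A ≠ .mn b → a'.m A = a.m A) →
      SearchInv n N h b (if j = l then l + 1 else l) F' a' → a'.v .s ∈ F' →
      a'.m (.pos b) (a'.v .s) = j + 1 → a'.v .q = a'.m (.cnt b) (a'.v .s) →
      (∀ t ∈ F', t ≠ a'.v .s → a'.m (.cnt b) t < h) →
      a'.t + potential h F' (a'.m (.cnt b)) ≤ a.t + potential h F (a.m (.cnt b)) + 600 → Q a') :
    (advance b).wp M a Q := by
  obtain ⟨hcap, hnN, hhN, hw, hh⟩ := S.bound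
  have hpow := S.pow
  have hsz : ∀ A : Arr, A ≠ .io → M.size A = 4 * N := fun A hA => by rw [size_arr M hA, hcap]
  obtain ⟨hsF, hps⟩ := hsep.S_mem j (by omega)
  rw [hSj] at hsF hps
  have hsr := hsep.range s hsF
  have hcs := hcnt s hsF
  simp only [advance, wp_cons, wp_put, ok_var, ok_lit, eval_var, eval_lit, hlo, wp_asg, ok_add,
    ok_get, eval_add, eval_get, Store.put_v, Store.put_m, Store.set_v, Store.set_m, hs, true_and,
    reduceCtorEq, if_false, if_true, ne_eq, not_false_eq_true, hsz, wp_nil, wp_ite]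
  rw [Function.update_of_ne (show j + 1 ≠ j by omega)]
  refine ⟨by norm_num, by omega, ⟨by omega, by norm_num, by omega⟩,
    ⟨⟨by norm_num, by omega⟩, by omega⟩, fun hz => ?_, fun hz => ?_⟩
  · rw [← hSj] at hus hcs
    obtain ⟨hjl, hsep'⟩ := hsep.merge hu hj hlow hhigh hus hz hcs
    obtain ⟨hrF, hpr⟩ := hsep.S_mem (j + 1) hz
    rw [hSj] at hsep' hus hcs
    generalize hr : a.m (.S b) (j + 1) = r at *
    have hrr := hsep.range r hrF
    have hrs : r ≠ s := by rintro rfl; omega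
    have hrF' : r ∈ F.erase s := Finset.mem_erase.2 ⟨hrs, hrF⟩
    simp only [Store.set_v, Store.tick_v, Store.put_v, reduceCtorEq, if_false, if_true, hs]
    refine ⟨by norm_num, by omega, by norm_num, by omega, ?_⟩
    refine trieUp_wp S (u := s) (b := b) (F := F.erase s) (by simp) (by omega) (by omega)
      (fun t ht => ?_) ?_ ?_
    · have := hsep.range t (Finset.mem_of_mem_erase ht); omega
    · convert htrie.leaf (u := s) (x := 0) (F' := F.erase s) (by omega) (fun t ht => ?_) ?_ using 1
      · simp
      · simp
      · simp [ht]
      · simp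
    intro a₁ hv₁ hm₁ htrie₁ ht₁
    have h1lo : a₁.v .lo = j := by rw [hv₁ _ (by simp) (by simp)]; simp [hlo]
    have h1z : a₁.v .z = r := by rw [hv₁ _ (by simp) (by simp)]; simp
    have h1q : a₁.v .q = a.m (.cnt b) s + 1 := by rw [hv₁ _ (by simp) (by simp)]; simp
    simp only [h1lo, h1z,
      h1q]
    have hsum := Finset.sum_erase_add F (a.m (.cnt b)) hsF
    have hcard := Finset.card_erase_add_one hsF
    have hsum' := sum_update_add hrF' (a.m (.cnt b)) (a.m (.cnt b) s + 1)
    have hpot : potential h (F.erase s)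
        (Function.update (a.m (.cnt b)) r (a.m (.cnt b) s + 1)) + 200 * h ≤
        potential h F (a.m (.cnt b)) + 400 := by
      unfold potential
      rw [← hcard]
      rw [mul_add]
      omega
    refine ⟨⟨by norm_num, by omega⟩, by omega, by omega, hQ _ (F.erase s) ?_ ?_ ?_ ?_ ?_ ?_ ?_ ?_⟩
    · intro r e1 e2 e3 e4 e5
      simp [e1, e2, e3, e5, hv₁ r e3 e4]
    · intro A e1 e2 e3 e4 e5
      simp [e1, e2, e3, e4, e5, hm₁ A e4 e5]
    · rw [if_neg hjl]
      refine ⟨?_, ?_⟩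
      · simpa [hm₁, hT] using hsep'
      · simpa using htrie₁
    · simpa [h1z] using hrF'
    · simp
    · simp [h1q]
    · intro t ht hne
      simp at hne
      simp [hm₁, hne]
      exact hcnt t (Finset.mem_of_mem_erase ht)
    · simp [hm₁] at ht₁ ⊢
      omega
  · rw [← hSj] at hus hcs
    have hsep' := hsep.move hu hj hlow hhigh hus hz hcs
    rw [hSj] at hsep' hus hcs
    simp only [Store.set_v, Store.tick_v, Store.put_v, reduceCtorEq, if_false, if_true, hs, hlo]
    have hsum' := sum_update_add hsF (a.m (.cnt b)) (a.m (.cnt b) s + 1)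
    have hpot : potential h F (Function.update (a.m (.cnt b)) s (a.m (.cnt b) s + 1)) ≤
        potential h F (a.m (.cnt b)) + 400 := by
      unfold potential
      omega
    refine ⟨⟨by norm_num, by omega⟩, by omega, ⟨by norm_num, by omega⟩, by omega, by omega,
      hQ _ F ?_ ?_ ?_ ?_ ?_ ?_ ?_ ?_⟩
    · intro r e1 e2 e3 e4 e5
      simp [e1, e2]
    · intro A e1 e2 e3 e4 e5
      simp [e1, e2, e3]
    · refine ⟨?_, ?_⟩
      · simpa [hT] using hsep'
      · simpa using htrie
    · simpa [hs] using hsF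
    · simp [hs]
    · simp [hs]
    · intro t ht hne
      simp [hs] at hne
      simp [hne]
      exact hcnt t ht
    · simp
      omega

/-- A split resets a counter of value `h`, which frees enough potential for the scan, the update of
the trie and the share of the new separator. -/
lemma splitGroup_wp {M : Machine} {n N h l j s : ℕ} (S : Setting M n N h) {b : Bool} {a : Store}
    {F : Finset ℕ} (hl : l ≤ n) (hinv : SearchInv n N h b l F a) (hah : a.v .h = h)
    (hlo : a.v .lo = j) (hs : a.v .s = s) (hsF : s ∈ F) (hpos : a.m (.pos b) s = j + 1)
    (hcs : a.m (.cnt b) s = h) (hcnt : ∀ t ∈ F, t ≠ s → a.m (.cnt b) t < h) {Q : Store → Prop}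
    (hQ : ∀ (a' : Store) (F' : Finset ℕ),
      (∀ r, r ≠ .mid → r ≠ .z → r ≠ .v → r ≠ .c → a'.v r = a.v r) →
      (∀ A, A ≠ .S b → A ≠ .pos b → A ≠ .cnt b → A ≠ .mx b → A ≠ .mn b → a'.m A = a.m A) →
      SearchInv n N h b l F' a' → (∀ t ∈ F', a'.m (.cnt b) t < h) →
      a'.t + potential h F' (a'.m (.cnt b)) ≤ a.t + potential h F (a.m (.cnt b)) + 200 → Q a') :
    (splitGroup b).wp M a Q := by
  obtain ⟨hcap, hnN, hhN, hw, hh⟩ := S.bound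
  have hpow := S.pow
  have hsz : ∀ A : Arr, A ≠ .io → M.size A = 4 * N := fun A hA => by rw [size_arr M hA, hcap]
  obtain ⟨hsep, htrie⟩ := hinv
  have hsr := hsep.range s hsF
  have hpl := hsep.pos_le s hsF
  have hsum := sum_update_add hsF (a.m (.cnt b)) 0
  have hcnt0 : ∀ t ∈ F, Function.update (a.m (.cnt b)) s 0 t < h := by
    intro t ht
    rw [Function.update_apply]
    split_ifs with h1
    · omega
    · exact hcnt t ht h1
  simp only [splitGroup, wp_cons, wp_put, ok_var, ok_lit, eval_var, eval_lit, hlo, wp_asg, ok_add,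
    ok_sub, eval_add, eval_sub, Store.put_v, hs, true_and,
    reduceCtorEq, ne_eq, not_false_eq_true, hsz, hah]
  refine ⟨by norm_num, by omega, ⟨⟨by norm_num, by omega⟩, trivial⟩, ?_⟩
  generalize hm : j + 1 - h = m at *
  have hmj : m ≤ j := by omega
  refine Cmd.wp_loop (fun k a' => k = j + 1 - a'.v .mid ∧ m ≤ a'.v .mid ∧ a'.v .mid ≤ j + 1 ∧
    (∀ r, r ≠ .mid → r ≠ .z → a'.v r = a.v r) ∧ a'.v .z = m ∧
    (∀ A, A ≠ .cnt b → a'.m A = a.m A) ∧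
    a'.m (.cnt b) = Function.update (a.m (.cnt b)) s 0 ∧
    (∀ q, m ≤ q → q < a'.v .mid → a.m (.S b) q = 0) ∧
    a'.t ≤ a.t + 30 + 20 * (a'.v .mid - m)) ?_ (j + 1 - m) _ ?_
  · rintro k a' ⟨hk, h1, h2, h3, h4, h5, h6, h7, h8⟩
    have hlo' : a'.v .lo = j := by rw [h3 _ (by simp) (by simp), hlo]
    have hs' : a'.v .s = s := by rw [h3 _ (by simp) (by simp), hs]
    simp only [ok_less, ok_get, ok_var, ok_add, ok_lit, eval_var, eval_add, eval_lit, hlo',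
      true_and, hsz, ne_eq, reduceCtorEq, not_false_eq_true, less_eq_zero, eval_get,
      h5, wp_asg, Store.tick_v, wp_ite, wp_cons, wp_skip, wp_nil]
    refine ⟨⟨by omega, by norm_num, by omega⟩, fun hlt => ?_, fun hge => ?_⟩
    · have h9 : a'.v .mid < j + 1 := by
        by_contra h9
        rw [eval_less, if_neg (by simpa [hlo'] using h9)] at hlt
        omega
      rw [eval_less, if_pos (by simpa [hlo'] using h9)] at hlt
      refine ⟨⟨by norm_num, by omega⟩, k - 1, by omega, ?_⟩
      simp only [Store.set_v, Store.set_m, Store.set_t, Store.tick_m, Store.tick_v, Store.tick_t,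
        if_true, cost_less, cost_get, cost_var, cost_add, cost_lit]
      refine ⟨by omega, by omega, by omega, ?_, ?_, h5, h6, ?_, by omega⟩
      · intro r e1 e2
        simp [e1, h3 r e1 e2]
      · simp [h4]
      · intro q hq1 hq2
        rcases Nat.lt_or_ge q (a'.v .mid) with h10 | h10
        · exact h7 q hq1 h10
        · obtain rfl : q = a'.v .mid := by omega
          omega
    · refine ⟨fun hlt => ?_, fun hle => ?_⟩
      · have hnone : ∀ q, a.m (.pos b) s - h ≤ q → q < a.m (.pos b) s → a.m (.S b) q = 0 :=
          fun q hq1 hq2 => h7 q (by omega) (by omega)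
        obtain ⟨hzF, hsep'⟩ := hsep.split (by omega) hsF (by omega) hnone
        rw [hpos, hm] at hzF hsep'
        have hzT := hsep.tail m (by omega)
        have hsum2 : ∑ t ∈ insert (a.m (.T b) m) F,
            Function.update (Function.update (a.m (.cnt b)) s 0) (a.m (.T b) m) 0 t =
            ∑ t ∈ F, Function.update (a.m (.cnt b)) s 0 t := by
          rw [Finset.sum_insert hzF, Function.update_self, zero_add]
          refine Finset.sum_congr rfl fun t ht => Function.update_of_ne ?_ _ _
          rintro rfl
          exact hzF ht
        have hcard := Finset.card_insert_of_notMem hzF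
        have hpot : potential h (insert (a.m (.T b) m) F)
            (Function.update (Function.update (a.m (.cnt b)) s 0) (a.m (.T b) m) 0) + 200 * h =
            potential h F (a.m (.cnt b)) := by
          unfold potential
          rw [hsum2, hcard, mul_add]
          omega
        simp only [wp_put, ok_var, eval_var, Store.set_v, Store.put_v, Store.tick_v,
          Store.tick_m, reduceCtorEq, if_false, if_true, hsz, h4, h5, ne_eq, not_false_eq_true,
          true_and, ok_lit, eval_lit]
        generalize hz : a.m (.T b) m = z at *
        refine ⟨by omega, by omega, by omega, by norm_num, by omega, by omega, by omega, ?_⟩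
        refine trieUp_wp S (u := z) (b := b) (F := insert z F) (by simp) (by omega) (by omega)
          (fun t ht => ?_) ?_ ?_
        · have := hsep'.range t ht; omega
        · convert htrie.leaf (u := z) (x := z) (F' := insert z F) (by omega) (fun t ht => ?_) ?_
            using 1
          · simp [h5]
          · simp [h5]
          · simp [ht]
          · simp
        intro a₁ hv₁ hm₁ htrie₁ ht₁
        refine hQ _ (insert z F) ?_ ?_ ⟨?_, ?_⟩ ?_ ?_
        · intro r e1 e2 e3 e4
          simp [hv₁ r e3 e4, e3, h3 r e1 e2]
        · intro A e1 e2 e3 e4 e5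
          simp [e1, e2, e3, e4, e5, hm₁ A e4 e5, h5]
        · simpa [hm₁, h5, h6] using hsep'
        · simpa using htrie₁
        · intro t ht
          rcases Finset.mem_insert.1 ht with rfl | htF
          · simp [hm₁]; omega
          · have hne : t ≠ z := by rintro rfl; exact hzF htF
            simpa [hm₁, hne, h6] using hcnt0 t htF
        · simp [hm₁, h6] at ht₁ ⊢
          omega
      · rw [eval_less, if_pos (by simpa [hlo'] using by omega)] at hge
        have hsep' := hsep.reset hsF (q := a'.v .mid) (by omega) (by omega) (by omega)
        have hpot : potential h F (Function.update (a.m (.cnt b)) s 0) + 400 * h =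
            potential h F (a.m (.cnt b)) := by
          unfold potential
          omega
        refine hQ _ F ?_ ?_ ⟨?_, ?_⟩ ?_ ?_
        · intro r e1 e2 e3 e4
          simp [h3 r e1 e2]
        · intro A e1 e2 e3 e4 e5
          simp [e3, h5]
        · simpa [h5, h6] using hsep'
        · simpa [h5] using htrie
        · simpa [h6] using hcnt0
        · simp [h6]
          omega
  · refine ⟨by simp, by simp, by simp; omega, ?_, by simp, ?_, by simp, ?_, by simp⟩
    · intro r e1 e2; simp [e1, e2]
    · intro A e1; simp [e1]
    · intro q h1 h2; simp at h2; omega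

/-! ### Lengths of increasing subsequences -/

/-- After the first `i` keys of the sequence `X`: `L a` is one less than the length of a longest
increasing subsequence that ends at `a`, `P a` is the index before `a` in such a subsequence, and,
for `j < l`, `T j` is the least key at the end of an increasing subsequence of length `j + 1`, found
at index `I j`. -/
structure LisInv (i l : ℕ) (X T I L P : ℕ → ℕ) : Prop where
  own : ∀ j < l, I j < i ∧ X (I j) = T j ∧ L (I j) = j
  tail_le : ∀ a < i, L a < l ∧ T (L a) ≤ X a
  incr : ∀ a b, a < b → b < i → X a < X b → L a < L b
  pred : ∀ a < i, L a ≠ 0 → P a < a ∧ X (P a) < X a ∧ L (P a) + 1 = L a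

lemma LisInv.step {i l j : ℕ} {X T I L P : ℕ → ℕ} (H : LisInv i l X T I L P) (hj : j ≤ l)
    (hlow : ∀ a < j, T a < X i) (hhigh : ∀ a < l, j ≤ a → X i < T a) :
    LisInv (i + 1) (if j = l then l + 1 else l) X (Function.update T j (X i))
      (Function.update I j i) (Function.update L i j) (Function.update P i (I (j - 1))) := by
  have hl : l ≤ if j = l then l + 1 else l := by split_ifs <;> omega
  refine ⟨fun a ha => ?_, fun a ha => ?_, fun a b hab hb hX => ?_, fun a ha hL => ?_⟩
  · by_cases haj : a = j
    · subst haj; simp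
    · have hal : a < l := by split_ifs at ha <;> omega
      obtain ⟨h1, h2, h3⟩ := H.own a hal
      rw [Function.update_of_ne haj, Function.update_of_ne haj, Function.update_of_ne (by omega)]
      exact ⟨by omega, h2, h3⟩
  · by_cases hai : a = i
    · subst hai
      simp only [Function.update_self, le_refl, and_true]
      split_ifs <;> omega
    · obtain ⟨h1, h2⟩ := H.tail_le a (by omega)
      rw [Function.update_of_ne hai]
      refine ⟨by omega, ?_⟩
      rw [Function.update_apply]
      split_ifs with h3
      · exact (hhigh _ h1 h3.ge).le.trans h2
      · exact h2
  · rw [Function.update_of_ne (show a ≠ i by omega)]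
    by_cases hbi : b = i
    · subst hbi
      rw [Function.update_self]
      by_contra hle
      obtain ⟨h1, h2⟩ := H.tail_le a (by omega)
      have := hhigh _ h1 (by omega)
      omega
    · rw [Function.update_of_ne hbi]
      exact H.incr a b hab (by omega) hX
  · by_cases hai : a = i
    · subst hai
      rw [Function.update_self] at hL ⊢
      obtain ⟨h1, h2, h3⟩ := H.own (j - 1) (by omega)
      rw [Function.update_self, Function.update_of_ne (by omega), h2, h3]
      exact ⟨h1, hlow _ (by omega), by omega⟩
    · rw [Function.update_of_ne hai] at hL ⊢
      obtain ⟨h1, h2, h3⟩ := H.pred a (by omega) hL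
      rw [Function.update_of_ne hai, Function.update_of_ne (by omega)]
      exact ⟨h1, h2, h3⟩

section
open Reg

/-- Process the key with index `i`. -/
def step (b : Bool) : Cmd := .block [
  .asg u (.get (.X b) i),
  locate b,
  .asg s (.get (.S b) lo),
  .put (.T b) lo u,
  .put (.P b) i (.get (.I b) (lo - 1)),
  .put (.I b) lo i,
  .put (.L b) i lo,
  .ite (Ex.less u s)
    (.block [advance b, .ite (Ex.less q h) .skip (splitGroup b)]) .skip,
  .ite (Ex.equal lo l) (.asg l (l + 1)) .skip,
  .asg i (i + 1)]

/-- Process the whole sequence of keys. -/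
def pass (b : Bool) : Cmd := .block [
  .asg s (N + n + 1),
  .put (.S b) 0 s,
  .put (.mx b) s s,
  .put (.mn b) s s,
  .asg v s,
  trieUp b,
  .asg l 0,
  .asg i 0,
  .loop (Ex.less i n) (step b)]

end

/-- The arrays that a pass writes to. -/
def workArrays (b : Bool) : List Arr :=
  [.T b, .I b, .L b, .P b, .S b, .pos b, .cnt b, .mx b, .mn b]

/-- The invariant of a pass over the keys `X` after the first `i` keys. -/
structure PassInv (n N h : ℕ) (b : Bool) (X : ℕ → ℕ) (i l : ℕ) (F : Finset ℕ) (a : Store) :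
    Prop where
  glob : Globals n N h a
  i_eq : a.v .i = i
  l_eq : a.v .l = l
  l_le : l ≤ i
  X_eq : a.m (.X b) = X
  search : SearchInv n N h b l F a
  cnt_lt : ∀ t ∈ F, a.m (.cnt b) t < h
  lis : LisInv i l X (a.m (.T b)) (a.m (.I b)) (a.m (.L b)) (a.m (.P b))

/-- One key takes time `O(log h)`, amortized over the potential. -/
lemma step_wp {M : Machine} {n N h g i l : ℕ} (S : Setting M n N h) (hg : h < 2 ^ g) {b : Bool}
    {X : ℕ → ℕ} {F : Finset ℕ} {a : Store} (hX : ∀ i < n, N < X i ∧ X i ≤ N + n)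
    (hinj : ∀ i < n, ∀ j < n, X i = X j → i = j) (hi : i < n)
    (H : PassInv n N h b X i l F a) {Q : Store → Prop}
    (hQ : ∀ (a' : Store) (l' : ℕ) (F' : Finset ℕ), PassInv n N h b X (i + 1) l' F' a' →
      (∀ A, A ∉ workArrays b → a'.m A = a.m A) →
      a'.t + potential h F' (a'.m (.cnt b)) ≤
        a.t + potential h F (a.m (.cnt b)) + (60 * g + 1200) → Q a') :
    (step b).wp M a Q := by
  obtain ⟨hcap, hnN, hhN, hw, hh⟩ := S.bound
  have hsz : ∀ A : Arr, A ≠ .io → M.size A = 4 * N := fun A hA => by rw [size_arr M hA, hcap]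
  obtain ⟨⟨gn, gN, gh⟩, hi_eq, hl_eq, hl_le, hX_eq, ⟨hsep, htrie⟩, hcnt, hlis⟩ := H
  simp only [step, wp_cons, wp_asg, ok_get, ok_var, eval_var, true_and, hsz, ne_eq, reduceCtorEq,
    not_false_eq_true, hi_eq, eval_get, hX_eq]
  refine ⟨by omega, ?_⟩
  obtain ⟨hu1, hu2⟩ := hX i hi
  refine locate_wp S (n := n) (l := l) (u := X i) (F := F) hg (by simp [gh]) (by simp)
    (by simp [hl_eq]) (by omega) hu1 hu2 (by simpa using hsep) ?_ (by simpa using htrie) ?_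
  · intro j hj he
    obtain ⟨h1, h2, -⟩ := hlis.own j hj
    simp only [Store.set_m] at he
    rw [← h2] at he
    have := hinj _ (by omega) _ hi he
    omega
  intro a₁ hv₁ hm₁ hj hlow hhigh ht₁
  simp only [Store.set_m] at hm₁ hlow hhigh
  simp only [Store.set_t, cost_get, cost_var] at ht₁
  have h1 : ∀ r, r ≠ .lo → r ≠ .hi → r ≠ .mid → r ≠ .v → r ≠ .c → r ≠ .u → a₁.v r = a.v r := by
    intro r e1 e2 e3 e4 e5 e6
    simp [hv₁ r e1 e2 e3 e4 e5, e6]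
  have hu : a₁.v .u = X i := by simp [hv₁ .u]
  have h1i : a₁.v .i = i := by simp [h1 .i, hi_eq]
  have h1l : a₁.v .l = l := by simp [h1 .l, hl_eq]
  have h1n : a₁.v .n = n := by simp [h1 .n, gn]
  have h1N : a₁.v .N = N := by simp [h1 .N, gN]
  have h1h : a₁.v .h = h := by simp [h1 .h, gh]
  clear hv₁ h1
  generalize hlo : a₁.v .lo = j at *
  have hstep := hlis.step hj hlow hhigh
  -- What remains to be done once the group boundaries have been adjusted.
  have key : ∀ (a₂ : Store) (F' : Finset ℕ),
      (∀ r, r ≠ .q → r ≠ .z → r ≠ .v → r ≠ .c → r ≠ .s → r ≠ .mid → a₂.v r = a₁.v r) →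
      (∀ A, A ∉ workArrays b → a₂.m A = a.m A) →
      a₂.m (.T b) = Function.update (a.m (.T b)) j (X i) →
      a₂.m (.I b) = Function.update (a.m (.I b)) j i →
      a₂.m (.L b) = Function.update (a.m (.L b)) i j →
      a₂.m (.P b) = Function.update (a.m (.P b)) i (a.m (.I b) (j - 1)) →
      SearchInv n N h b (if j = l then l + 1 else l) F' a₂ →
      (∀ t ∈ F', a₂.m (.cnt b) t < h) →
      a₂.t + potential h F' (a₂.m (.cnt b)) ≤
        a.t + potential h F (a.m (.cnt b)) + (60 * g + 1150) →
      (Cmd.block [Cmd.ite (Ex.equal Reg.lo Reg.l) (.asg .l (Reg.l + 1)) .skip,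
        .asg .i (Reg.i + 1)]).wp M a₂ Q := by
    intro a₂ F' hv₂ hm₂ hT₂ hI₂ hL₂ hP₂ hs₂ hc₂ ht₂
    have h2lo : a₂.v .lo = j := by simp [hv₂ .lo, hlo]
    have h2l : a₂.v .l = l := by simp [hv₂ .l, h1l]
    have h2i : a₂.v .i = i := by simp [hv₂ .i, h1i]
    have hX₂ : a₂.m (.X b) = X := by rw [hm₂ _ (by simp [workArrays]), hX_eq]
    simp only [wp_cons, wp_ite, ok_equal, ok_var, equal_ne_zero, equal_eq_zero, eval_var, h2lo, h2l,
      wp_asg, ok_add, ok_lit, eval_add, eval_lit, Store.tick_v, wp_skip, wp_nil, Store.set_v,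
      reduceCtorEq, if_false, h2i, true_and]
    refine ⟨fun he => ⟨⟨by norm_num, by omega⟩, ⟨by norm_num, by omega⟩, ?_⟩,
      fun hne => ⟨⟨by norm_num, by omega⟩, ?_⟩⟩
    · rw [if_pos he] at hs₂ hstep
      refine hQ _ (l + 1) F' ⟨⟨?_, ?_, ?_⟩, ?_, ?_, by omega, ?_, ⟨?_, ?_⟩, ?_, ?_⟩ ?_ ?_
      · simp [hv₂ .n, h1n]
      · simp [hv₂ .N, h1N]
      · simp [hv₂ .h, h1h]
      · simp
      · simp
      · simpa using hX₂
      · simpa using hs₂.sep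
      · simpa using hs₂.trie
      · simpa using hc₂
      · simpa [hT₂, hI₂, hL₂, hP₂] using hstep
      · simpa using hm₂
      · simp; omega
    · rw [if_neg hne] at hs₂ hstep
      refine hQ _ l F' ⟨⟨?_, ?_, ?_⟩, ?_, ?_, by omega, ?_, ⟨?_, ?_⟩, ?_, ?_⟩ ?_ ?_
      · simp [hv₂ .n, h1n]
      · simp [hv₂ .N, h1N]
      · simp [hv₂ .h, h1h]
      · simp
      · simpa using h2l
      · simpa using hX₂
      · simpa using hs₂.sep
      · simpa using hs₂.trie
      · simpa using hc₂
      · simpa [hT₂, hI₂, hL₂, hP₂] using hstep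
      · simpa using hm₂
      · simp; omega
  simp only [ok_get, ok_var, eval_var, true_and, hsz, ne_eq, reduceCtorEq,
    not_false_eq_true, hlo, eval_get, hm₁, wp_put, Store.set_v, if_false, Store.put_v, ok_sub,
    ok_lit, eval_sub, eval_lit, h1i, hu, Store.put_m, Store.set_m]
  refine ⟨by omega, by omega, ⟨by norm_num, by omega⟩, by omega, by omega, by omega, ?_⟩
  rw [wp_ite, less_ne_zero, less_eq_zero]
  simp only [ok_less, ok_var, true_and, eval_var, Store.put_v, Store.set_v, reduceCtorEq, if_false,
    if_true, hu]
  refine ⟨fun hlt => ?_, fun hge => ?_⟩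
  · rw [wp_cons]
    refine advance_wp S (n := n) (l := l) (j := j) (s := a.m (.S b) j) (u := X i) (F := F)
      (T := a.m (.T b)) (by simp [hm₁]) (by omega) ⟨hu1, hu2⟩ hj hlow hhigh
      (by simpa [hm₁] using hsep) (by simpa [hm₁] using htrie) (by simpa [hm₁] using hcnt)
      (by simp [hlo]) (by simp) (by simp [hm₁]) hlt ?_
    intro a₂ F' hv₂ hm₂ hs₂ hsF' hpos' hq' hc₂ ht₂
    have h2 : ∀ r, r ≠ .q → r ≠ .z → r ≠ .v → r ≠ .c → r ≠ .s → a₂.v r = a₁.v r := by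
      intro r e1 e2 e3 e4 e5
      simp [hv₂ r e1 e2 e3 e4 e5, e5]
    have h2h : a₂.v .h = h := by simp [h2 .h, h1h]
    have h2lo : a₂.v .lo = j := by simp [h2 .lo, hlo]
    have hle : a₂.m (.cnt b) (a₂.v .s) ≤ h := hs₂.sep.cnt_le _ hsF'
    have hmw : ∀ A, A ∉ workArrays b → a₂.m A = a.m A := by
      intro A hA
      simp [workArrays] at hA
      rw [hm₂ A (by tauto) (by tauto) (by tauto) (by tauto) (by tauto)]
      simp [hA, hm₁]
    simp at ht₂
    simp only [wp_cons, wp_ite, ok_less, ok_var, less_ne_zero, less_eq_zero, eval_var, h2h,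
      true_and,
      wp_skip, wp_nil]
    refine ⟨fun hlt' => ?_, fun hge' => ?_⟩
    · refine key _ F' ?_ ?_ ?_ ?_ ?_ ?_ ⟨?_, ?_⟩ ?_ ?_
      · intro r e1 e2 e3 e4 e5 e6
        simp [h2 r e1 e2 e3 e4 e5]
      · simpa using hmw
      · simp [hm₂, hm₁]
      · simp [hm₂, hm₁]
      · simp [hm₂, hm₁]
      · simp [hm₂, hm₁]
      · simpa using hs₂.sep
      · simpa using hs₂.trie
      · intro t ht
        by_cases hts : t = a₂.v .s
        · subst hts; simpa [← hq'] using hlt'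
        · simpa using hc₂ t ht hts
      · simp [hm₁] at ht₂ ⊢; omega
    · refine splitGroup_wp S (n := n) (l := if j = l then l + 1 else l) (j := j) (s := a₂.v .s)
        (F := F') (by split_ifs <;> omega) ⟨by simpa using hs₂.sep, by simpa using hs₂.trie⟩
        (by simp [h2h]) (by simp [h2lo]) (by simp) hsF' (by simpa using hpos')
        (by simp; omega) (by simpa using hc₂) ?_
      intro a₃ F₃ hv₃ hm₃ hs₃ hc₃ ht₃
      refine key _ F₃ ?_ ?_ ?_ ?_ ?_ ?_ ⟨?_, ?_⟩ ?_ ?_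
      · intro r e1 e2 e3 e4 e5 e6
        simp [hv₃ r e6 e2 e3 e4, h2 r e1 e2 e3 e4 e5]
      · intro A hA
        have hA' := hA
        simp [workArrays] at hA
        simp only [Store.tick_m]
        rw [hm₃ A (by tauto) (by tauto) (by tauto) (by tauto) (by tauto)]
        exact hmw A hA'
      · simp [hm₃, hm₂, hm₁]
      · simp [hm₃, hm₂, hm₁]
      · simp [hm₃, hm₂, hm₁]
      · simp [hm₃, hm₂, hm₁]
      · simpa using hs₃.sep
      · simpa using hs₃.trie
      · simpa using hc₃
      · simp [hm₁] at ht₂ ht₃ ⊢; omega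
  · obtain ⟨hjl, hsep'⟩ := hsep.replace ⟨hu1, hu2⟩ hj hlow hhigh hge
    rw [wp_skip]
    refine key _ F ?_ ?_ ?_ ?_ ?_ ?_ ⟨?_, ?_⟩ ?_ ?_
    · intro r e1 e2 e3 e4 e5 e6
      simp [e5]
    · intro A hA
      simp [workArrays] at hA
      simp [hA, hm₁]
    · simp [hm₁]
    · simp [hm₁]
    · simp [hm₁]
    · simp [hm₁]
    · rw [if_neg hjl]; simpa [hm₁] using hsep'
    · simpa [hm₁] using htrie
    · simpa [hm₁] using hcnt
    · simp [hm₁]; omega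

/-- A pass computes the lengths of increasing subsequences in time `O(n log h)`. -/
lemma pass_wp {M : Machine} {n N h g : ℕ} (S : Setting M n N h) (hg : h < 2 ^ g) {b : Bool}
    {X : ℕ → ℕ} {a : Store} (hX : ∀ i < n, N < X i ∧ X i ≤ N + n)
    (hinj : ∀ i < n, ∀ j < n, X i = X j → i = j) (hglob : Globals n N h a)
    (hXa : a.m (.X b) = X) (hzero : ∀ A ∈ workArrays b, a.m A = 0) {Q : Store → Prop}
    (hQ : ∀ a' : Store, Globals n N h a' → (∀ A, A ∉ workArrays b → a'.m A = a.m A) →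
      (∃ l ≤ n, LisInv n l X (a'.m (.T b)) (a'.m (.I b)) (a'.m (.L b)) (a'.m (.P b))) →
      a'.t ≤ a.t + n * (60 * g + 1300) + 400 * h + 200 → Q a') :
    (pass b).wp M a Q := by
  obtain ⟨hcap, hnN, hhN, hw, hh⟩ := S.bound
  have hpow := S.pow
  have hsz : ∀ A : Arr, A ≠ .io → M.size A = 4 * N := fun A hA => by rw [size_arr M hA, hcap]
  obtain ⟨gn, gN, gh⟩ := hglob
  simp only [pass, wp_cons, wp_asg, ok_add, ok_var, ok_lit, eval_add, eval_var, eval_lit, gn, gN,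
    wp_put, Store.set_v, Store.put_v, if_true, hsz, ne_eq, reduceCtorEq, not_false_eq_true,
    true_and]
  refine ⟨⟨by omega, by norm_num, by omega⟩, by norm_num, by omega, by omega, by omega, ?_⟩
  have hS0 : a.m (.S b) = 0 := hzero _ (by simp [workArrays])
  have hpos0 : a.m (.pos b) = 0 := hzero _ (by simp [workArrays])
  have hcnt0 : a.m (.cnt b) = 0 := hzero _ (by simp [workArrays])
  have hmx0 : a.m (.mx b) = 0 := hzero _ (by simp [workArrays])
  have hmn0 : a.m (.mn b) = 0 := hzero _ (by simp [workArrays])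
  have hempty : TrieInv h ∅ (0 : ℕ → ℕ) 0 := fun e v _ _ => ⟨by simp, by simp⟩
  refine trieUp_wp S (u := N + n + 1) (b := b) (F := {N + n + 1}) (by simp) (by omega) (by omega)
    (by simp) ?_ ?_
  · convert hempty.leaf (u := N + n + 1) (x := N + n + 1) (F' := {N + n + 1}) (by omega)
      (fun t ht => by simpa using ht) (by simp) using 1
    · simp [hmx0]
    · simp [hmn0]
  intro a₁ hv₁ hm₁ htrie₁ ht₁
  simp at ht₁
  refine ⟨by norm_num, by norm_num, ?_⟩
  obtain ⟨C, hC⟩ : ∃ C, C = 60 * g + 1300 := ⟨_, rfl⟩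
  rw [← hC] at hQ
  refine Cmd.wp_loop (fun k a' => ∃ i l F, k = n - i ∧ i ≤ n ∧ PassInv n N h b X i l F a' ∧
    (∀ A, A ∉ workArrays b → a'.m A = a.m A) ∧
    a'.t + potential h F (a'.m (.cnt b)) ≤
      a.t + (300 * h + 180) + i * C) ?_ n _ ?_
  · rintro k a' ⟨i, l, F, hk, hin, H, hm, ht⟩
    simp only [ok_less, ok_var, less_ne_zero, less_eq_zero, eval_var, H.i_eq, H.glob.n, true_and,
      wp_nil]
    refine ⟨fun hlt => ?_, fun hge => ?_⟩
    · refine step_wp S hg hX hinj hlt (l := l) (F := F) ?_ ?_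
      · exact ⟨⟨H.glob.n, H.glob.N, H.glob.h⟩, H.i_eq, H.l_eq, H.l_le, H.X_eq,
          ⟨H.search.sep, H.search.trie⟩, H.cnt_lt, H.lis⟩
      · intro a₂ l' F' H' hm' ht'
        refine ⟨k - 1, by omega, i + 1, l', F', by omega, by omega, H', ?_, ?_⟩
        · intro A hA
          rw [hm' A hA, Store.tick_m, hm A hA]
        · simp at ht'
          rw [add_mul, one_mul]
          omega
    · obtain rfl : i = n := by omega
      refine hQ _ ⟨H.glob.n, H.glob.N, H.glob.h⟩ (by simpa using hm) ⟨l, H.l_le, ?_⟩ ?_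
      · simpa using H.lis
      · simp; omega
  · refine ⟨0, 0, {N + n + 1}, rfl, Nat.zero_le _, ⟨⟨?_, ?_, ?_⟩, by simp, by simp, le_rfl, ?_,
      ⟨?_, by simpa using htrie₁⟩, ?_, ?_⟩, ?_, ?_⟩
    · simp [hv₁ .n, gn]
    · simp [hv₁ .N, gN]
    · simp [hv₁ .h, gh]
    · simp [hm₁, hXa]
    · refine ⟨by simp, by simp, by simp, by simp, ?_, ?_, ?_, ?_, ?_, ?_, ?_⟩
      · simp [hm₁, hpos0]
      · simp [hm₁, hpos0]
      · intro j hj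
        simp [hm₁, hS0, Function.update_apply] at hj
        simp [hm₁, hS0, hpos0, hj]
      · simp [hm₁, hpos0]
      · simp
      · simp [hm₁, hpos0]
      · simp [hm₁, hcnt0]
    · simp [hm₁, hcnt0]; omega
    · exact ⟨by simp, by simp, by simp, by simp⟩
    · intro A hA
      simp [workArrays] at hA
      simp [hA, hm₁]
    · simp [potential, hm₁, hcnt0]
      omega

/-! ### Avoiding patterns and monotone subsequences -/

/-- A pattern that avoids 213 and 231 consists of its last element, of smaller elements, which
increase, and of larger elements, which decrease. -/
theorem length_le_of_avoids {n k : ℕ} {π : Equiv.Perm (Fin n)} {x L₁ L₂ : ℕ → ℕ}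
    (hx : ∀ i : Fin n, x i = π i + 1)
    (h₁ : ∀ a b, a < b → b < n → x a < x b → L₁ a < L₁ b)
    (h₂ : ∀ a b, a < b → b < n → x b < x a → L₂ a < L₂ b)
    (hk : ∀ i < n, L₁ i + L₂ i + 1 ≤ k) {m : ℕ} {τ : Equiv.Perm (Fin m)}
    (hτ : Avoids213And231 τ) (hm : Matches τ π) : m ≤ k := by
  obtain ⟨f, hf⟩ := hm
  rcases m with _ | m
  · exact Nat.zero_le _
  have hfx : ∀ i j, τ i < τ j → x (f i) < x (f j) := by
    intro i j hij
    have h3 := (hf i j).1 hij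
    rw [Fin.lt_def] at h3
    rw [hx, hx]
    omega
  have hlast : ∀ i, i ≠ Fin.last m → i < Fin.last m := fun i hi => Fin.lt_last_iff_ne_last.2 hi
  -- Three positions before, and including, the last one cannot form a forbidden pattern.
  have h213 : ∀ i j, i < j → j < Fin.last m → τ i < τ (Fin.last m) → τ i < τ j := by
    intro i j hij hjl hil
    by_contra hle
    have hji : τ j < τ i := lt_of_le_of_ne (not_lt.1 hle) (by simpa using hij.ne')
    refine hτ.1 ⟨OrderEmbedding.ofStrictMono ![i, j, Fin.last m] ?_, ?_⟩
    · intro a b hab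
      have h4 := hij.trans hjl
      fin_cases a <;> fin_cases b <;> simp_all
    · intro a b
      have h4 := hji.trans hil
      change (perm213 a < perm213 b ↔ τ (![i, j, Fin.last m] a) < τ (![i, j, Fin.last m] b))
      fin_cases a <;> fin_cases b <;> simp [perm213, hji, hil, h4, hji.le, hil.le, h4.le]
  have h231 : ∀ i j, i < j → j < Fin.last m → τ (Fin.last m) < τ i → τ j < τ i := by
    intro i j hij hjl hil
    by_contra hle
    have hji : τ i < τ j := lt_of_le_of_ne (not_lt.1 hle) (by simpa using hij.ne)
    refine hτ.2 ⟨OrderEmbedding.ofStrictMono ![i, j, Fin.last m] ?_, ?_⟩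
    · intro a b hab
      have h4 := hij.trans hjl
      fin_cases a <;> fin_cases b <;> simp_all
    · intro a b
      have h4 := hil.trans hji
      change (perm231 a < perm231 b ↔ τ (![i, j, Fin.last m] a) < τ (![i, j, Fin.last m] b))
      fin_cases a <;> fin_cases b <;> simp [perm231, hji, hil, h4, hji.le, hil.le, h4.le]
  let e := f (Fin.last m)
  let lows : Finset (Fin (m + 1)) := Finset.univ.filter fun i => τ i < τ (Fin.last m)
  let highs : Finset (Fin (m + 1)) := Finset.univ.filter fun i => τ (Fin.last m) < τ i
  have hlow : lows.card ≤ L₁ e := by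
    rw [← Finset.card_range (L₁ e)]
    have hmono : ∀ i ∈ lows, ∀ j ∈ lows, i < j → L₁ (f i) < L₁ (f j) := by
      intro i hi j hj hij
      simp only [lows, Finset.mem_filter, Finset.mem_univ, true_and] at hi hj
      exact h₁ _ _ (f.strictMono hij) (f j).2
        (hfx _ _ (h213 i j hij (hlast j (by rintro rfl; exact lt_irrefl _ hj)) hi))
    refine Finset.card_le_card_of_injOn (fun i => L₁ (f i)) ?_ ?_
    · intro i hi
      have hi' := hi
      simp only [lows, Finset.coe_filter, Finset.mem_univ, true_and, Set.mem_ofPred_eq] at hi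
      simp only [Finset.coe_range, Set.mem_Iio]
      exact h₁ _ _ (f.strictMono (hlast i (by rintro rfl; exact lt_irrefl _ hi))) (Fin.is_lt _)
        (hfx _ _ hi)
    · intro i hi j hj hij
      rcases lt_trichotomy i j with h | h | h
      · exact absurd hij (hmono i hi j hj h).ne
      · exact h
      · exact absurd hij (hmono j hj i hi h).ne'
  have hhigh : highs.card ≤ L₂ e := by
    rw [← Finset.card_range (L₂ e)]
    have hmono : ∀ i ∈ highs, ∀ j ∈ highs, i < j → L₂ (f i) < L₂ (f j) := by
      intro i hi j hj hij
      simp only [highs, Finset.mem_filter, Finset.mem_univ, true_and] at hi hj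
      exact h₂ _ _ (f.strictMono hij) (f j).2
        (hfx _ _ (h231 i j hij (hlast j (by rintro rfl; exact lt_irrefl _ hj)) hi))
    refine Finset.card_le_card_of_injOn (fun i => L₂ (f i)) ?_ ?_
    · intro i hi
      simp only [highs, Finset.coe_filter, Finset.mem_univ, true_and, Set.mem_ofPred_eq] at hi
      simp only [Finset.coe_range, Set.mem_Iio]
      exact h₂ _ _ (f.strictMono (hlast i (by rintro rfl; exact lt_irrefl _ hi))) (Fin.is_lt _)
        (hfx _ _ hi)
    · intro i hi j hj hij
      rcases lt_trichotomy i j with h | h | h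
      · exact absurd hij (hmono i hi j hj h).ne
      · exact h
      · exact absurd hij (hmono j hj i hi h).ne'
  have huniv : (Finset.univ : Finset (Fin (m + 1))) ⊆ lows ∪ highs ∪ {Fin.last m} := by
    intro i _
    simp only [lows, highs, Finset.mem_union, Finset.mem_filter, Finset.mem_univ, true_and,
      Finset.mem_singleton]
    rcases lt_trichotomy (τ i) (τ (Fin.last m)) with h | h | h
    · exact Or.inl (Or.inl h)
    · exact Or.inr (τ.injective h)
    · exact Or.inl (Or.inr h)
  have hcard := (Finset.card_le_card huniv).trans (Finset.card_union_le _ _)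
  have hcard' := Finset.card_union_le lows highs
  rw [Finset.card_univ, Fintype.card_fin, Finset.card_singleton] at hcard
  have := hk e e.2
  omega

/-- The rank of the marked position `y` among `k` marked positions, if the values at the positions
with mark `1` increase and those with other marks decrease and are larger. -/
def rank (mk : ℕ → ℕ) (k y : ℕ) : ℕ :=
  if mk y = 1 then 1 + Nat.count (fun z => mk z = 1) y
  else k - Nat.count (fun z => mk z ≠ 0 ∧ mk z ≠ 1) y

/-- Positions are marked such that each value at a position with mark `1` is less, and each value at
a position with another mark is greater, than all later marked values. -/
structure Marking (n : ℕ) (x mk : ℕ → ℕ) : Prop where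
  low : ∀ a b, a < b → mk a = 1 → mk b ≠ 0 → x a < x b
  high : ∀ a b, a < b → mk a ≠ 0 → mk a ≠ 1 → mk b ≠ 0 → x b < x a
  lt : ∀ a, mk a ≠ 0 → a < n

lemma count_lt_count {p : ℕ → Prop} [DecidablePred p] {a b : ℕ} (hab : a < b) (ha : p a) :
    Nat.count p a + 1 ≤ Nat.count p b := by
  have h1 : Nat.count p (a + 1) = Nat.count p a + 1 := by simp [Nat.count_succ, ha]
  rw [← h1]
  exact Nat.count_monotone p hab

lemma count_add_count (mk : ℕ → ℕ) (y : ℕ) :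
    Nat.count (fun z => mk z = 1) y + Nat.count (fun z => mk z ≠ 0 ∧ mk z ≠ 1) y =
      Nat.count (fun z => mk z ≠ 0) y := by
  induction y with
  | zero => simp
  | succ y ih =>
    rw [Nat.count_succ, Nat.count_succ, Nat.count_succ]
    split_ifs <;> omega

namespace Marking

variable {n k : ℕ} {x mk : ℕ → ℕ}

lemma count_bounds (H : Marking n x mk) (hk : Nat.count (fun z => mk z ≠ 0) n = k) :
    (∀ a, mk a = 1 → ∀ b, mk b ≠ 0 → mk b ≠ 1 →
      Nat.count (fun z => mk z = 1) a + Nat.count (fun z => mk z ≠ 0 ∧ mk z ≠ 1) b + 2 ≤ k) ∧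
    (∀ a, mk a = 1 → Nat.count (fun z => mk z = 1) a + 1 ≤ k) ∧
    (∀ b, mk b ≠ 0 → mk b ≠ 1 →
      Nat.count (fun z => mk z ≠ 0 ∧ mk z ≠ 1) b + 1 ≤ k) := by
  have h0 := count_add_count mk n
  rw [hk] at h0
  have h1 : ∀ a, mk a = 1 → Nat.count (fun z => mk z = 1) a + 1 ≤
      Nat.count (fun z => mk z = 1) n := fun a ha =>
    count_lt_count (p := fun z => mk z = 1) (H.lt a (by omega)) ha
  have h2 : ∀ b, mk b ≠ 0 → mk b ≠ 1 → Nat.count (fun z => mk z ≠ 0 ∧ mk z ≠ 1) b + 1 ≤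
      Nat.count (fun z => mk z ≠ 0 ∧ mk z ≠ 1) n := fun b hb hb' =>
    count_lt_count (p := fun z => mk z ≠ 0 ∧ mk z ≠ 1) (H.lt b hb) ⟨hb, hb'⟩
  refine ⟨fun a ha b hb hb' => ?_, fun a ha => ?_, fun b hb hb' => ?_⟩
  · have := h1 a ha; have := h2 b hb hb'; omega
  · have := h1 a ha; omega
  · have := h2 b hb hb'; omega

lemma rank_bounds (H : Marking n x mk) (hk : Nat.count (fun z => mk z ≠ 0) n = k) {y : ℕ}
    (hy : mk y ≠ 0) : 1 ≤ rank mk k y ∧ rank mk k y ≤ k := by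
  obtain ⟨-, h2, h3⟩ := H.count_bounds hk
  unfold rank
  split_ifs with h
  · have := h2 y h; omega
  · have := h3 y hy h; omega

lemma rank_lt (H : Marking n x mk) (hk : Nat.count (fun z => mk z ≠ 0) n = k) {a b : ℕ}
    (ha : mk a ≠ 0) (hb : mk b ≠ 0) (hab : x a < x b) : rank mk k a < rank mk k b := by
  obtain ⟨h1, h2, h3⟩ := H.count_bounds hk
  have hne : a ≠ b := by rintro rfl; exact lt_irrefl _ hab
  unfold rank
  rcases Nat.lt_or_gt_of_ne hne with hlt | hlt
  · have ha1 : mk a = 1 := by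
      by_contra h
      have := H.high a b hlt ha h hb
      omega
    rw [if_pos ha1]
    split_ifs with hb1
    · have := count_lt_count (p := fun z => mk z = 1) hlt ha1; omega
    · have := h1 a ha1 b hb hb1; omega
  · have hb1 : mk b ≠ 1 := by
      intro h
      have := H.low b a hlt h ha
      omega
    rw [if_neg hb1]
    split_ifs with ha1
    · have := h1 a ha1 b hb hb1; omega
    · have h4 := count_lt_count (p := fun z => mk z ≠ 0 ∧ mk z ≠ 1) hlt ⟨hb, hb1⟩
      have := h3 a ha ha1
      omega

/-- The marked positions form an occurrence of a pattern that avoids 213 and 231 and whose values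
are the ranks. -/
theorem exists_pattern (H : Marking n x mk) {π : Equiv.Perm (Fin n)}
    (hx : ∀ i : Fin n, x i = π i + 1) (hk : Nat.count (fun z => mk z ≠ 0) n = k) :
    ∃ (σ : Equiv.Perm (Fin k)) (f : Fin k ↪o Fin n), IsMatching σ π f ∧ Avoids213And231 σ ∧
      ∀ j : Fin k, mk (f j) ≠ 0 ∧ Nat.count (fun z => mk z ≠ 0) (f j) = j ∧
        (σ j : ℕ) + 1 = rank mk k (f j) := by
  have hfin : {z | mk z ≠ 0}.Finite :=
    (Set.finite_lt_nat n).subset fun z hz => H.lt z hz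
  have hcard : hfin.toFinset.card = k := by
    rw [← hk, Nat.count_eq_card_filter_range]
    congr 1
    ext z
    simp only [Set.Finite.mem_toFinset, Set.mem_ofPred_eq, Finset.mem_filter, Finset.mem_range]
    exact ⟨fun hz => ⟨H.lt z hz, hz⟩, fun hz => hz.2⟩
  have hmem : ∀ j : Fin k, mk (Nat.nth (fun z => mk z ≠ 0) j) ≠ 0 := fun j =>
    Nat.nth_mem_of_lt_card hfin (lt_of_lt_of_eq j.2 hcard.symm)
  let f : Fin k ↪o Fin n := OrderEmbedding.ofStrictMono
    (fun j => ⟨Nat.nth (fun z => mk z ≠ 0) j, H.lt _ (hmem j)⟩)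
    (fun i j hij => Nat.nth_lt_nth_of_lt_card hfin hij (lt_of_lt_of_eq j.2 hcard.symm))
  have hf : ∀ j, mk (f j) ≠ 0 := hmem
  have hxinj : ∀ i j : Fin n, x i = x j → i = j := by
    intro i j hij
    rw [hx, hx] at hij
    exact π.injective (Fin.ext (by omega))
  let r : Fin k → Fin k := fun j => ⟨rank mk k (f j) - 1, by
    have := H.rank_bounds hk (hf j); omega⟩
  have hr : ∀ j, (r j : ℕ) + 1 = rank mk k (f j) := fun j => by
    have := H.rank_bounds hk (hf j)
    simp only [r]; omega
  have hrinj : Function.Injective r := by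
    intro i j hij
    have h1 : rank mk k (f i) = rank mk k (f j) := by rw [← hr, ← hr, hij]
    rcases lt_trichotomy (x (f i)) (x (f j)) with h | h | h
    · have := H.rank_lt hk (hf i) (hf j) h; omega
    · exact f.injective (hxinj _ _ h)
    · have := H.rank_lt hk (hf j) (hf i) h; omega
  have hmatch : ∀ i j, r i < r j ↔ π (f i) < π (f j) := by
    have hlt : ∀ i j, π (f i) < π (f j) → r i < r j := by
      intro i j hij
      have h1 := H.rank_lt hk (hf i) (hf j) (by rw [hx, hx]; rw [Fin.lt_def] at hij; omega)
      rw [← hr, ← hr] at h1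
      rw [Fin.lt_def]
      omega
    intro i j
    refine ⟨fun hij => ?_, hlt i j⟩
    by_contra hle
    rcases (not_lt.1 hle).eq_or_lt with h | h
    · rw [f.injective (π.injective h)] at hij
      exact lt_irrefl _ hij
    · exact lt_asymm hij (hlt j i h)
  -- No marked value lies between two later ones.
  have hbetween : ∀ i a b : Fin k, i < a → i < b → r a < r i → r i < r b → False := by
    intro i a b hia hib h1 h2
    rw [hmatch, Fin.lt_def] at h1 h2
    have hia' : (f i : ℕ) < f a := f.strictMono hia
    have hib' : (f i : ℕ) < f b := f.strictMono hib
    by_cases hm : mk (f i) = 1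
    · have := H.low _ _ hia' hm (hf a)
      rw [hx, hx] at this
      omega
    · have := H.high _ _ hib' (hf i) hm (hf b)
      rw [hx, hx] at this
      omega
  refine ⟨Equiv.ofBijective r (Finite.injective_iff_bijective.1 hrinj), f, hmatch, ⟨?_, ?_⟩,
    fun j => ⟨hf j, ?_, hr j⟩⟩
  · rintro ⟨g, hg⟩
    exact hbetween (g 0) (g 1) (g 2) (g.strictMono (by decide)) (g.strictMono (by decide))
      ((hg 1 0).1 (by decide)) ((hg 0 2).1 (by decide))
  · rintro ⟨g, hg⟩
    exact hbetween (g 0) (g 2) (g 1) (g.strictMono (by decide)) (g.strictMono (by decide))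
      ((hg 2 0).1 (by decide)) ((hg 0 1).1 (by decide))
  · exact Nat.count_nth_of_lt_card_finite hfin (lt_of_lt_of_eq j.2 hcard.symm)

end Marking

/-! ### Chains of predecessors -/

/-- `y` is one of the first `m` elements after `e` in the chain of predecessors of `e`. -/
def InChain (P : ℕ → ℕ) (e m y : ℕ) : Prop := ∃ t, 1 ≤ t ∧ t ≤ m ∧ P^[t] e = y

section

variable {n e : ℕ} {X L P : ℕ → ℕ}

lemma iterate_pred (hp : ∀ a < n, L a ≠ 0 → P a < a ∧ X (P a) < X a ∧ L (P a) + 1 = L a)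
    (he : e < n) (t : ℕ) (ht : t ≤ L e) : P^[t] e ≤ e ∧ L (P^[t] e) + t = L e := by
  induction t with
  | zero => simp
  | succ t ih =>
    obtain ⟨h1, h2⟩ := ih (by omega)
    obtain ⟨h3, -, h5⟩ := hp (P^[t] e) (by omega) (by omega)
    rw [Function.iterate_succ_apply']
    omega

lemma iterate_pred_lt (hp : ∀ a < n, L a ≠ 0 → P a < a ∧ X (P a) < X a ∧ L (P a) + 1 = L a)
    (he : e < n) {s t : ℕ} (hst : s < t) (ht : t ≤ L e) :
    P^[t] e < P^[s] e ∧ X (P^[t] e) < X (P^[s] e) := by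
  induction t with
  | zero => omega
  | succ t ih =>
    obtain ⟨h1, h2⟩ := iterate_pred hp he t (by omega)
    obtain ⟨h3, h4, -⟩ := hp (P^[t] e) (by omega) (by omega)
    rw [Function.iterate_succ_apply']
    rcases Nat.lt_succ_iff_lt_or_eq.1 hst with h | h
    · obtain ⟨h5, h6⟩ := ih h (by omega)
      exact ⟨by omega, by omega⟩
    · subst h; exact ⟨h3, h4⟩

/-- Elements of a chain are distinct, so the chain has as many elements as steps. -/
lemma card_chain (hp : ∀ a < n, L a ≠ 0 → P a < a ∧ X (P a) < X a ∧ L (P a) + 1 = L a)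
    (he : e < n) : ((Finset.Icc 1 (L e)).image fun t => P^[t] e).card = L e := by
  rw [Finset.card_image_of_injOn, Nat.card_Icc, Nat.add_sub_cancel]
  intro s hs t ht hst
  simp only [Finset.coe_Icc, Set.mem_Icc] at hs ht
  have h1 := (iterate_pred hp he s hs.2).2
  have h2 := (iterate_pred hp he t ht.2).2
  simp only at hst
  rw [hst] at h1
  omega

end

open Classical in
/-- The marks for the increasing chain and the decreasing chain that end at `e`: the elements of the
decreasing chain before `e` get the mark `2`, those of the increasing chain and `e` the mark `1`,
  and
all others the mark `0`. -/
noncomputable def chainMarks (P₁ P₂ : ℕ → ℕ) (e m₁ m₂ y : ℕ) : ℕ :=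
  if InChain P₂ e m₂ y then 2 else if InChain P₁ e m₁ y then 1 else if y = e then 1 else 0

section

variable {n e : ℕ} {X₁ X₂ L₁ L₂ P₁ P₂ : ℕ → ℕ}

lemma chainMarks_spec
    (hp₁ : ∀ a < n, L₁ a ≠ 0 → P₁ a < a ∧ X₁ (P₁ a) < X₁ a ∧ L₁ (P₁ a) + 1 = L₁ a)
    (hp₂ : ∀ a < n, L₂ a ≠ 0 → P₂ a < a ∧ X₂ (P₂ a) < X₂ a ∧ L₂ (P₂ a) + 1 = L₂ a)
    (hX : ∀ a < n, ∀ b < n, X₂ a < X₂ b ↔ X₁ b < X₁ a) (he : e < n) :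
    Marking n X₁ (chainMarks P₁ P₂ e (L₁ e) (L₂ e)) ∧
    Nat.count (fun z => chainMarks P₁ P₂ e (L₁ e) (L₂ e) z ≠ 0) n = L₁ e + L₂ e + 1 := by
  have hle₁ : ∀ t ≤ L₁ e, X₁ (P₁^[t] e) ≤ X₁ e ∧ P₁^[t] e < n := by
    intro t ht
    refine ⟨?_, by have := (iterate_pred hp₁ he t ht).1; omega⟩
    rcases Nat.eq_zero_or_pos t with h | h
    · subst h; simp
    · exact (iterate_pred_lt hp₁ he h ht).2.le
  have hgt₂ : ∀ t, 1 ≤ t → t ≤ L₂ e → X₁ e < X₁ (P₂^[t] e) ∧ P₂^[t] e < n := by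
    intro t ht1 ht
    have h1 : P₂^[t] e < n := by have := (iterate_pred hp₂ he t ht).1; omega
    exact ⟨(hX _ h1 _ he).1 (iterate_pred_lt hp₂ he ht1 ht).2, h1⟩
  have hone : ∀ y, chainMarks P₁ P₂ e (L₁ e) (L₂ e) y = 1 → ∃ t ≤ L₁ e, P₁^[t] e = y := by
    intro y hy
    unfold chainMarks at hy
    by_cases h1 : InChain P₂ e (L₂ e) y
    · rw [if_pos h1] at hy; omega
    rw [if_neg h1] at hy
    by_cases h2 : InChain P₁ e (L₁ e) y
    · obtain ⟨t, -, ht, h⟩ := h2; exact ⟨t, ht, h⟩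
    rw [if_neg h2] at hy
    by_cases h3 : y = e
    · exact ⟨0, Nat.zero_le _, h3.symm⟩
    · rw [if_neg h3] at hy; omega
  have htwo : ∀ y, chainMarks P₁ P₂ e (L₁ e) (L₂ e) y ≠ 0 →
      chainMarks P₁ P₂ e (L₁ e) (L₂ e) y ≠ 1 → InChain P₂ e (L₂ e) y := by
    intro y h0 h1
    by_contra h
    unfold chainMarks at h0 h1
    rw [if_neg h] at h0 h1
    split_ifs at h0 h1 <;> omega
  constructor
  · refine ⟨?_, ?_, ?_⟩
    · intro a b hab ha hb
      obtain ⟨s, hs, rfl⟩ := hone a ha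
      by_cases hb1 : chainMarks P₁ P₂ e (L₁ e) (L₂ e) b = 1
      · obtain ⟨t, ht, rfl⟩ := hone b hb1
        rcases lt_trichotomy s t with h | h | h
        · have := (iterate_pred_lt hp₁ he h ht).1; omega
        · subst h; omega
        · exact (iterate_pred_lt hp₁ he h hs).2
      · obtain ⟨t, ht1, ht, rfl⟩ := htwo b hb hb1
        exact lt_of_le_of_lt (hle₁ s hs).1 (hgt₂ t ht1 ht).1
    · intro a b hab ha0 ha1 hb
      obtain ⟨s, hs1, hs, rfl⟩ := htwo a ha0 ha1
      by_cases hb1 : chainMarks P₁ P₂ e (L₁ e) (L₂ e) b = 1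
      · obtain ⟨t, ht, rfl⟩ := hone b hb1
        exact lt_of_le_of_lt (hle₁ t ht).1 (hgt₂ s hs1 hs).1
      · obtain ⟨t, ht1, ht, rfl⟩ := htwo b hb hb1
        rcases lt_trichotomy s t with h | h | h
        · have := (iterate_pred_lt hp₂ he h ht).1; omega
        · subst h; omega
        · exact (hX _ (hgt₂ s hs1 hs).2 _ (hgt₂ t ht1 ht).2).1 (iterate_pred_lt hp₂ he h hs).2
    · intro a ha
      by_cases ha1 : chainMarks P₁ P₂ e (L₁ e) (L₂ e) a = 1
      · obtain ⟨t, ht, rfl⟩ := hone a ha1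
        exact (hle₁ t ht).2
      · obtain ⟨t, ht1, ht, rfl⟩ := htwo a ha ha1
        exact (hgt₂ t ht1 ht).2
  · have hset : (Finset.range n).filter (fun z => chainMarks P₁ P₂ e (L₁ e) (L₂ e) z ≠ 0) =
        insert e (((Finset.Icc 1 (L₁ e)).image fun t => P₁^[t] e) ∪
          ((Finset.Icc 1 (L₂ e)).image fun t => P₂^[t] e)) := by
      ext y
      simp only [Finset.mem_filter, Finset.mem_range, Finset.mem_insert, Finset.mem_union,
        Finset.mem_image, Finset.mem_Icc]
      constructor
      · rintro ⟨-, hy⟩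
        by_cases h1 : InChain P₁ e (L₁ e) y
        · obtain ⟨t, h2, h3, h4⟩ := h1; exact Or.inr (Or.inl ⟨t, ⟨h2, h3⟩, h4⟩)
        · by_cases h2 : InChain P₂ e (L₂ e) y
          · obtain ⟨t, h3, h4, h5⟩ := h2; exact Or.inr (Or.inr ⟨t, ⟨h3, h4⟩, h5⟩)
          · unfold chainMarks at hy
            rw [if_neg h2, if_neg h1] at hy
            left
            by_contra h3
            exact hy (if_neg h3)
      · rintro (rfl | ⟨t, ⟨h1, h2⟩, rfl⟩ | ⟨t, ⟨h1, h2⟩, rfl⟩)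
        · refine ⟨he, ?_⟩
          unfold chainMarks
          rw [if_pos (rfl : y = y)]
          split_ifs <;> simp
        · refine ⟨(hle₁ t h2).2, ?_⟩
          unfold chainMarks
          rw [if_pos (show InChain P₁ e (L₁ e) _ from ⟨t, h1, h2, rfl⟩)]
          split_ifs <;> simp
        · refine ⟨(hgt₂ t h1 h2).2, ?_⟩
          unfold chainMarks
          rw [if_pos (show InChain P₂ e (L₂ e) _ from ⟨t, h1, h2, rfl⟩)]
          simp
    rw [Nat.count_eq_card_filter_range, hset, Finset.card_insert_of_notMem,
      Finset.card_union_of_disjoint, card_chain hp₁ he, card_chain hp₂ he]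
    · rw [Finset.disjoint_left]
      intro y hy1 hy2
      simp only [Finset.mem_image, Finset.mem_Icc] at hy1 hy2
      obtain ⟨s, ⟨hs1, hs2⟩, rfl⟩ := hy1
      obtain ⟨t, ⟨ht1, ht2⟩, h⟩ := hy2
      have h1 := (hle₁ s hs2).1
      have h2 := (hgt₂ t ht1 ht2).1
      rw [h] at h2
      omega
    · simp only [Finset.mem_union, Finset.mem_image, Finset.mem_Icc, not_or, not_exists, not_and]
      refine ⟨fun t ht h => ?_, fun t ht h => ?_⟩
      · have := (iterate_pred_lt hp₁ he ht.1 ht.2).1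
        rw [h] at this
        simp at this
      · have := (hgt₂ t ht.1 ht.2).1
        rw [h] at this
        exact lt_irrefl _ this

end

/-! ### The program -/

section
open Reg

/-- Compute the least power of two that is at least `n + 2`. -/
def setup : Cmd := .block [
  .asg N 1,
  .asg h 0,
  .loop (Ex.less N (n + 2)) (.block [.asg N (N * 2), .asg h (h + 1)])]

/-- Prepare the two sequences of keys: the values, and the values in reverse order. -/
def loadKeys : Cmd := .block [
  .asg i 0,
  .loop (Ex.less i n) (.block [
    .asg c (.get .io (i + 1)),
    .put (.X false) i (N + c),
    .put (.X true) i (N + (n + 1) - c),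
    .asg i (i + 1)])]

/-- Find the index at which the two chains together are longest. -/
def findBest : Cmd := .block [
  .asg k 0,
  .asg best 0,
  .asg i 0,
  .loop (Ex.less i n) (.block [
    .asg q (.get (.L false) i + .get (.L true) i + 1),
    .ite (Ex.less k q) (.block [.asg k q, .asg best i]) .skip,
    .asg i (i + 1)])]

/-- Give the mark `x` to the chain of predecessors of the index `best`. -/
def markChain (b : Bool) (x : ℕ) : Cmd := .block [
  .asg i best,
  .asg q (.get (.L b) best),
  .loop q (.block [
    .asg i (.get (.P b) i),
    .put .mark i (.lit x),
    .asg q (q - 1)])]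

/-- Write the pattern and the marked values. -/
def output : Cmd := .block [
  .asg i 0,
  .asg q 0,
  .asg low 1,
  .asg high k,
  .loop (Ex.less i n) (.block [
    .asg c (.get .mark i),
    .ite c (.block [
      .asg q (q + 1),
      .put .io (k + q) (.get (.X false) i - N),
      .ite (Ex.equal c 1)
        (.block [.put .io q low, .asg low (low + 1)])
        (.block [.put .io q high, .asg high (high - 1)])]) .skip,
    .asg i (i + 1)]),
  .put .io 0 k]

/-- The algorithm, once the input length is in the variable `n`. -/
def algorithm : Cmd := .block [
  setup,
  loadKeys,
  pass false,
  pass true,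
  findBest,
  .ite k (.block [.put .mark best 1, markChain false 1, markChain true 2]) .skip,
  output]

end

lemma setup_wp {M : Machine} {n N h : ℕ} (S : Setting M n N h)
    (hmin : ∀ h', n + 2 ≤ 2 ^ h' → h ≤ h') {a : Store} (hn : a.v .n = n) {Q : Store → Prop}
    (hQ : ∀ a' : Store, Globals n N h a' → a'.m = a.m → a'.t ≤ a.t + 15 * h + 20 → Q a') :
    setup.wp M a Q := by
  obtain ⟨hcap, hnN, hhN, hw, hh⟩ := S.bound
  have hpow := S.pow
  simp only [setup, wp_cons, wp_asg, ok_lit, eval_lit]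
  refine ⟨by norm_num, by norm_num, ?_⟩
  refine Cmd.wp_loop (fun k a' => ∃ h', k = h - h' ∧ h' ≤ h ∧ a'.v .n = n ∧ a'.v .N = 2 ^ h' ∧
    a'.v .h = h' ∧ a'.m = a.m ∧ a'.t ≤ a.t + 10 + 15 * h') ?_ h _ ?_
  · rintro k a' ⟨h', hk, hh', en, eN, eh, hm, ht⟩
    simp only [ok_less, ok_var, ok_add, ok_lit, less_ne_zero, less_eq_zero, eval_var, eval_add,
      eval_lit, en, eN, true_and, wp_cons, wp_nil, wp_asg, ok_mul, eval_mul, Store.tick_v,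
      Store.set_v, reduceCtorEq, if_false, eh]
    refine ⟨⟨by norm_num, by omega⟩, fun hlt => ?_, fun hge => ?_⟩
    · have hne : h' ≠ h := by rintro rfl; omega
      refine ⟨⟨by norm_num, by omega⟩, ⟨by norm_num, by omega⟩, k - 1, by omega, h' + 1, by omega,
        by omega, by simp [pow_succ], by simp, by simp [hm], by simp; omega⟩
    · obtain rfl : h' = h := le_antisymm hh' (hmin _ hge)
      exact hQ _ ⟨by simp [en], by simp [eN, hpow], by simp [eh]⟩ (by simp [hm]) (by simp; omega)
  · exact ⟨0, rfl, Nat.zero_le _, by simp [hn], by simp, by simp, by simp, by simp⟩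

lemma loadKeys_wp {M : Machine} {n N h : ℕ} (S : Setting M n N h) {a : Store} {x : ℕ → ℕ}
    (hglob : Globals n N h a) (hx : ∀ i < n, a.m .io (i + 1) = x i ∧ x i ≤ n) {Q : Store → Prop}
    (hQ : ∀ a' : Store, Globals n N h a' → (∀ A, (∀ b, A ≠ .X b) → a'.m A = a.m A) →
      (∀ i < n, a'.m (.X false) i = N + x i ∧ a'.m (.X true) i = N + (n + 1) - x i) →
      a'.t ≤ a.t + 60 * n + 20 → Q a') :
    loadKeys.wp M a Q := by
  obtain ⟨hcap, hnN, hhN, hw, hh⟩ := S.bound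
  have hD := S.D
  have hsz : ∀ A : Arr, A ≠ .io → M.size A = 4 * N := fun A hA => by rw [size_arr M hA, hcap]
  simp only [loadKeys, wp_cons, wp_asg, ok_lit, eval_lit]
  refine ⟨by norm_num, ?_⟩
  refine Cmd.wp_loop (fun k a' => ∃ i, k = n - i ∧ i ≤ n ∧ Globals n N h a' ∧ a'.v .i = i ∧
    (∀ A, (∀ b, A ≠ .X b) → a'.m A = a.m A) ∧
    (∀ y < i, a'.m (.X false) y = N + x y ∧ a'.m (.X true) y = N + (n + 1) - x y) ∧
    a'.t ≤ a.t + 2 + 60 * i) ?_ n _ ?_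
  · rintro k a' ⟨i, hk, hin, ⟨gn, gN, gh⟩, ei, hm, hX, ht⟩
    have hio : a'.m .io = a.m .io := hm _ (by simp)
    simp only [ok_less, ok_var, less_ne_zero, less_eq_zero, eval_var, gn, ei, true_and]
    refine ⟨fun hlt => ?_, fun hge => ?_⟩
    · obtain ⟨hxi, hxn⟩ := hx i hlt
      simp only [wp_cons, wp_nil, wp_asg, wp_put, ok_get, ok_add, ok_sub, ok_var, ok_lit, eval_get,
        eval_add, eval_sub, eval_var, eval_lit, Store.tick_v, Store.tick_m, Store.set_v,
        Store.put_v, reduceCtorEq, if_false, if_true, ei, gn, gN, hio, hxi, true_and, and_true,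
          size_io,
        hsz, ne_eq, not_false_eq_true]
      refine ⟨⟨⟨by norm_num, by omega⟩, by omega⟩, by omega, by omega,
        ⟨⟨by norm_num, by omega⟩, by omega⟩, by omega, ⟨by norm_num, by omega⟩,
        k - 1, by omega, i + 1, by omega, by omega, ⟨by simp [gn], by simp [gN], by simp [gh]⟩,
        by simp, ?_, ?_, by simp; omega⟩
      · intro A hA
        simp [hA, hm A hA]
      · intro y hy
        by_cases hyi : y = i
        · subst hyi; simp
        · simpa [hyi] using hX y (by omega)
    · obtain rfl : i = n := by omega
      exact hQ _ ⟨by simp [gn], by simp [gN], by simp [gh]⟩ (by simpa using hm) (by simpa using hX)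
        (by simp; omega)
  · obtain ⟨gn, gN, gh⟩ := hglob
    exact ⟨0, rfl, Nat.zero_le _, ⟨by simp [gn], by simp [gN], by simp [gh]⟩, by simp, by simp,
      by simp, by simp⟩

lemma findBest_wp {M : Machine} {n N h : ℕ} (S : Setting M n N h) {a : Store} {L₁ L₂ : ℕ → ℕ}
    (hglob : Globals n N h a) (hL₁ : a.m (.L false) = L₁) (hL₂ : a.m (.L true) = L₂)
    (hL : ∀ i < n, L₁ i < n ∧ L₂ i < n) {Q : Store → Prop}
    (hQ : ∀ a' : Store, Globals n N h a' → a'.m = a.m →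
      (∀ i < n, L₁ i + L₂ i + 1 ≤ a'.v .k) →
      (a'.v .k = 0 ∨ a'.v .best < n ∧ a'.v .k = L₁ (a'.v .best) + L₂ (a'.v .best) + 1) →
      a'.t ≤ a.t + 40 * n + 20 → Q a') :
    findBest.wp M a Q := by
  obtain ⟨hcap, hnN, hhN, hw, hh⟩ := S.bound
  have hsz : ∀ A : Arr, A ≠ .io → M.size A = 4 * N := fun A hA => by rw [size_arr M hA, hcap]
  simp only [findBest, wp_cons, wp_asg, ok_lit, eval_lit]
  refine ⟨by norm_num, by norm_num, by norm_num, ?_⟩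
  refine Cmd.wp_loop (fun k a' => ∃ i, k = n - i ∧ i ≤ n ∧ Globals n N h a' ∧ a'.v .i = i ∧
    a'.m = a.m ∧ (∀ y < i, L₁ y + L₂ y + 1 ≤ a'.v .k) ∧
    (a'.v .k = 0 ∨ a'.v .best < n ∧ a'.v .k = L₁ (a'.v .best) + L₂ (a'.v .best) + 1) ∧
    a'.t ≤ a.t + 6 + 40 * i) ?_ n _ ?_
  · rintro k a' ⟨i, hk, hin, ⟨gn, gN, gh⟩, ei, hm, hle, hbest, ht⟩
    simp only [ok_less, ok_var, less_ne_zero, less_eq_zero, eval_var, gn, ei, true_and]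
    refine ⟨fun hlt => ?_, fun hge => ?_⟩
    · obtain ⟨hl1, hl2⟩ := hL i hlt
      simp only [wp_cons, wp_nil, wp_asg, wp_ite, wp_skip, ok_get, ok_add, ok_less, ok_var, ok_lit,
        eval_get, eval_add, eval_var, eval_lit, less_eq_zero, Store.tick_v,
        Store.tick_m, Store.set_v, reduceCtorEq, if_false, if_true, ei, hm, hL₁, hL₂, true_and,
        hsz, ne_eq, not_false_eq_true]
      refine ⟨⟨⟨by omega, by omega, by omega⟩, by norm_num, by omega⟩,
        fun hlt' => ⟨⟨by norm_num, by omega⟩, ?_⟩, fun hge' => ⟨⟨by norm_num, by omega⟩, ?_⟩⟩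
      · refine ⟨k - 1, by omega, i + 1, by omega, by omega, ⟨by simp [gn], by simp [gN],
          by simp [gh]⟩,
          by simp, by simp [hm], ?_, Or.inr ?_, by simp; omega⟩
        · intro y hy
          by_cases hyi : y = i
          · subst hyi; simp
          · have := hle y (by omega)
            simp; omega
        · simp [hlt]
      · refine ⟨k - 1, by omega, i + 1, by omega, by omega, ⟨by simp [gn], by simp [gN],
          by simp [gh]⟩,
          by simp, by simp [hm], ?_, by simpa using hbest, by simp; omega⟩
        intro y hy
        by_cases hyi : y = i
        · subst hyi; simpa using hge'
        · simpa using hle y (by omega)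
    · obtain rfl : i = n := by omega
      exact hQ _ ⟨by simp [gn], by simp [gN], by simp [gh]⟩ (by simpa using hm) (by simpa using hle)
        (by simpa using hbest) (by simp; omega)
  · obtain ⟨gn, gN, gh⟩ := hglob
    exact ⟨0, rfl, Nat.zero_le _, ⟨by simp [gn], by simp [gN], by simp [gh]⟩, by simp, by simp,
      by simp, by simp, by simp⟩

open Classical in
lemma markChain_wp {M : Machine} {n N h e x : ℕ} (S : Setting M n N h) {b : Bool} {a : Store}
    {X L P : ℕ → ℕ} (hglob : Globals n N h a) (hL : a.m (.L b) = L) (hP : a.m (.P b) = P)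
    (hp : ∀ a < n, L a ≠ 0 → P a < a ∧ X (P a) < X a ∧ L (P a) + 1 = L a)
    (he : e < n) (hbest : a.v .best = e) (hle : L e ≤ n) (hx : x < 64) {Q : Store → Prop}
    (hQ : ∀ a' : Store, Globals n N h a' → a'.v .best = e → a'.v .k = a.v .k →
      (∀ A, A ≠ .mark → a'.m A = a.m A) →
      (∀ y, a'.m .mark y = if InChain P e (L e) y then x else a.m .mark y) →
      a'.t ≤ a.t + 40 * n + 20 → Q a') :
    (markChain b x).wp M a Q := by
  obtain ⟨hcap, hnN, hhN, hw, hh⟩ := S.bound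
  have hsz : ∀ A : Arr, A ≠ .io → M.size A = 4 * N := fun A hA => by rw [size_arr M hA, hcap]
  obtain ⟨gn, gN, gh⟩ := hglob
  simp only [markChain, wp_cons, wp_asg, ok_get, ok_var, eval_var, eval_get, Store.set_v,
    Store.set_m, reduceCtorEq, if_false, hbest, hL, hsz, ne_eq, not_false_eq_true, true_and]
  refine ⟨by omega, ?_⟩
  refine Cmd.wp_loop (fun k a' => ∃ t, k = L e - t ∧ t ≤ L e ∧ Globals n N h a' ∧
    a'.v .q = L e - t ∧ a'.v .i = P^[t] e ∧ a'.v .best = e ∧ a'.v .k = a.v .k ∧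
    (∀ A, A ≠ .mark → a'.m A = a.m A) ∧
    (∀ y, a'.m .mark y = if InChain P e t y then x else a.m .mark y) ∧
    a'.t ≤ a.t + 10 + 40 * t) ?_ (L e) _ ?_
  · rintro k a' ⟨t, hk, htL, ⟨gn, gN, gh⟩, eq, ei, eb, ek, hm, hmark, ht⟩
    have hit := (iterate_pred hp he t htL).1
    have hP' : a'.m (.P b) = P := by rw [hm _ (by simp), hP]
    simp only [ok_var, eval_var, eq, true_and]
    refine ⟨fun hne => ?_, fun h0 => ?_⟩
    · have hit' := (iterate_pred hp he (t + 1) (by omega)).1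
      have hok : ∀ a : Store, (Ex.lit x).ok M a := fun a => hx
      have heval : ∀ a : Store, (Ex.lit x).eval a = x := fun a => rfl
      have hcost : (Ex.lit x).cost = 1 := rfl
      have hsucc : P (P^[t] e) = P^[t + 1] e := (Function.iterate_succ_apply' ..).symm
      simp only [wp_cons, wp_nil, wp_asg, wp_put, ok_get, ok_sub, ok_var, ok_lit, eval_get,
        eval_sub, eval_var, eval_lit, Store.tick_v, Store.tick_m, Store.set_v, Store.put_v,
        reduceCtorEq, if_false, if_true, ei, eq, hP', true_and, hsz, ne_eq, not_false_eq_true,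
          hok, heval,
        hcost, hsucc]
      refine ⟨by omega, by omega, by norm_num, k - 1, by omega, t + 1, by omega, by omega,
        ⟨by simp [gn], by simp [gN], by simp [gh]⟩, by omega, by simp, by simp [eb],
        by simp [ek], ?_, ?_, by simp; omega⟩
      · intro A hA
        simp [hA, hm A hA]
      · intro y
        simp only [Store.set_m, Store.put_m, Store.tick_m, if_true, Function.update_apply, hmark y]
        by_cases h1 : y = P^[t + 1] e
        · rw [if_pos h1, if_pos ⟨t + 1, by omega, le_rfl, h1.symm⟩]
        · have h2 : InChain P e (t + 1) y ↔ InChain P e t y := by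
            constructor
            · rintro ⟨s, h3, h4, h5⟩
              refine ⟨s, h3, ?_, h5⟩
              by_contra h6
              obtain rfl : s = t + 1 := by omega
              exact h1 h5.symm
            · rintro ⟨s, h3, h4, h5⟩
              exact ⟨s, h3, by omega, h5⟩
          rw [if_neg h1, if_congr h2 rfl rfl]
    · obtain rfl : t = L e := by omega
      exact hQ _ ⟨by simp [gn], by simp [gN], by simp [gh]⟩ (by simpa using eb) (by simpa using ek)
        (by simpa using hm) (by simpa using hmark) (by simp; omega)
  · refine ⟨0, rfl, Nat.zero_le _, ⟨by simp [gn], by simp [gN], by simp [gh]⟩, by simp, by simp,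
      by simp [hbest], by simp, by simp, ?_, by simp⟩
    intro y
    rw [if_neg]
    · simp
    · rintro ⟨s, h1, h2, -⟩
      omega

/-- The output consists of `k` and, for each marked position, its rank and its value. The ranks of
the positions with mark `1` are counted upwards from `1`, the others downwards from `k`. -/
lemma output_wp {M : Machine} {n N h k : ℕ} (S : Setting M n N h) {a : Store} {x mk : ℕ → ℕ}
    (hglob : Globals n N h a) (hk : a.v .k = k) (hmark : a.m .mark = mk)
    (hX : ∀ i < n, a.m (.X false) i = N + x i) (hxn : ∀ i < n, x i ≤ n)
    (hcount : Nat.count (fun z => mk z ≠ 0) n = k) {Q : Store → Prop}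
    (hQ : ∀ a' : Store, a'.m .io 0 = k →
      (∀ y < n, mk y ≠ 0 → a'.m .io (Nat.count (fun z => mk z ≠ 0) y + 1) = rank mk k y ∧
        a'.m .io (k + (Nat.count (fun z => mk z ≠ 0) y + 1)) = x y) →
      a'.t ≤ a.t + 90 * n + 30 → Q a') :
    output.wp M a Q := by
  obtain ⟨hcap, hnN, hhN, hw, hh⟩ := S.bound
  have hD := S.D
  have hsz : ∀ A : Arr, A ≠ .io → M.size A = 4 * N := fun A hA => by rw [size_arr M hA, hcap]
  have hkn : k ≤ n := hcount ▸ Nat.count_le _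
  obtain ⟨gn, gN, gh⟩ := hglob
  simp only [output, wp_cons, wp_asg, ok_var, ok_lit, eval_var, eval_lit, Store.set_v,
    reduceCtorEq, if_false, hk, true_and]
  refine ⟨by norm_num, by norm_num, by norm_num, ?_⟩
  refine Cmd.wp_loop (fun j a' => ∃ i, j = n - i ∧ i ≤ n ∧ Globals n N h a' ∧ a'.v .i = i ∧
    a'.v .k = k ∧ a'.v .q = Nat.count (fun z => mk z ≠ 0) i ∧
    a'.v .low = 1 + Nat.count (fun z => mk z = 1) i ∧
    a'.v .high = k - Nat.count (fun z => mk z ≠ 0 ∧ mk z ≠ 1) i ∧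
    (∀ A, A ≠ .io → a'.m A = a.m A) ∧
    (∀ y < i, mk y ≠ 0 → a'.m .io (Nat.count (fun z => mk z ≠ 0) y + 1) = rank mk k y ∧
      a'.m .io (k + (Nat.count (fun z => mk z ≠ 0) y + 1)) = x y) ∧
    a'.t ≤ a.t + 10 + 90 * i) ?_ n _ ?_
  · rintro j a' ⟨i, hj, hin, ⟨gn, gN, gh⟩, ei, ek, eq, el, eh, hm, hout, ht⟩
    have hmark' : a'.m .mark = mk := by rw [hm _ (by simp), hmark]
    have hX' : a'.m (.X false) = a.m (.X false) := hm _ (by simp)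
    simp only [ok_less, ok_var, less_ne_zero, less_eq_zero, eval_var, gn, ei, true_and]
    refine ⟨fun hlt => ?_, fun hge => ?_⟩
    · have hXi : a.m (.X false) i - N = x i := by rw [hX i hlt]; omega
      have hci : Nat.count (fun z => mk z ≠ 0) i ≤ i := Nat.count_le _
      have hc1 : Nat.count (fun z => mk z = 1) i ≤ i := Nat.count_le _
      -- Cells that belong to earlier marks have other addresses than those written now.
      have hcount' : mk i ≠ 0 → Nat.count (fun z => mk z ≠ 0) i + 1 ≤ k := fun h0 =>
        hcount ▸ count_lt_count (p := fun z => mk z ≠ 0) hlt h0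
      have hold : ∀ y < i, mk y ≠ 0 → Nat.count (fun z => mk z ≠ 0) y <
          Nat.count (fun z => mk z ≠ 0) i := fun y hy h0 =>
        count_lt_count (p := fun z => mk z ≠ 0) hy h0
      have hs0 : Nat.count (fun z => mk z ≠ 0) (i + 1) =
        Nat.count (fun z => mk z ≠ 0) i + if mk i ≠ 0 then 1 else 0 := Nat.count_succ ..
      have hs1 : Nat.count (fun z => mk z = 1) (i + 1) =
        Nat.count (fun z => mk z = 1) i + if mk i = 1 then 1 else 0 := Nat.count_succ ..
      have hs2 : Nat.count (fun z => mk z ≠ 0 ∧ mk z ≠ 1) (i + 1) =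
        Nat.count (fun z => mk z ≠ 0 ∧ mk z ≠ 1) i + if mk i ≠ 0 ∧ mk i ≠ 1 then 1 else 0 :=
        Nat.count_succ ..
      generalize hc : Nat.count (fun z => mk z ≠ 0) i = c at *
      generalize hd1 : Nat.count (fun z => mk z = 1) i = c1 at *
      generalize hd2 : Nat.count (fun z => mk z ≠ 0 ∧ mk z ≠ 1) i = c2 at *
      -- The invariant for the next round, if the two cells have been written.
      have hnew : ∀ f : ℕ → ℕ, mk i ≠ 0 → f (c + 1) = rank mk k i → f (k + (c + 1)) = x i →
          (∀ z, z ≠ c + 1 → z ≠ k + (c + 1) → f z = a'.m .io z) →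
          ∀ y < i + 1, mk y ≠ 0 → f (Nat.count (fun z => mk z ≠ 0) y + 1) = rank mk k y ∧
            f (k + (Nat.count (fun z => mk z ≠ 0) y + 1)) = x y := by
        intro f h0 h1 h2 h3 y hy hy0
        have h4 := hcount' h0
        by_cases hyi : y = i
        · subst hyi; rw [hc]; exact ⟨h1, h2⟩
        · have h5 := hold y (by omega) hy0
          rw [h3 _ (by omega) (by omega), h3 _ (by omega) (by omega)]
          exact hout y (by omega) hy0
      simp only [wp_cons, wp_nil, wp_asg, wp_put, wp_ite, wp_skip, ok_get, ok_add, ok_sub, ok_equal,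
        ok_var, ok_lit, eval_get, eval_add, eval_sub, eval_var, eval_lit,
        equal_eq_zero, Store.tick_v, Store.tick_m, Store.set_v, Store.put_v, Store.set_m,
        reduceCtorEq, if_false, if_true, ei, ek, eq, el, eh, gN, hmark', hX', hXi, true_and,
          and_true, size_io,
        hsz, ne_eq, not_false_eq_true]
      refine ⟨by omega, fun h0 => ?_, fun h0 => ?_⟩
      · have h1 := hcount' h0
        refine ⟨⟨by norm_num, by omega⟩, by omega, by omega, by omega, by norm_num,
          fun hone => ⟨by omega, ⟨by norm_num, by omega⟩, ⟨by norm_num, by omega⟩, ?_⟩,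
          fun hone => ⟨by omega, by norm_num, ⟨by norm_num, by omega⟩, ?_⟩⟩
        · refine ⟨j - 1, by omega, i + 1, by omega, by omega,
            ⟨by simp [gn], by simp [gN], by simp [gh]⟩, by simp, ?_, ?_, ?_, ?_, ?_,
            by simp; omega⟩
          · rw [hs0, if_pos h0]
          · rw [hs1, if_pos (not_not.1 hone)]; omega
          · rw [hs2, if_neg (by tauto)]; simp
          · intro A hA
            simp [hA, hm A hA]
          · refine hnew _ h0 ?_ ?_ ?_
            · simp [rank, hone, hd1]
            · simp; rw [Function.update_of_ne (by omega), Function.update_self]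
            · intro z h2 h3
              simp [h2, h3]
        · refine ⟨j - 1, by omega, i + 1, by omega, by omega,
            ⟨by simp [gn], by simp [gN], by simp [gh]⟩, by simp, ?_, ?_, ?_, ?_, ?_,
            by simp; omega⟩
          · rw [hs0, if_pos h0]
          · rw [hs1, if_neg hone]; simp
          · rw [hs2, if_pos ⟨h0, hone⟩]; omega
          · intro A hA
            simp [hA, hm A hA]
          · refine hnew _ h0 ?_ ?_ ?_
            · simp only [rank, if_neg hone, hd2]; simp
            · simp; rw [Function.update_of_ne (by omega), Function.update_self]
            · intro z h2 h3
              simp [h2, h3]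
      · refine ⟨⟨by norm_num, by omega⟩, j - 1, by omega, i + 1, by omega, by omega,
            ⟨by simp [gn], by simp [gN], by simp [gh]⟩, by simp, ?_, ?_, ?_, ?_, ?_,
            by simp; omega⟩
        · rw [hs0, if_neg (by simpa using h0)]; simp
        · rw [hs1, if_neg (by omega)]; simp
        · rw [hs2, if_neg (by tauto)]; simp
        · intro A hA
          simp [hm A hA]
        · intro y hy hy0
          have hyi : y ≠ i := by rintro rfl; exact hy0 h0
          simpa using hout y (by omega) hy0
    · obtain rfl : i = n := by omega
      simp only [wp_nil, wp_put, ok_var, ok_lit, eval_var, eval_lit, size_io,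
        Store.tick_v, ek, true_and]
      refine ⟨by norm_num, by omega, hQ _ (by simp) ?_ (by simp; omega)⟩
      intro y hy hy0
      simpa using hout y hy hy0
  · exact ⟨0, rfl, Nat.zero_le _, ⟨by simp [gn], by simp [gN], by simp [gh]⟩, by simp, by simp [hk],
      by simp, by simp, by simp, by simp, by simp, by simp⟩

/-- The algorithm finds an optimal index, marks an increasing and a decreasing chain of predecessors
and writes the pattern that they form. -/
lemma algorithm_wp {M : Machine} {n N h g : ℕ} (S : Setting M n N h) (hg : h < 2 ^ g)
    (hmin : ∀ h', n + 2 ≤ 2 ^ h' → h ≤ h') {a : Store} {x : ℕ → ℕ} (hn : a.v .n = n)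
    (hx : ∀ i < n, a.m .io (i + 1) = x i ∧ 1 ≤ x i ∧ x i ≤ n)
    (hinj : ∀ i < n, ∀ j < n, x i = x j → i = j)
    (hzero : ∀ A, A ≠ .io → a.m A = 0) {Q : Store → Prop}
    (hQ : ∀ (a' : Store) (k : ℕ) (L₁ L₂ mk : ℕ → ℕ),
      (∀ a b, a < b → b < n → x a < x b → L₁ a < L₁ b) →
      (∀ a b, a < b → b < n → x b < x a → L₂ a < L₂ b) →
      (∀ i < n, L₁ i + L₂ i + 1 ≤ k) →
      Marking n x mk → Nat.count (fun z => mk z ≠ 0) n = k →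
      a'.m .io 0 = k →
      (∀ y < n, mk y ≠ 0 → a'.m .io (Nat.count (fun z => mk z ≠ 0) y + 1) = rank mk k y ∧
        a'.m .io (k + (Nat.count (fun z => mk z ≠ 0) y + 1)) = x y) →
      a'.t ≤ a.t + n * (120 * g + 2900) + 900 * h + 600 → Q a') :
    algorithm.wp M a Q := by
  obtain ⟨hcap, hnN, hhN, hw, hh⟩ := S.bound
  have hsz : ∀ A : Arr, A ≠ .io → M.size A = 4 * N := fun A hA => by rw [size_arr M hA, hcap]
  simp only [algorithm, wp_cons]
  refine setup_wp S hmin hn fun a₁ hg₁ hm₁ ht₁ => ?_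
  refine loadKeys_wp S (x := x) hg₁ (fun i hi => ?_) fun a₂ hg₂ hm₂ hX₂ ht₂ => ?_
  · rw [hm₁]
    exact ⟨(hx i hi).1, (hx i hi).2.2⟩
  have hz₂ : ∀ A, A ≠ .io → (∀ b, A ≠ .X b) → a₂.m A = 0 := fun A h1 h2 => by
    rw [hm₂ A h2, hm₁, hzero A h1]
  refine pass_wp S hg (b := false) (X := a₂.m (.X false)) (fun i hi => ?_) (fun i hi j hj hij => ?_)
    hg₂ rfl (fun A hA => ?_) fun a₃ hg₃ hm₃ hl₃ ht₃ => ?_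
  · have := hx i hi
    rw [(hX₂ i hi).1]
    omega
  · rw [(hX₂ i hi).1, (hX₂ j hj).1] at hij
    exact hinj i hi j hj (by omega)
  · simp only [workArrays, List.mem_cons, List.not_mem_nil, or_false] at hA
    exact hz₂ A (by rintro rfl; simp at hA) (by rintro b rfl; simp at hA)
  refine pass_wp S hg (b := true) (X := a₂.m (.X true)) (fun i hi => ?_) (fun i hi j hj hij => ?_)
    hg₃ (hm₃ _ (by simp [workArrays])) (fun A hA => ?_) fun a₄ hg₄ hm₄ hl₄ ht₄ => ?_
  · have := hx i hi
    rw [(hX₂ i hi).2]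
    omega
  · have h1 := hx i hi
    have h2 := hx j hj
    rw [(hX₂ i hi).2, (hX₂ j hj).2] at hij
    exact hinj i hi j hj (by omega)
  · simp only [workArrays, List.mem_cons, List.not_mem_nil, or_false] at hA
    rw [hm₃]
    · exact hz₂ A (by rintro rfl; simp at hA) (by rintro b rfl; simp at hA)
    · simp only [workArrays, List.mem_cons, List.not_mem_nil, or_false]
      rintro h1
      rcases hA with rfl | rfl | rfl | rfl | rfl | rfl | rfl | rfl | rfl <;> simp at h1
  obtain ⟨l₁, hln₁, H₁⟩ := hl₃
  obtain ⟨l₂, hln₂, H₂⟩ := hl₄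
  have hL₁ : a₄.m (.L false) = a₃.m (.L false) := hm₄ _ (by simp [workArrays])
  have hP₁ : a₄.m (.P false) = a₃.m (.P false) := hm₄ _ (by simp [workArrays])
  have hmark₄ : a₄.m .mark = 0 := by
    rw [hm₄ _ (by simp [workArrays]), hm₃ _ (by simp [workArrays]), hz₂ _ (by simp) (by simp)]
  have hX₄ : a₄.m (.X false) = a₂.m (.X false) := by
    rw [hm₄ _ (by simp [workArrays]), hm₃ _ (by simp [workArrays])]
  have hX : ∀ a < n, ∀ b < n, a₂.m (.X true) a < a₂.m (.X true) b ↔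
      a₂.m (.X false) b < a₂.m (.X false) a := by
    intro a ha b hb
    have h1 := hx a ha
    have h2 := hx b hb
    rw [(hX₂ a ha).1, (hX₂ a ha).2, (hX₂ b hb).1, (hX₂ b hb).2]
    omega
  have hx₁ : ∀ a < n, ∀ b < n, a₂.m (.X false) a < a₂.m (.X false) b ↔ x a < x b := by
    intro a ha b hb
    rw [(hX₂ a ha).1, (hX₂ b hb).1]
    omega
  rw [← hL₁, ← hP₁] at H₁
  generalize hX₁e : a₂.m (.X false) = X₁ at *
  generalize hX₂e : a₂.m (.X true) = X₂ at *
  generalize hL₁e : a₄.m (.L false) = L₁ at *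
  generalize hL₂e : a₄.m (.L true) = L₂ at *
  generalize hP₁e : a₄.m (.P false) = P₁ at *
  generalize hP₂e : a₄.m (.P true) = P₂ at *
  have hL : ∀ i < n, L₁ i < n ∧ L₂ i < n := fun i hi =>
    ⟨(H₁.tail_le i hi).1.trans_le hln₁, (H₂.tail_le i hi).1.trans_le hln₂⟩
  refine findBest_wp S hg₄ hL₁e hL₂e hL fun a₅ hg₅ hm₅ hle hbest ht₅ => ?_
  -- The output, given the final marks.
  have finish : ∀ (a₆ : Store) (mk : ℕ → ℕ), Globals n N h a₆ → a₆.v .k = a₅.v .k →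
      (∀ A, A ≠ .mark → a₆.m A = a₅.m A) → a₆.m .mark = mk → Marking n X₁ mk →
      Nat.count (fun z => mk z ≠ 0) n = a₅.v .k → a₆.t ≤ a₅.t + 80 * n + 60 →
      (Cmd.block [output]).wp M a₆ Q := by
    intro a₆ mk hg₆ hk₆ hm₆ hmark₆ hM hcount ht₆
    rw [wp_cons]
    refine output_wp S (x := x) hg₆ hk₆ hmark₆ (fun i hi => ?_) (fun i hi => (hx i hi).2.2) hcount
      fun a₇ h0 hout ht₇ => ?_
    · rw [hm₆ _ (by simp), hm₅, hX₄, (hX₂ i hi).1]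
    · rw [wp_nil]
      refine hQ _ (a₅.v .k) L₁ L₂ mk (fun a b hab hb h1 => ?_) (fun a b hab hb h1 => ?_) hle
        ⟨fun a b hab ha hb => ?_, fun a b hab ha ha' hb => ?_, hM.lt⟩ hcount h0 hout ?_
      · exact H₁.incr a b hab hb ((hx₁ a (by omega) b hb).2 h1)
      · exact H₂.incr a b hab hb ((hX a (by omega) b hb).2 ((hx₁ b hb a (by omega)).2 h1))
      · exact (hx₁ a (hM.lt a (by omega)) b (hM.lt b hb)).1 (hM.low a b hab ha hb)
      · exact (hx₁ b (hM.lt b hb) a (hM.lt a ha)).1 (hM.high a b hab ha ha' hb)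
      · simp only [Store.tick_t]
        have h2 : n * (120 * g + 2900) = 2 * (n * (60 * g + 1300)) + 300 * n := by ring
        obtain ⟨C, hC⟩ : ∃ C, C = n * (60 * g + 1300) := ⟨_, rfl⟩
        rw [← hC] at h2 ht₃ ht₄
        omega
  simp only [wp_ite, ok_var, eval_var, true_and, wp_skip]
  refine ⟨fun hk => ?_, fun hk => ?_⟩
  · obtain ⟨hb, hkb⟩ := hbest.resolve_left hk
    generalize hbe : a₅.v .best = e at *
    have hLe := hL e hb
    simp only [wp_cons, wp_nil, wp_put, ok_var, ok_lit, eval_var, eval_lit, hsz, ne_eq,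
      reduceCtorEq,
      not_false_eq_true, Store.tick_v, hbe, true_and]
    refine ⟨by norm_num, by omega, ?_⟩
    refine markChain_wp S (e := e) (X := X₁) (L := L₁) (P := P₁) ⟨?_, ?_, ?_⟩ ?_ ?_ H₁.pred hb ?_
      hLe.1.le (by norm_num) fun a₆ hg₆ hb₆ hk₆ hm₆ hmark₆ ht₆ => ?_
    · simp [hg₅.n]
    · simp [hg₅.N]
    · simp [hg₅.h]
    · simp [hm₅, hL₁e]
    · simp [hm₅, hP₁e]
    · simp [hbe]
    refine markChain_wp S (e := e) (X := X₂) (L := L₂) (P := P₂) hg₆ ?_ ?_ H₂.pred hb hb₆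
      hLe.2.le (by norm_num) fun a₇ hg₇ hb₇ hk₇ hm₇ hmark₇ ht₇ => ?_
    · rw [hm₆ _ (by simp)]; simp [hm₅, hL₂e]
    · rw [hm₆ _ (by simp)]; simp [hm₅, hP₂e]
    obtain ⟨hM, hcount⟩ := chainMarks_spec H₁.pred H₂.pred hX hb
    refine finish _ (chainMarks P₁ P₂ e (L₁ e) (L₂ e)) ⟨?_, ?_, ?_⟩ ?_ (fun A hA => ?_) ?_ hM ?_ ?_
    · simp [hg₇.n]
    · simp [hg₇.N]
    · simp [hg₇.h]
    · simp [hk₇, hk₆]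
    · simp [hm₇ A hA, hm₆ A hA, hA]
    · funext y
      rw [Store.tick_m, hmark₇, hmark₆, chainMarks]
      simp [hm₅, hmark₄, Function.update_apply]
    · rw [hcount, hkb]
    · simp at ht₆ ht₇ ⊢
      omega
  · have hn0 : n = 0 := by
      by_contra h0
      have := hle 0 (by omega)
      omega
    refine finish _ 0 ⟨?_, ?_, ?_⟩ ?_ (fun A hA => ?_) ?_ ⟨?_, ?_, ?_⟩ ?_ ?_
    · simp [hg₅.n]
    · simp [hg₅.N]
    · simp [hg₅.h]
    · simp
    · simp
    · simp [hm₅, hmark₄]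
    · simp
    · simp
    · simp
    · simp [hk, hn0]
    · simp; omega

/-! ### The machine and its initial state -/

/-- The height of the trie: the least `h` with `n + 2 ≤ 2 ^ h`. -/
def height (n : ℕ) : ℕ := Nat.clog 2 (n + 2)

lemma le_two_pow_height (n : ℕ) : n + 2 ≤ 2 ^ height n := Nat.le_pow_clog (by norm_num) _

lemma height_pos (n : ℕ) : 0 < height n :=
  Nat.clog_pos (b := 2) (n := n + 2) (by norm_num) (by omega)

lemma two_pow_height_pred_lt (n : ℕ) : 2 ^ (height n - 1) < n + 2 :=
  Nat.pow_pred_clog_lt_self (b := 2) (x := n + 2) (by norm_num) (by omega)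

lemma two_pow_height_lt (n : ℕ) : 2 ^ height n < 2 * (n + 2) := by
  have h1 := two_pow_height_pred_lt n
  have h2 := height_pos n
  rw [show height n = height n - 1 + 1 by omega, pow_succ]
  omega

/-- The number of memory cells. -/
def cells (n : ℕ) : ℕ := 2 * n + 2 + 32 * (4 * 2 ^ height n)

/-- The number of rounds of the binary searches. -/
def rounds (n : ℕ) : ℕ := Nat.log 2 (height n) + 1

/-- The bound for the running time. -/
def timeBound (n : ℕ) : ℕ := n * (120 * rounds n + 2900) + 900 * height n + 604

/-- The machine for inputs of length `n`. -/
def machine (n : ℕ) : Machine where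
  w := height n + 10
  s := cells n
  D := 2 * n + 2
  cap := 4 * 2 ^ height n
  fits := le_rfl
  small := by
    have := le_two_pow_height n
    rw [pow_add, cells]
    omega
  large := by
    have := le_two_pow_height n
    rw [pow_add]
    omega

lemma machine_setting (n : ℕ) : Setting (machine n) n (2 ^ height n) (height n) :=
  ⟨rfl, le_two_pow_height n, rfl, rfl⟩

/-- The word RAM program: it initializes the registers for the array start and the input length and
runs the algorithm. -/
def program : Program :=
  .seq (.instr (.load 1 0)) (.seq (.instr (.op .add 0 1 1)) (.seq (.instr (.const 100 2))
    (.seq (.instr (.op .add 0 0 100)) algorithm.comp)))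

/-- The store that the initial state represents. -/
def initialStore (n : ℕ) (input : List ℕ) : Store where
  v r := if r = .n then n else 0
  m A i := if A = .io then input.getD i 0 else 0
  t := 0

lemma program_runs {n : ℕ} {xs : List ℕ} (hlen : xs.length = n) (hxs : ∀ y ∈ xs, y ≤ n)
    {Q : Store → Prop} (hQ : algorithm.wp (machine n) (initialStore n (n :: xs)) Q) :
    ∃ t σ a, Runs (machine n).w (machine n).s program (initialState (n :: xs)) t σ ∧
      Rep (machine n) σ a ∧ t ≤ a.t + 4 ∧ Q a := by
  have hw := (machine_setting n).bound
  obtain ⟨-, hn, -, hw, -⟩ := hw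
  have hle : ∀ y ∈ n :: xs, y ≤ n := by
    intro y hy
    rcases List.mem_cons.1 hy with rfl | h
    · exact le_rfl
    · exact hxs y h
  have hmem : ∀ y, (n :: xs).getD y 0 ≤ n := by
    intro y
    by_cases hy : y < (n :: xs).length
    · rw [List.getD_eq_getElem _ _ hy]
      exact hle _ (List.getElem_mem hy)
    · rw [List.getD_eq_default _ _ (by omega)]
      exact Nat.zero_le _
  have hs : 0 < (machine n).s := by
    change 0 < cells n
    unfold cells
    omega
  have hload : (Instr.load 1 0).exec (machine n).w (machine n).s (initialState (n :: xs)) =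
      some ⟨Function.update (fun _ => 0) 1 n, fun y => (n :: xs).getD y 0⟩ := by
    change (if 0 < (machine n).s then _ else _) = _
    rw [if_pos hs]
    exact setReg_eq (w := (machine n).w) (v := n) (by omega)
  obtain ⟨t, σ, a, hr, hσ, ht, ha⟩ := Cmd.ends_comp algorithm hQ
    ⟨Function.update (Function.update (Function.update (Function.update (fun _ => 0) 1 n) 0 (n + n))
      100 2) 0 (n + n + 2), fun y => (n :: xs).getD y 0⟩
    { reg := fun r => by cases r <;> simp [Reg.idx, initialStore]
      base := by simp [machine]; omega
      reg_lt := update_lt (update_lt (update_lt (update_lt (fun _ => by omega) (by omega))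
        (by omega)) (by omega)) (by omega)
      mem_lt := fun y => (hmem y).trans_lt (by omega)
      arr := fun A i hA => by
        rw [initialStore]
        simp only [if_neg hA]
        exact List.getD_eq_default _ _ (by simp [hlen, machine]; omega)
      io := fun i _ => by simp [initialStore] }
  refine ⟨1 + (1 + (1 + (1 + t))), σ, a, .seq (.instr hload) (.seq (.instr (setReg_eq ?_))
    (.seq (.instr (setReg_eq ?_)) (.seq (.instr (setReg_eq ?_)) ?_))), hσ, ?_, ha⟩
  · simp [Op.eval]; omega
  · omega
  · simp [Op.eval]; omega
  · simpa [Op.eval] using hr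
  · simp [initialStore] at ht
    omega

/-! ### Correctness -/

lemma oneLine_getD {n : ℕ} (π : Equiv.Perm (Fin n)) {i : ℕ} (hi : i < n) :
    (oneLine π).getD i 0 = π ⟨i, hi⟩ + 1 := by
  rw [List.getD_eq_getElem _ _ (by simpa [oneLine] using hi)]
  simp [oneLine]

/-- The program computes a longest avoiding pattern and one of its occurrences. -/
theorem program_computes {n : ℕ} (π : Equiv.Perm (Fin n)) :
    ∃ (k : ℕ) (σ : Equiv.Perm (Fin k)) (f : Fin k ↪o Fin n),
      IsLongestAvoidingPattern σ π ∧ IsMatching σ π f ∧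
      Computes program (height n + 10) (cells n) (timeBound n)
        (n :: oneLine π) (k :: (oneLine σ ++ subsequenceAt π f)) := by
  have S := machine_setting n
  obtain ⟨-, hn, -, hw, -⟩ := S.bound
  have hlen : (oneLine π).length = n := by simp [oneLine]
  have hval : ∀ y ∈ oneLine π, y ≤ n := by
    intro y hy
    simp only [oneLine, List.mem_ofFn] at hy
    obtain ⟨i, rfl⟩ := hy
    exact (π i).2
  obtain ⟨t, τ, a, hr, hτ, ht, k, L₁, L₂, mk, h1, h2, hk, hM, hcount, h0, hout, hta⟩ :=
    program_runs hlen hval (Q := fun a' => ∃ (k : ℕ) (L₁ L₂ mk : ℕ → ℕ),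
      (∀ a b, a < b → b < n → (oneLine π).getD a 0 < (oneLine π).getD b 0 → L₁ a < L₁ b) ∧
      (∀ a b, a < b → b < n → (oneLine π).getD b 0 < (oneLine π).getD a 0 → L₂ a < L₂ b) ∧
      (∀ i < n, L₁ i + L₂ i + 1 ≤ k) ∧ Marking n (fun i => (oneLine π).getD i 0) mk ∧
      Nat.count (fun z => mk z ≠ 0) n = k ∧ a'.m .io 0 = k ∧
      (∀ y < n, mk y ≠ 0 → a'.m .io (Nat.count (fun z => mk z ≠ 0) y + 1) = rank mk k y ∧
        a'.m .io (k + (Nat.count (fun z => mk z ≠ 0) y + 1)) = (oneLine π).getD y 0) ∧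
      a'.t ≤ n * (120 * rounds n + 2900) + 900 * height n + 600)
    (algorithm_wp S (x := fun i => (oneLine π).getD i 0) (g := rounds n)
      (Nat.lt_pow_succ_log_self (by norm_num) _)
      (fun h' hh' => (Nat.clog_le_iff_le_pow (by norm_num)).2 hh')
      (by simp [initialStore])
      (fun i hi => ⟨by simp [initialStore], by rw [oneLine_getD π hi]; omega,
        by rw [oneLine_getD π hi]; exact (π ⟨i, hi⟩).2⟩)
      (fun i hi j hj hij => by
        simp only [oneLine_getD π hi, oneLine_getD π hj] at hij
        have h3 : (⟨i, hi⟩ : Fin n) = ⟨j, hj⟩ := π.injective (Fin.ext (by omega))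
        simpa using h3)
      (fun A hA => by funext i; simp [initialStore, hA])
      (fun a' k L₁ L₂ mk h1 h2 h3 h4 h5 h6 h7 h8 =>
        ⟨k, L₁, L₂, mk, h1, h2, h3, h4, h5, h6, h7, by simpa [initialStore] using h8⟩))
  have hx : ∀ i : Fin n, (oneLine π).getD i 0 = π i + 1 := fun i => oneLine_getD π i.2
  obtain ⟨σ, f, hσ, hav, hf⟩ := hM.exists_pattern hx hcount
  have hkn : k ≤ n := hcount ▸ Nat.count_le _
  have hcells : 2 * n + 2 ≤ cells n := by unfold cells; omega
  have hio : ∀ j : Fin k, τ.mem (j + 1) = σ j + 1 ∧ τ.mem (k + (j + 1)) = π (f j) + 1 := by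
    intro j
    obtain ⟨h3, h4, h5⟩ := hf j
    obtain ⟨h6, h7⟩ := hout (f j) (f j).2 h3
    rw [h4] at h6 h7
    have hj := j.2
    have hD : (machine n).D = 2 * n + 2 := rfl
    rw [hτ.io _ (by omega), hτ.io _ (by omega), h6, h7, h5, hx]
    exact ⟨rfl, rfl⟩
  refine ⟨k, σ, f, ⟨hav, ⟨f, hσ⟩, fun m ρ hρ hm => length_le_of_avoids hx h1 h2 hk hρ hm⟩, hσ,
    ?_, ?_, ?_, t, ?_, τ, hr, ?_⟩
  · simp [oneLine]; omega
  · simp [oneLine, subsequenceAt]; omega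
  · intro y hy
    change y < 2 ^ (machine n).w
    rcases List.mem_cons.1 hy with rfl | h3
    · omega
    · have := hval y h3
      omega
  · unfold timeBound
    omega
  · refine List.ext_getElem (by simp) fun i hi hi' => ?_
    simp only [List.getElem_map, List.getElem_range]
    simp only [List.length_cons, List.length_append, oneLine, subsequenceAt, List.length_ofFn]
      at hi'
    rcases i with _ | i
    · rw [List.getElem_cons_zero, hτ.io 0 (by change 0 < 2 * n + 2; omega), h0]
    · rw [List.getElem_cons_succ]
      by_cases hik : i < k
      · rw [List.getElem_append_left (by simpa [oneLine] using hik)]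
        simpa [oneLine] using (hio ⟨i, hik⟩).1
      · rw [List.getElem_append_right (by simpa [oneLine] using hik)]
        have h3 := (hio ⟨i - k, by omega⟩).2
        simp only [show k + (i - k + 1) = i + 1 by omega] at h3
        simpa [oneLine, subsequenceAt] using h3

/-! ### Asymptotic bounds -/

lemma height_le_log {n : ℕ} (hn : 2 ≤ n) : (height n : ℝ) ≤ 7 * Real.log n := by
  have hn' : (2 : ℝ) ≤ n := by exact_mod_cast hn
  have h2 := Real.log_two_gt_d9
  have hlog : Real.log 2 ≤ Real.log n := Real.log_le_log (by norm_num) hn'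
  have h1 : ((2 : ℝ) ^ (height n - 1)) ≤ (n : ℝ) ^ 2 := by
    have h3 : ((2 ^ (height n - 1) : ℕ) : ℝ) < ((n + 2 : ℕ) : ℝ) := by
      exact_mod_cast two_pow_height_pred_lt n
    push_cast at h3
    nlinarith
  have h4 := Real.log_le_log (by positivity) h1
  rw [Real.log_pow, Real.log_pow, Nat.cast_sub (height_pos n)] at h4
  push_cast at h4
  have h5 : (1 : ℝ) ≤ height n := by exact_mod_cast height_pos n
  nlinarith

lemma rounds_le {n : ℕ} (hn : 2 ≤ n) (h1 : 1 ≤ Real.log (Real.log n)) :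
    (rounds n : ℝ) ≤ 15 * Real.log (Real.log n) := by
  have h2 := Real.log_two_gt_d9
  have hlog : Real.log 2 ≤ Real.log n :=
    Real.log_le_log (by norm_num) (by exact_mod_cast hn)
  have h3 : ((2 : ℝ) ^ Nat.log 2 (height n)) ≤ 7 * Real.log n := by
    refine le_trans ?_ (height_le_log hn)
    exact_mod_cast Nat.pow_log_le_self 2 (height_pos n).ne'
  have h4 := Real.log_le_log (by positivity) h3
  rw [Real.log_pow, Real.log_mul (by norm_num) (by linarith)] at h4
  have h5 : Real.log 7 ≤ 6 := by
    have := Real.log_le_sub_one_of_pos (show (0 : ℝ) < 7 by norm_num)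
    linarith
  have h6 : (0 : ℝ) ≤ Nat.log 2 (height n) := Nat.cast_nonneg _
  rw [rounds]
  push_cast
  nlinarith

lemma height_isBigO : (fun n : ℕ => ((height n + 10 : ℕ) : ℝ)) =O[Filter.atTop]
    fun n : ℕ => Real.log (n : ℝ) := by
  refine Asymptotics.IsBigO.of_bound 27 ?_
  filter_upwards [Filter.eventually_ge_atTop 2] with n hn
  have h1 := height_le_log hn
  have h2 := Real.log_two_gt_d9
  have hlog : Real.log 2 ≤ Real.log n := Real.log_le_log (by norm_num) (by exact_mod_cast hn)
  rw [Real.norm_of_nonneg (Nat.cast_nonneg _), Real.norm_of_nonneg (by linarith)]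
  push_cast
  linarith

lemma cells_isBigO : (fun n : ℕ => (cells n : ℝ)) =O[Filter.atTop] fun n : ℕ => (n : ℝ) := by
  refine Asymptotics.IsBigO.of_bound 1000 ?_
  filter_upwards [Filter.eventually_ge_atTop 1] with n hn
  rw [Real.norm_of_nonneg (Nat.cast_nonneg _), Real.norm_of_nonneg (Nat.cast_nonneg _)]
  have h1 : cells n ≤ 1000 * n := by
    have := two_pow_height_lt n
    unfold cells
    omega
  exact_mod_cast h1

lemma timeBound_isBigO : (fun n : ℕ => (timeBound n : ℝ)) =O[Filter.atTop]
    fun n : ℕ => (n : ℝ) * Real.log (Real.log (n : ℝ)) := by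
  refine Asymptotics.IsBigO.of_bound 20000 ?_
  have hlim : Filter.Tendsto (fun n : ℕ => Real.log (Real.log (n : ℝ))) Filter.atTop Filter.atTop :=
    Real.tendsto_log_atTop.comp (Real.tendsto_log_atTop.comp tendsto_natCast_atTop_atTop)
  filter_upwards [Filter.eventually_ge_atTop 2, hlim.eventually_ge_atTop 1] with n hn hll
  have hn' : (2 : ℝ) ≤ n := by exact_mod_cast hn
  have h1 := rounds_le hn hll
  have h2 : (height n : ℝ) ≤ 7 * n := by
    have := Real.log_le_sub_one_of_pos (show (0 : ℝ) < n by linarith)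
    linarith [height_le_log hn]
  rw [Real.norm_of_nonneg (Nat.cast_nonneg _),
    Real.norm_of_nonneg (mul_nonneg (Nat.cast_nonneg _) (by linarith))]
  rw [timeBound]
  push_cast
  have h3 : (n : ℝ) * rounds n ≤ n * (15 * Real.log (Real.log n)) :=
    mul_le_mul_of_nonneg_left h1 (by linarith)
  have h4 : (n : ℝ) * 1 ≤ n * Real.log (Real.log n) := mul_le_mul_of_nonneg_left hll (by linarith)
  linarith

end AvoidingPattern

theorem mainTheorem5 :
    ∃ (p : WordRAM.Program) (w s T : ℕ → ℕ),
      ((fun n : ℕ => (w n : ℝ)) =O[Filter.atTop] fun n : ℕ => Real.log (n : ℝ)) ∧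
      ((fun n : ℕ => (s n : ℝ)) =O[Filter.atTop] fun n : ℕ => (n : ℝ)) ∧
      ((fun n : ℕ => (T n : ℝ)) =O[Filter.atTop]
        fun n : ℕ => (n : ℝ) * Real.log (Real.log (n : ℝ))) ∧
      ∀ (n : ℕ) (π : Equiv.Perm (Fin n)),
        ∃ (k : ℕ) (σ : Equiv.Perm (Fin k)) (f : Fin k ↪o Fin n),
          IsLongestAvoidingPattern σ π ∧ IsMatching σ π f ∧
          WordRAM.Computes p (w n) (s n) (T n)
            (n :: oneLine π) (k :: (oneLine σ ++ subsequenceAt π f)) :=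
  ⟨AvoidingPattern.program, fun n => AvoidingPattern.height n + 10, AvoidingPattern.cells,
    AvoidingPattern.timeBound, AvoidingPattern.height_isBigO, AvoidingPattern.cells_isBigO,
    AvoidingPattern.timeBound_isBigO, fun _ π => AvoidingPattern.program_computes π⟩
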